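/- **Language.** Fix a countably infinite set of variable names $x$. Types, expressions and programs of (extended) Qunity are $$T ::= \mathtt{Void}\mid\mathtt{Unit}\mid T\oplus T\mid T\otimes T,$$ $$e ::= ()\mid x\mid (e,e)\mid \mathtt{ctrl}\,e\,\{e_1\mapsto e_1';\dots;e_n\mapsto e_n'\}^{T}_{T'}\mid \mathtt{match}\,e\,\{e_1\mapsto e_1';\dots;e_n\mapsto e_n'\}^{T}_{T'}\mid \mathtt{try}\ e\ \mathtt{catch}\ e\mid f\,e ,$$ $$f ::= \mathtt{u3}(r,r,r)\mid \mathtt{left}_{T_0,T_1}\mid \mathtt{right}_{T_0,T_1}\mid \lambda e\xmapsto{T}e\mid \mathtt{rphase}_T\{e,r,r'\}\mid \mathtt{pmatch}\{e_1\mapsto e_1';\dots;e_n\mapsto e_n'\}^{T}_{T'}$$ with $r\in\mathbb R$ and $n\ge 0$. Put $\mathrm{Bit}=\mathtt{Unit}\oplus\mathtt{Unit}$ and $\mathtt{gphase}_T(r)=\mathtt{rphase}_T\{y,r,r\}$ for a variable $y$. $FV(e)$ is the set of free variables: left-hand sides of $\mathtt{ctrl}$ and $\mathtt{match}$ bind their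 variables in the corresponding right-hand sides, and programs are closed, so $FV(f\,e)=FV(e)$. $\mathrm{classical}(e)$ means that neither $\mathtt{u3}$ nor $\mathtt{rphase}$ occurs anywhere in $e$. A context $\Gamma$ or $\Delta$ is a finite (unordered) set of bindings $x:T$ with no variable bound twice; writing $\Delta,\Delta'$ presupposes disjoint domains. **Typing.** The judgments $\Gamma\parallel\Delta\vdash e:T$ (pure), $\Gamma\parallel\Delta\Vdash e:T$ (mixed), $\vdash f:T\rightsquigarrow T'$ (coherent map), $\vdash f:T\Rrightarrow T'$ (channel), $\mathrm{ortho}$, $\mathrm{spanning}$, $\mathrm{iso}$ and $\mathrm{erases}$ are the least ones closed under the following rules. *Pure.* $\Gamma\parallel\varnothing\vdash():\mathtt{Unit}$; $\Gamma\parallel\varnothing\vdash x:T$ if $(x:T)\in\Gamma$; $\Gamma\parallel x:T\vdash x:T$ if $x\notin\mathrm{dom}\,\Gamma$; if $\Gamma\parallel\Delta,\Delta_i\vdash e_i:T_i$ $(i=0,1)$ then $\Gamma\parallel\Delta,\Delta_0,\Delta_1\vdash(e_0,e_1):T_0\otimes T_1$; if $\vdash f:T\rightsquigarrow T'$ and $\Gamma\parallel\Delta\vdash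 e:T$ then $\Gamma\parallel\Delta\vdash f\,e:T'$; if $\Gamma\parallel\Delta\Vdash e:T$, $\mathrm{ortho}_T(e_1,\dots,e_n)$, for all $j$: $\varnothing\parallel\Gamma_j\vdash e_j:T$, $\mathrm{classical}(e_j)$ and $\Gamma,\Gamma_j\parallel\Delta,\Delta'\vdash e_j':T'$, and $\mathrm{erases}_{T'}(x;e_1',\dots,e_n')$ for all $x\in\mathrm{dom}\,\Delta$, then $\Gamma\parallel\Delta,\Delta'\vdash\mathtt{ctrl}\,e\,\{e_j\mapsto e_j'\}^T_{T'}:T'$. *Mixed.* If $\Gamma\parallel\Delta\vdash e:T$ then $\Gamma\parallel\Delta\Vdash e:T$; if $\Gamma\parallel\Delta\Vdash e:T$ then $\Gamma\parallel\Delta,\Delta_0\Vdash e:T$ (discarding); pairs and applications as in the pure case with $\Vdash$ and $\Rrightarrow$; if $\Gamma\parallel\Delta_i\Vdash e_i:T$ then $\Gamma\parallel\Delta_0,\Delta_1\Vdash\mathtt{try}\ e_0\ \mathtt{catch}\ e_1:T$; if $\Gamma\parallel\Delta,\Delta_0\Vdash e:T$, $\mathrm{ortho}_T(e_1,\dots,e_n)$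 and for all $j$: $\varnothing\parallel\Gamma_j\vdash e_j:T$, $\mathrm{classical}(e_j)$, $\Gamma,\Gamma_j\parallel\Delta,\Delta_1\Vdash e_j':T'$, then $\Gamma\parallel\Delta,\Delta_0,\Delta_1\Vdash\mathtt{match}\,e\,\{e_j\mapsto e_j'\}^T_{T'}:T'$. *Programs.* $\vdash\mathtt{u3}(r_\theta,r_\phi,r_\lambda):\mathrm{Bit}\rightsquigarrow\mathrm{Bit}$; $\vdash\mathtt{left}_{T_0,T_1}:T_0\rightsquigarrow T_0\oplus T_1$; $\vdash\mathtt{right}_{T_0,T_1}:T_1\rightsquigarrow T_0\oplus T_1$; if $\varnothing\parallel\Delta\vdash e:T$ then $\vdash\mathtt{rphase}_T\{e,r,r'\}:T\rightsquigarrow T$, and moreover $\vdash\lambda e\xmapsto{T}e':T\rightsquigarrow T'$ if $\varnothing\parallel\Delta\vdash e':T'$, and $\vdash\lambda e\xmapsto{T}e':T\Rrightarrow T'$ if $\varnothing\parallel\Delta\Vdash e':T'$; if $\mathrm{ortho}_T(e_1,\dots,e_n)$, $\mathrm{ortho}_{T'}(e_1',\dots,e_n')$, $\varnothing\parallel\Delta_j\vdash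 e_j:T$ and $\varnothing\parallel\Delta_j\vdash e_j':T'$ for all $j$, then $\vdash\mathtt{pmatch}\{e_j\mapsto e_j'\}^T_{T'}:T\rightsquigarrow T'$; if $\vdash f:T\rightsquigarrow T'$ then $\vdash f:T\Rrightarrow T'$. *Orthogonality.* $\mathrm{ortho}_{\mathtt{Void}}()$; $\mathrm{ortho}_{\mathtt{Unit}}(())$; $\mathrm{ortho}_T(x)$; (O-IsoApp) if $\mathrm{ortho}_T(e_1,\dots,e_n)$, $\vdash f:T\rightsquigarrow T'$ and $\mathrm{iso}(f)$ then $\mathrm{ortho}_{T'}(f\,e_1,\dots,f\,e_n)$; (sum) if $\mathrm{ortho}_{T_0}(e_1,\dots,e_n)$ and $\mathrm{ortho}_{T_1}(e_1',\dots,e_{n'}')$ then $\mathrm{ortho}_{T_0\oplus T_1}(\mathtt{left}\,e_1,\dots,\mathtt{left}\,e_n,\mathtt{right}\,e_1',\dots,\mathtt{right}\,e'_{n'})$; (pair) if $\mathrm{ortho}_{T_0}(e_1,\dots,e_m)$ and, for all $j$, $\mathrm{ortho}_{T_1}(e_{j,1}',\dots,e_{j,n_j}')$ and $FV(e_j)\cap\bigcup_{k\le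 n_j}FV(e_{j,k}')=\varnothing$, then $\mathrm{ortho}_{T_0\otimes T_1}$ holds of the sequence of all $(e_j,e_{j,k}')$ in lexicographic order of $(j,k)$; every subsequence of a sequence satisfying $\mathrm{ortho}_T$ satisfies $\mathrm{ortho}_T$. *Spanning.* The same rules with $\mathrm{spanning}$ for $\mathrm{ortho}$, but without the subsequence rule, and with the additional premise $\dim\mathcal H(T)=\dim\mathcal H(T')$ in the rule for applying an isometric $f$. *Isometry.* $\mathrm{iso}$ holds of $()$, $x$, $\mathtt{u3}(\cdot)$, $\mathtt{left}$, $\mathtt{right}$; of $(e_0,e_1)$ if of $e_0$ and $e_1$; of $f\,e$ if of $f$ and $e$; of $\mathtt{try}\ e_0\ \mathtt{catch}\ e_1$ if of $e_0$ or of $e_1$; of $\mathtt{ctrl}$ and $\mathtt{match}\ e\,\{e_j\mapsto e_j'\}^T_{T'}$ if $\mathrm{classical}(e)$, $\mathrm{iso}(e)$, $\mathrm{spanning}_T(e_1,\dots,e_n)$ and $\mathrm{iso}(e_j')$ for all $j$; of $\lambda e\xmapsto{T}e'$ if $\mathrm{spanning}_T(e)$ and $\mathrm{iso}(e')$; of $\mathtt{rphase}_T\{e,r,r'\}$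 if of $e$; of $\mathtt{pmatch}\{e_j\mapsto e_j'\}^T_{T'}$ if $\mathrm{spanning}_T(e_1,\dots,e_n)$ and $\mathrm{iso}(e_j')$ for all $j$. *Erasure.* $\mathrm{erases}_T(x;x,\dots,x)$; $\mathrm{erases}_{T_0\otimes T_1}(x;(e_{0,1},e_{1,1}),\dots,(e_{0,n},e_{1,n}))$ if $\mathrm{erases}_{T_i}(x;e_{i,1},\dots,e_{i,n})$ for $i=0$ or for $i=1$; in a sequence satisfying $\mathrm{erases}_T(x;\cdot)$ an entry $e$ may be replaced by $\mathtt{gphase}_T(r)\,e$, and a block of consecutive entries $e_1',\dots,e_m'$ ($m\ge0$) by the single entry $\mathtt{ctrl}\,e\,\{e_1\mapsto e_1';\dots;e_m\mapsto e_m'\}^{T'}_{T}$, provided that $x$ is not captured, i.e. $x\notin FV(e_k)$ for all $k\le m$. **Semantics.** $\mathbb V(\mathtt{Void})=\varnothing$, $\mathbb V(\mathtt{Unit})=\{()\}$, $\mathbb V(T_0\oplus T_1)=\{\mathtt{left}\,v\}\cup\{\mathtt{right}\,v\}$, $\mathbb V(T_0\otimes T_1)=\{(v_0,v_1)\}$ with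 $v$'s ranging over the values of the components; $\mathbb V(\Delta)$ is the set of valuations $\tau$ giving each binding $x:T$ of $\Delta$ a value in $\mathbb V(T)$. $\mathcal H(T)$ and $\mathcal H(\Delta)$ are the finite-dimensional complex Hilbert spaces with orthonormal bases $|v\rangle$, $v\in\mathbb V(T)$, and $|\tau\rangle$, $\tau\in\mathbb V(\Delta)$ (so $\oplus$ and $\otimes$ of types give $\oplus$ and $\otimes$ of spaces). By recursion on typing derivations one defines operators $[\![\sigma:\Gamma\parallel\Delta\vdash e:T]\!]:\mathcal H(\Delta)\to\mathcal H(T)$ and superoperators $[\![\sigma:\Gamma\parallel\Delta\Vdash e:T]\!]:\mathcal L(\mathcal H(\Delta))\to\mathcal L(\mathcal H(T))$ for $\sigma\in\mathbb V(\Gamma)$, and likewise $[\![\vdash f:T\rightsquigarrow T']\!]:\mathcal H(T)\to\mathcal H(T')$, $[\![\vdash f:T\Rrightarrow T']\!]:\mathcal L(\mathcal H(T))\to\mathcal L(\mathcal H(T'))$ (the evident judgments are abbreviated below, and $[\![e]\!]_\sigma$ indicates $\sigma$). *Pure expressions:* $[\![()]\!]|\varnothing\rangle=|()\rangle$; $[\![x]\!]_\sigma|\varnothing\rangle=|\sigma(x)\rangle$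 for classical $x$; $[\![x]\!]|x\mapsto v\rangle=|v\rangle$ for quantum $x$; $[\![(e_0,e_1)]\!]_\sigma|\tau,\tau_0,\tau_1\rangle=[\![e_0]\!]_\sigma|\tau,\tau_0\rangle\otimes[\![e_1]\!]_\sigma|\tau,\tau_1\rangle$; $[\![f\,e]\!]_\sigma=[\![f]\!][\![e]\!]_\sigma$; and $$[\![\mathtt{ctrl}\,e\,\{e_j\mapsto e_j'\}^T_{T'}]\!]_\sigma|\tau,\tau'\rangle=\sum_{v\in\mathbb V(T)}\langle v|[\![e]\!]_\sigma(|\tau\rangle\langle\tau|)|v\rangle\sum_{j=1}^n\sum_{\sigma_j\in\mathbb V(\Gamma_j)}\langle\sigma_j|[\![e_j]\!]^\dagger|v\rangle\,[\![e_j']\!]_{\sigma,\sigma_j}|\tau,\tau'\rangle .$$ *Coherent maps:* $\mathtt{u3}$ maps $|0\rangle$ to $\cos(r_\theta/2)|0\rangle+e^{ir_\phi}\sin(r_\theta/2)|1\rangle$ and $|1\rangle$ to $-e^{ir_\lambda}\sin(r_\theta/2)|0\rangle+e^{i(r_\phi+r_\lambda)}\cos(r_\theta/2)|1\rangle$, where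 $|0\rangle=|\mathtt{left}\,()\rangle$, $|1\rangle=|\mathtt{right}\,()\rangle$; $\mathtt{left}|v\rangle=|\mathtt{left}\,v\rangle$, $\mathtt{right}|v\rangle=|\mathtt{right}\,v\rangle$; $[\![\lambda e\mapsto e']\!]=[\![e']\!][\![e]\!]^\dagger$; $[\![\mathtt{rphase}\{e,r,r'\}]\!]=e^{ir}[\![e]\!][\![e]\!]^\dagger+e^{ir'}(\mathbb I-[\![e]\!][\![e]\!]^\dagger)$; $[\![\mathtt{pmatch}\{e_j\mapsto e_j'\}]\!]=\sum_j[\![e_j']\!][\![e_j]\!]^\dagger$. *Mixed expressions and channels* (extended linearly): a pure expression or coherent map $A$ gives $\rho\mapsto A\rho A^\dagger$; discarding gives $\rho\otimes\rho_0\mapsto\mathrm{tr}(\rho_0)[\![e]\!]_\sigma(\rho)$; a pair maps $|\tau,\tau_0,\tau_1\rangle\langle\tau',\tau_0',\tau_1'|$ to $[\![e_0]\!]_\sigma(|\tau,\tau_0\rangle\langle\tau',\tau_0'|)\otimes[\![e_1]\!]_\sigma(|\tau,\tau_1\rangle\langle\tau',\tau_1'|)$; $\mathtt{try}\ e_0\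 \mathtt{catch}\ e_1$ maps $\rho_0\otimes\rho_1$ to $\mathrm{tr}(\rho_1)[\![e_0]\!]_\sigma(\rho_0)+(\mathrm{tr}\,\rho_0-\mathrm{tr}\,[\![e_0]\!]_\sigma(\rho_0))[\![e_1]\!]_\sigma(\rho_1)$; application is composition; $\lambda e\mapsto e'$ gives $\rho\mapsto[\![e']\!]([\![e]\!]^\dagger\rho[\![e]\!])$; and $\mathtt{match}$ maps $|\tau,\tau_0,\tau_1\rangle\langle\tau',\tau_0',\tau_1'|$ to $$\sum_{v\in\mathbb V(T)}\langle v|[\![e]\!]_\sigma(|\tau,\tau_0\rangle\langle\tau',\tau_0'|)|v\rangle\sum_{j=1}^n\sum_{\sigma_j\in\mathbb V(\Gamma_j)}\langle\sigma_j|[\![e_j]\!]^\dagger|v\rangle\,[\![e_j']\!]_{\sigma,\sigma_j}(|\tau,\tau_1\rangle\langle\tau',\tau_1'|).$$ **Lemma.** Suppose that $\mathrm{ortho}_T(e_1,\dots,e_n)$ holds and let $i\neq j$. Then for all quantum contexts $\Delta_i,\Delta_j$ and all derivations of $\varnothing\parallel\Delta_i\vdash e_i:T$ and $\varnothing\parallel\Delta_j\vdash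 e_j:T$, the images of the operators $$[\![\varnothing:\varnothing\parallel\Delta_i\vdash e_i:T]\!]:\mathcal H(\Delta_i)\to\mathcal H(T),\qquad [\![\varnothing:\varnothing\parallel\Delta_j\vdash e_j:T]\!]:\mathcal H(\Delta_j)\to\mathcal H(T)$$ are orthogonal subspaces of $\mathcal H(T)$. -/

import Mathlib

open scoped BigOperators Matrix

namespace Qunity

/-! ### Syntax -/

/-- Variable names. -/
abbrev Var : Type := ℕ

/-- Data types: `Void`, `Unit`, `T ⊕ T`, `T ⊗ T`. -/
inductive Ty : Type
  | void : Ty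
  | unit : Ty
  | sum (T₀ T₁ : Ty) : Ty
  | tensor (T₀ T₁ : Ty) : Ty
  deriving DecidableEq

/-- `Bit = Unit ⊕ Unit`. -/
abbrev Ty.bit : Ty := Ty.sum Ty.unit Ty.unit

mutual
  /-- Expressions.  A block of `n` branches `e₁ ↦ e₁', …, eₙ ↦ eₙ'` is given by the two families
  `p` (left-hand sides) and `b` (right-hand sides) indexed by `Fin n`. -/
  inductive Expr : Type
    | unit : Expr
    | var (x : Var) : Expr
    | pair (e₀ e₁ : Expr) : Expr
    | ctrl (e : Expr) (T : Ty) (n : ℕ) (p b : Fin n → Expr) (T' : Ty) : Expr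
    | mmatch (e : Expr) (T : Ty) (n : ℕ) (p b : Fin n → Expr) (T' : Ty) : Expr
    | tryCatch (e₀ e₁ : Expr) : Expr
    | app (f : Prog) (e : Expr) : Expr
  /-- Programs.  `lam T e e'` is the abstraction `λ e ↦ e'` with input type `T`. -/
  inductive Prog : Type
    | u3 (rθ rφ rl : ℝ) : Prog
    | left (T₀ T₁ : Ty) : Prog
    | right (T₀ T₁ : Ty) : Prog
    | lam (T : Ty) (e e' : Expr) : Prog
    | rphase (T : Ty) (e : Expr) (r r' : ℝ) : Prog
    | pmatch (T : Ty) (n : ℕ) (p b : Fin n → Expr) (T' : Ty) : Prog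
end

/-- The global phase program `gphase_T(r)`, that is `rphase_T {y, r, r}` for a variable `y`. -/
def Prog.gphase (T : Ty) (y : Var) (r : ℝ) : Prog := Prog.rphase T (Expr.var y) r r

/-- Free variables.  The left-hand sides of `ctrl` and `match` bind their variables in the
corresponding right-hand sides; programs are closed. -/
def Expr.FV : Expr → Finset Var
  | .unit => ∅
  | .var x => {x}
  | .pair e₀ e₁ => e₀.FV ∪ e₁.FV
  | .ctrl e _ _ p b _ => e.FV ∪ Finset.univ.biUnion fun k => (b k).FV \ (p k).FV
  | .mmatch e _ _ p b _ => e.FV ∪ Finset.univ.biUnion fun k => (b k).FV \ (p k).FV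
  | .tryCatch e₀ e₁ => e₀.FV ∪ e₁.FV
  | .app _ e => e.FV

mutual
  /-- `classical(e)`: no use of `u3` or `rphase` anywhere in `e`. -/
  def Expr.Classical : Expr → Prop
    | .unit => True
    | .var _ => True
    | .pair e₀ e₁ => e₀.Classical ∧ e₁.Classical
    | .ctrl e _ _ p b _ => e.Classical ∧ ∀ k, (p k).Classical ∧ (b k).Classical
    | .mmatch e _ _ p b _ => e.Classical ∧ ∀ k, (p k).Classical ∧ (b k).Classical
    | .tryCatch e₀ e₁ => e₀.Classical ∧ e₁.Classical
    | .app f e => f.Classical ∧ e.Classical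
  /-- No use of `u3` or `rphase` anywhere in a program. -/
  def Prog.Classical : Prog → Prop
    | .u3 _ _ _ => False
    | .left _ _ => True
    | .right _ _ => True
    | .lam _ e e' => e.Classical ∧ e'.Classical
    | .rphase _ _ _ _ => False
    | .pmatch _ _ p b _ => ∀ k, (p k).Classical ∧ (b k).Classical
end

/-! ### Contexts -/

/-- A typing context: a finite set of bindings `x : T` in which no variable is bound twice. -/
@[ext]
structure Ctx : Type where
  bindings : Finset (Var × Ty)
  functional : ∀ x T T', (x, T) ∈ bindings → (x, T') ∈ bindings → T = T'

/-- The empty context. -/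
def Ctx.empty : Ctx := ⟨∅, by simp⟩

/-- The context `x : T`. -/
def Ctx.single (x : Var) (T : Ty) : Ctx :=
  ⟨{(x, T)}, by
    intro y S S' h h'
    simp only [Finset.mem_singleton, Prod.mk.injEq] at h h'
    exact h.2.trans h'.2.symm⟩

/-- The set of variables bound by a context. -/
def Ctx.dom (Δ : Ctx) : Finset Var := Δ.bindings.image Prod.fst

/-- `Join A B C` says that `A` and `B` bind disjoint sets of variables and that `C` is the
context `A, B`. -/
structure Ctx.Join (A B C : Ctx) : Prop where
  disjoint : Disjoint A.dom B.dom
  union : C.bindings = A.bindings ∪ B.bindings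

theorem Ctx.Join.left_sub {A B C : Ctx} (h : Ctx.Join A B C) : A.bindings ⊆ C.bindings := by
  rw [h.union]; exact Finset.subset_union_left

theorem Ctx.Join.right_sub {A B C : Ctx} (h : Ctx.Join A B C) : B.bindings ⊆ C.bindings := by
  rw [h.union]; exact Finset.subset_union_right

/-- With `D₀ = Δ, Δ₀` and `D₁ = Δ, Δ₁` and `D = Δ, Δ₀, Δ₁`, the context `D₁` is part of `D`. -/
theorem Ctx.Join.second_sub {Δ Δ₀ Δ₁ D₀ D₁ D : Ctx} (h₀ : Ctx.Join Δ Δ₀ D₀)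
    (h₁ : Ctx.Join Δ Δ₁ D₁) (h : Ctx.Join D₀ Δ₁ D) : D₁.bindings ⊆ D.bindings := by
  rw [h₁.union]
  exact Finset.union_subset (h₀.left_sub.trans h.left_sub) h.right_sub

/-! ### Values, valuations and Hilbert spaces -/

/-- The set `𝕍(T)` of classical expressions (values) of type `T`: no value of type `Void`, the
value `()`, the values `left v₀` and `right v₁`, and the pairs `(v₀, v₁)`. -/
def Val : Ty → Type
  | .void => Empty
  | .unit => Unit
  | .sum T₀ T₁ => Val T₀ ⊕ Val T₁
  | .tensor T₀ T₁ => Val T₀ × Val T₁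

instance Val.instFintype : (T : Ty) → Fintype (Val T)
  | .void => inferInstanceAs (Fintype Empty)
  | .unit => inferInstanceAs (Fintype Unit)
  | .sum T₀ T₁ =>
    letI := Val.instFintype T₀
    letI := Val.instFintype T₁
    inferInstanceAs (Fintype (Val T₀ ⊕ Val T₁))
  | .tensor T₀ T₁ =>
    letI := Val.instFintype T₀
    letI := Val.instFintype T₁
    inferInstanceAs (Fintype (Val T₀ × Val T₁))

instance Val.instDecidableEq : (T : Ty) → DecidableEq (Val T)
  | .void => inferInstanceAs (DecidableEq Empty)
  | .unit => inferInstanceAs (DecidableEq Unit)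
  | .sum T₀ T₁ =>
    letI := Val.instDecidableEq T₀
    letI := Val.instDecidableEq T₁
    inferInstanceAs (DecidableEq (Val T₀ ⊕ Val T₁))
  | .tensor T₀ T₁ =>
    letI := Val.instDecidableEq T₀
    letI := Val.instDecidableEq T₁
    inferInstanceAs (DecidableEq (Val T₀ × Val T₁))

/-- The set `𝕍(Δ)` of valuations of a context: a value of type `T` for each binding `x : T`. -/
abbrev Valuation (Δ : Ctx) : Type := (b : Δ.bindings) → Val b.1.2

/-- The valuation of the empty context. -/
def Valuation.empty : Valuation Ctx.empty := fun b => absurd b.2 (Finset.notMem_empty _)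

/-- Restriction of a valuation to a smaller context. -/
def Valuation.restrict {A C : Ctx} (h : A.bindings ⊆ C.bindings) (τ : Valuation C) :
    Valuation A := fun b => τ ⟨b.1, h b.2⟩

/-- The valuation `σ, σ'` of the context `A, B`. -/
def Valuation.join {A B C : Ctx} (h : Ctx.Join A B C) (σ : Valuation A) (σ' : Valuation B) :
    Valuation C := fun b =>
  if hb : b.1 ∈ A.bindings then σ ⟨b.1, hb⟩
  else σ' ⟨b.1, (Finset.mem_union.mp (h.union ▸ b.2)).resolve_left hb⟩

/-- The Hilbert space `ℋ(T)`, with its orthonormal basis `|v⟩`, `v ∈ 𝕍(T)`.  As `𝕍` turns `⊕` into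
a disjoint union and `⊗` into a product, this is the direct sum, respectively the tensor product,
of the spaces of the components. -/
abbrev Hilb (T : Ty) : Type := EuclideanSpace ℂ (Val T)

/-- The Hilbert space `ℋ(Δ)`, with its orthonormal basis `|τ⟩`, `τ ∈ 𝕍(Δ)`. -/
abbrev HilbCtx (Δ : Ctx) : Type := EuclideanSpace ℂ (Valuation Δ)

/-! ### The erasure judgment -/

/-- `erases_T(x; e₁, …, eₙ)`.  In the rule for `ctrl`, the free variable `x` must not be captured
by the variables that the left-hand sides bind. -/
inductive Erases : Ty → Var → List Expr → Prop
  | gphase {T : Ty} {x : Var} {l₁ l₂ : List Expr} {e : Expr} (y : Var) (r : ℝ) :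
      Erases T x (l₁ ++ e :: l₂) →
      Erases T x (l₁ ++ Expr.app (Prog.gphase T y r) e :: l₂)
  | ctrl {T T' : Ty} {x : Var} {l₁ l₂ : List Expr} {e : Expr} {n : ℕ} {p b : Fin n → Expr} :
      (∀ k, x ∉ (p k).FV) →
      Erases T x (l₁ ++ List.ofFn b ++ l₂) →
      Erases T x (l₁ ++ Expr.ctrl e T' n p b T :: l₂)
  | var {T : Ty} {x : Var} (n : ℕ) : Erases T x (List.replicate n (Expr.var x))
  | pair₀ {T₀ T₁ : Ty} {x : Var} {l : List (Expr × Expr)} :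
      Erases T₀ x (l.map Prod.fst) →
      Erases (Ty.tensor T₀ T₁) x (l.map fun q => Expr.pair q.1 q.2)
  | pair₁ {T₀ T₁ : Ty} {x : Var} {l : List (Expr × Expr)} :
      Erases T₁ x (l.map Prod.snd) →
      Erases (Ty.tensor T₀ T₁) x (l.map fun q => Expr.pair q.1 q.2)

/-! ### Typing, orthogonality, spanning and isometry judgments

The judgments are mutually inductive.  They are families of types, whose elements are the
derivation trees, because the semantics is defined by recursion on typing derivations. -/

mutual
  /-- `Γ ∥ Δ ⊢ e : T`, pure expression typing. -/
  inductive PureTyping : Ctx → Ctx → Expr → Ty → Type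
    | unit {Γ : Ctx} : PureTyping Γ Ctx.empty Expr.unit Ty.unit
    | cvar {Γ : Ctx} {x : Var} {T : Ty} (h : (x, T) ∈ Γ.bindings) :
        PureTyping Γ Ctx.empty (Expr.var x) T
    | qvar {Γ : Ctx} {x : Var} {T : Ty} (h : x ∉ Γ.dom) :
        PureTyping Γ (Ctx.single x T) (Expr.var x) T
    | pair {Γ Δ Δ₀ Δ₁ D₀ D₁ D : Ctx} {e₀ e₁ : Expr} {T₀ T₁ : Ty}
        (h₀ : Ctx.Join Δ Δ₀ D₀) (h₁ : Ctx.Join Δ Δ₁ D₁) (h : Ctx.Join D₀ Δ₁ D)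
        (d₀ : PureTyping Γ D₀ e₀ T₀) (d₁ : PureTyping Γ D₁ e₁ T₁) :
        PureTyping Γ D (Expr.pair e₀ e₁) (Ty.tensor T₀ T₁)
    | app {Γ Δ : Ctx} {f : Prog} {e : Expr} {T T' : Ty}
        (df : CohTyping f T T') (de : PureTyping Γ Δ e T) :
        PureTyping Γ Δ (Expr.app f e) T'
    | ctrl {Γ Δ Δ' D : Ctx} {e : Expr} {T T' : Ty} {n : ℕ} {p b : Fin n → Expr}
        {Γp Γb : Fin n → Ctx}
        (hD : Ctx.Join Δ Δ' D) (hΓ : ∀ j, Ctx.Join Γ (Γp j) (Γb j))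
        (de : MixedTyping Γ Δ e T)
        (ho : Ortho T (List.ofFn p))
        (dp : ∀ j, PureTyping Ctx.empty (Γp j) (p j) T)
        (hc : ∀ j, (p j).Classical)
        (her : ∀ x ∈ Δ.dom, Erases T' x (List.ofFn b))
        (db : ∀ j, PureTyping (Γb j) D (b j) T') :
        PureTyping Γ D (Expr.ctrl e T n p b T') T'
  /-- `Γ ∥ Δ ⊩ e : T`, mixed expression typing. -/
  inductive MixedTyping : Ctx → Ctx → Expr → Ty → Type
    | mix {Γ Δ : Ctx} {e : Expr} {T : Ty} (d : PureTyping Γ Δ e T) : MixedTyping Γ Δ e T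
    | discard {Γ Δ Δ₀ D : Ctx} {e : Expr} {T : Ty} (h : Ctx.Join Δ Δ₀ D)
        (d : MixedTyping Γ Δ e T) : MixedTyping Γ D e T
    | pair {Γ Δ Δ₀ Δ₁ D₀ D₁ D : Ctx} {e₀ e₁ : Expr} {T₀ T₁ : Ty}
        (h₀ : Ctx.Join Δ Δ₀ D₀) (h₁ : Ctx.Join Δ Δ₁ D₁) (h : Ctx.Join D₀ Δ₁ D)
        (d₀ : MixedTyping Γ D₀ e₀ T₀) (d₁ : MixedTyping Γ D₁ e₁ T₁) :
        MixedTyping Γ D (Expr.pair e₀ e₁) (Ty.tensor T₀ T₁)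
    | tryCatch {Γ Δ₀ Δ₁ D : Ctx} {e₀ e₁ : Expr} {T : Ty} (h : Ctx.Join Δ₀ Δ₁ D)
        (d₀ : MixedTyping Γ Δ₀ e₀ T) (d₁ : MixedTyping Γ Δ₁ e₁ T) :
        MixedTyping Γ D (Expr.tryCatch e₀ e₁) T
    | app {Γ Δ : Ctx} {f : Prog} {e : Expr} {T T' : Ty}
        (df : ChanTyping f T T') (de : MixedTyping Γ Δ e T) :
        MixedTyping Γ Δ (Expr.app f e) T'
    | mmatch {Γ Δ Δ₀ Δ₁ D₀ D₁ D : Ctx} {e : Expr} {T T' : Ty} {n : ℕ} {p b : Fin n → Expr}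
        {Γp Γb : Fin n → Ctx}
        (h₀ : Ctx.Join Δ Δ₀ D₀) (h₁ : Ctx.Join Δ Δ₁ D₁) (h : Ctx.Join D₀ Δ₁ D)
        (hΓ : ∀ j, Ctx.Join Γ (Γp j) (Γb j))
        (de : MixedTyping Γ D₀ e T)
        (ho : Ortho T (List.ofFn p))
        (dp : ∀ j, PureTyping Ctx.empty (Γp j) (p j) T)
        (hc : ∀ j, (p j).Classical)
        (db : ∀ j, MixedTyping (Γb j) D₁ (b j) T') :
        MixedTyping Γ D (Expr.mmatch e T n p b T') T'
  /-- `⊢ f : T ⇝ T'`, typing of programs as coherent maps. -/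
  inductive CohTyping : Prog → Ty → Ty → Type
    | u3 (rθ rφ rl : ℝ) : CohTyping (Prog.u3 rθ rφ rl) Ty.bit Ty.bit
    | left (T₀ T₁ : Ty) : CohTyping (Prog.left T₀ T₁) T₀ (Ty.sum T₀ T₁)
    | right (T₀ T₁ : Ty) : CohTyping (Prog.right T₀ T₁) T₁ (Ty.sum T₀ T₁)
    | lam {Δ : Ctx} {e e' : Expr} {T T' : Ty}
        (d : PureTyping Ctx.empty Δ e T) (d' : PureTyping Ctx.empty Δ e' T') :
        CohTyping (Prog.lam T e e') T T'
    | rphase {Δ : Ctx} {e : Expr} {T : Ty} (r r' : ℝ) (d : PureTyping Ctx.empty Δ e T) :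
        CohTyping (Prog.rphase T e r r') T T
    | pmatch {T T' : Ty} {n : ℕ} {p b : Fin n → Expr} {Δ : Fin n → Ctx}
        (ho : Ortho T (List.ofFn p)) (dp : ∀ j, PureTyping Ctx.empty (Δ j) (p j) T)
        (ho' : Ortho T' (List.ofFn b)) (db : ∀ j, PureTyping Ctx.empty (Δ j) (b j) T') :
        CohTyping (Prog.pmatch T n p b T') T T'
  /-- `⊢ f : T ⇛ T'`, typing of programs as quantum channels. -/
  inductive ChanTyping : Prog → Ty → Ty → Type
    | channel {f : Prog} {T T' : Ty} (d : CohTyping f T T') : ChanTyping f T T'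
    | lam {Δ : Ctx} {e e' : Expr} {T T' : Ty}
        (d : PureTyping Ctx.empty Δ e T) (d' : MixedTyping Ctx.empty Δ e' T') :
        ChanTyping (Prog.lam T e e') T T'
  /-- `ortho_T(e₁, …, eₙ)`, the orthogonality judgment. -/
  inductive Ortho : Ty → List Expr → Type
    | void : Ortho Ty.void []
    | unit : Ortho Ty.unit [Expr.unit]
    | var (T : Ty) (x : Var) : Ortho T [Expr.var x]
    | isoApp {T T' : Ty} {f : Prog} {l : List Expr}
        (h : Ortho T l) (df : CohTyping f T T') (hf : IsoProg f) : Ortho T' (l.map (Expr.app f))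
    | sum {T₀ T₁ : Ty} {l l' : List Expr} (h : Ortho T₀ l) (h' : Ortho T₁ l') :
        Ortho (Ty.sum T₀ T₁)
          (l.map (Expr.app (Prog.left T₀ T₁)) ++ l'.map (Expr.app (Prog.right T₀ T₁)))
    /-- `l` lists the expressions `eⱼ`, each with its list `eⱼ₁', …, eⱼₙ'`. -/
    | pair {T₀ T₁ : Ty} {l : List (Expr × List Expr)}
        (h : Ortho T₀ (l.map Prod.fst)) (h' : ∀ q ∈ l, Ortho T₁ q.2)
        (hfv : ∀ q ∈ l, ∀ e' ∈ q.2, Disjoint q.1.FV e'.FV) :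
        Ortho (Ty.tensor T₀ T₁) (l.flatMap fun q => q.2.map (Expr.pair q.1))
    | sub {T : Ty} {l l' : List Expr} (h : Ortho T l') (hs : List.Sublist l l') : Ortho T l
  /-- `spanning_T(e₁, …, eₙ)`, the spanning judgment.  In `unApp`, the premise that `f` is unitary
  means that it is isometric and that its two types have spaces of the same dimension. -/
  inductive Spanning : Ty → List Expr → Type
    | void : Spanning Ty.void []
    | unit : Spanning Ty.unit [Expr.unit]
    | var (T : Ty) (x : Var) : Spanning T [Expr.var x]
    | unApp {T T' : Ty} {f : Prog} {l : List Expr}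
        (h : Spanning T l) (df : CohTyping f T T') (hf : IsoProg f)
        (hdim : Module.finrank ℂ (Hilb T) = Module.finrank ℂ (Hilb T')) :
        Spanning T' (l.map (Expr.app f))
    | sum {T₀ T₁ : Ty} {l l' : List Expr} (h : Spanning T₀ l) (h' : Spanning T₁ l') :
        Spanning (Ty.sum T₀ T₁)
          (l.map (Expr.app (Prog.left T₀ T₁)) ++ l'.map (Expr.app (Prog.right T₀ T₁)))
    | pair {T₀ T₁ : Ty} {l : List (Expr × List Expr)}
        (h : Spanning T₀ (l.map Prod.fst)) (h' : ∀ q ∈ l, Spanning T₁ q.2)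
        (hfv : ∀ q ∈ l, ∀ e' ∈ q.2, Disjoint q.1.FV e'.FV) :
        Spanning (Ty.tensor T₀ T₁) (l.flatMap fun q => q.2.map (Expr.pair q.1))
  /-- `iso(e)`, the isometry judgment for expressions. -/
  inductive IsoExpr : Expr → Type
    | unit : IsoExpr Expr.unit
    | var (x : Var) : IsoExpr (Expr.var x)
    | pair {e₀ e₁ : Expr} (h₀ : IsoExpr e₀) (h₁ : IsoExpr e₁) : IsoExpr (Expr.pair e₀ e₁)
    | ctrl {e : Expr} {T T' : Ty} {n : ℕ} {p b : Fin n → Expr}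
        (hc : e.Classical) (he : IsoExpr e) (hs : Spanning T (List.ofFn p))
        (hb : ∀ j, IsoExpr (b j)) : IsoExpr (Expr.ctrl e T n p b T')
    | mmatch {e : Expr} {T T' : Ty} {n : ℕ} {p b : Fin n → Expr}
        (hc : e.Classical) (he : IsoExpr e) (hs : Spanning T (List.ofFn p))
        (hb : ∀ j, IsoExpr (b j)) : IsoExpr (Expr.mmatch e T n p b T')
    | tryLeft {e₀ e₁ : Expr} (h : IsoExpr e₀) : IsoExpr (Expr.tryCatch e₀ e₁)
    | catchRight {e₀ e₁ : Expr} (h : IsoExpr e₁) : IsoExpr (Expr.tryCatch e₀ e₁)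
    | app {f : Prog} {e : Expr} (hf : IsoProg f) (he : IsoExpr e) : IsoExpr (Expr.app f e)
  /-- `iso(f)`, the isometry judgment for programs. -/
  inductive IsoProg : Prog → Type
    | u3 (rθ rφ rl : ℝ) : IsoProg (Prog.u3 rθ rφ rl)
    | left (T₀ T₁ : Ty) : IsoProg (Prog.left T₀ T₁)
    | right (T₀ T₁ : Ty) : IsoProg (Prog.right T₀ T₁)
    | lam {T : Ty} {e e' : Expr} (hs : Spanning T [e]) (h : IsoExpr e') :
        IsoProg (Prog.lam T e e')
    | rphase {T : Ty} {e : Expr} {r r' : ℝ} (h : IsoExpr e) : IsoProg (Prog.rphase T e r r')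
    | pmatch {T T' : Ty} {n : ℕ} {p b : Fin n → Expr} (hs : Spanning T (List.ofFn p))
        (hb : ∀ j, IsoExpr (b j)) : IsoProg (Prog.pmatch T n p b T')
end

/-! ### Semantics

Operators are given by their matrices in the bases `|v⟩` and `|τ⟩`, and superoperators by linear
maps between spaces of matrices. -/

noncomputable section

/-- `|i⟩⟨j|`. -/
def ketbra {m : Type} [DecidableEq m] (i j : m) : Matrix m m ℂ := Matrix.single i j 1

/-- The superoperator that maps each `|i⟩⟨j|` to `F i j`. -/
def superop {m k : Type} [Fintype m] (F : m → m → Matrix k k ℂ) :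
    Matrix m m ℂ →ₗ[ℂ] Matrix k k ℂ where
  toFun ρ := ∑ i, ∑ j, ρ i j • F i j
  map_add' ρ ρ' := by
    simp only [Matrix.add_apply, add_smul, Finset.sum_add_distrib]
  map_smul' c ρ := by
    simp only [Matrix.smul_apply, smul_eq_mul, mul_smul, Finset.smul_sum, RingHom.id_apply]

/-- The superoperator `ρ ↦ A ρ A†`. -/
def conjugation {m k : Type} [Fintype m] (A : Matrix k m ℂ) :
    Matrix m m ℂ →ₗ[ℂ] Matrix k k ℂ where
  toFun ρ := A * ρ * Aᴴ
  map_add' ρ ρ' := by rw [Matrix.mul_add, Matrix.add_mul]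
  map_smul' c ρ := by rw [Matrix.mul_smul, Matrix.smul_mul, RingHom.id_apply]

/-- The matrix of the gate `u3(θ, φ, l)`; `|0⟩ = |left ()⟩` and `|1⟩ = |right ()⟩`. -/
def u3Matrix (θ φ l : ℝ) : Matrix (Unit ⊕ Unit) (Unit ⊕ Unit) ℂ :=
  Matrix.of fun
    | .inl _, .inl _ => (Real.cos (θ / 2) : ℂ)
    | .inr _, .inl _ => Complex.exp (Complex.I * φ) * (Real.sin (θ / 2) : ℂ)
    | .inl _, .inr _ => -(Complex.exp (Complex.I * l) * (Real.sin (θ / 2) : ℂ))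
    | .inr _, .inr _ => Complex.exp (Complex.I * (φ + l)) * (Real.cos (θ / 2) : ℂ)

mutual
  /-- `⟦σ : Γ ∥ Δ ⊢ e : T⟧`. -/
  def PureTyping.sem : {Γ Δ : Ctx} → {e : Expr} → {T : Ty} → PureTyping Γ Δ e T →
      Valuation Γ → Matrix (Val T) (Valuation Δ) ℂ
    | _, _, _, _, .unit, _ => Matrix.of fun _ _ => 1
    | _, _, _, _, .cvar (x := x) (T := T) h, σ =>
        Matrix.of fun v _ => if v = σ ⟨(x, T), h⟩ then 1 else 0
    | _, _, _, _, .qvar (x := x) (T := T) _, _ =>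
        Matrix.of fun v τ => if v = τ ⟨(x, T), Finset.mem_singleton_self (x, T)⟩ then 1 else 0
    | _, _, _, _, .pair h₀ h₁ h d₀ d₁, σ =>
        Matrix.of fun v τ =>
          d₀.sem σ v.1 (τ.restrict h.left_sub) *
          d₁.sem σ v.2 (τ.restrict (h₀.second_sub h₁ h))
    | _, _, _, _, .app df de, σ => df.sem * de.sem σ
    | _, _, _, _, .ctrl (T := T) (Γp := Γp) hD hΓ de _ dp _ _ db, σ =>
        Matrix.of fun w τ =>
          ∑ v : Val T,
            de.sem σ (ketbra (τ.restrict hD.left_sub) (τ.restrict hD.left_sub)) v v *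
            ∑ j, ∑ σj : Valuation (Γp j),
              ((dp j).sem Valuation.empty)ᴴ σj v * (db j).sem (Valuation.join (hΓ j) σ σj) w τ
  /-- `⟦σ : Γ ∥ Δ ⊩ e : T⟧`. -/
  def MixedTyping.sem : {Γ Δ : Ctx} → {e : Expr} → {T : Ty} → MixedTyping Γ Δ e T →
      Valuation Γ → (Matrix (Valuation Δ) (Valuation Δ) ℂ →ₗ[ℂ] Matrix (Val T) (Val T) ℂ)
    | _, _, _, _, .mix d, σ => conjugation (d.sem σ)
    | _, _, _, _, .discard h d, σ =>
        superop fun τ τ' =>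
          Matrix.trace (ketbra (τ.restrict h.right_sub) (τ'.restrict h.right_sub)) •
            d.sem σ (ketbra (τ.restrict h.left_sub) (τ'.restrict h.left_sub))
    | _, _, _, _, .pair h₀ h₁ h d₀ d₁, σ =>
        superop fun τ τ' =>
          Matrix.kronecker
            (d₀.sem σ (ketbra (τ.restrict h.left_sub) (τ'.restrict h.left_sub)))
            (d₁.sem σ (ketbra (τ.restrict (h₀.second_sub h₁ h)) (τ'.restrict (h₀.second_sub h₁ h))))
    | _, _, _, _, .tryCatch h d₀ d₁, σ =>
        superop fun τ τ' =>
          let ρ₀ := ketbra (τ.restrict h.left_sub) (τ'.restrict h.left_sub)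
          let ρ₁ := ketbra (τ.restrict h.right_sub) (τ'.restrict h.right_sub)
          Matrix.trace ρ₁ • d₀.sem σ ρ₀ +
            (Matrix.trace ρ₀ - Matrix.trace (d₀.sem σ ρ₀)) • d₁.sem σ ρ₁
    | _, _, _, _, .app df de, σ => df.sem ∘ₗ de.sem σ
    | _, _, _, _, .mmatch (T := T) (Γp := Γp) h₀ h₁ h hΓ de _ dp _ db, σ =>
        superop fun τ τ' =>
          ∑ v : Val T,
            de.sem σ (ketbra (τ.restrict h.left_sub) (τ'.restrict h.left_sub)) v v •
            ∑ j, ∑ σj : Valuation (Γp j),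
              ((dp j).sem Valuation.empty)ᴴ σj v •
                (db j).sem (Valuation.join (hΓ j) σ σj)
                  (ketbra (τ.restrict (h₀.second_sub h₁ h)) (τ'.restrict (h₀.second_sub h₁ h)))
  /-- `⟦⊢ f : T ⇝ T'⟧`. -/
  def CohTyping.sem : {f : Prog} → {T T' : Ty} → CohTyping f T T' → Matrix (Val T') (Val T) ℂ
    | _, _, _, .u3 rθ rφ rl => u3Matrix rθ rφ rl
    | _, _, _, .left T₀ T₁ =>
        Matrix.of fun (v : Val T₀ ⊕ Val T₁) (u : Val T₀) => if v = Sum.inl u then 1 else 0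
    | _, _, _, .right T₀ T₁ =>
        Matrix.of fun (v : Val T₀ ⊕ Val T₁) (u : Val T₁) => if v = Sum.inr u then 1 else 0
    | _, _, _, .lam d d' => d'.sem Valuation.empty * (d.sem Valuation.empty)ᴴ
    | _, _, _, .rphase r r' d =>
        Complex.exp (Complex.I * r) • (d.sem Valuation.empty * (d.sem Valuation.empty)ᴴ) +
        Complex.exp (Complex.I * r') •
          (1 - d.sem Valuation.empty * (d.sem Valuation.empty)ᴴ)
    | _, _, _, .pmatch _ dp _ db =>
        ∑ j, (db j).sem Valuation.empty * ((dp j).sem Valuation.empty)ᴴ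
  /-- `⟦⊢ f : T ⇛ T'⟧`. -/
  def ChanTyping.sem : {f : Prog} → {T T' : Ty} → ChanTyping f T T' →
      (Matrix (Val T) (Val T) ℂ →ₗ[ℂ] Matrix (Val T') (Val T') ℂ)
    | _, _, _, .channel d => conjugation d.sem
    | _, _, _, .lam d d' =>
        d'.sem Valuation.empty ∘ₗ conjugation (d.sem Valuation.empty)ᴴ
end

/-- The operator `⟦∅ : ∅ ∥ Δ ⊢ e : T⟧ : ℋ(Δ) → ℋ(T)`. -/
def PureTyping.operator {Δ : Ctx} {e : Expr} {T : Ty} (d : PureTyping Ctx.empty Δ e T) :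
    HilbCtx Δ →ₗ[ℂ] Hilb T :=
  Matrix.toEuclideanLin (d.sem Valuation.empty)

end

end Qunity

open scoped BigOperators Matrix

namespace Qunity

/-! ### Syntactic facts about derivations -/

-- Orthogonality is proved by induction on the derivation of `Ortho` (`Ortho.pairwise`). The two
-- injections into a direct sum have orthogonal images, inner products of pairs factor so that one
-- orthogonal component suffices (`inner_pair`), and an isometry preserves inner products. The
-- weight lies in this last case, the application of an isometric program `f`. It needs two facts:
-- the operator of `f` is an isometry, and it does not depend on the typing derivation, since the
-- two expressions may type `f` differently.
--
-- For `lam` and `pmatch`, isometry needs the patterns of a spanning judgment to be complete: their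
-- projections add up to the identity (`Spanning.sum_proj`). For `pmatch` it also needs
-- orthogonality of the right-hand sides. For `ctrl`, the scrutinee of an isometric expression is
-- classical, so on a basis state it yields one basis value; the patterns then select exactly one
-- branch, and the branches are isometries. Inputs that differ in the scrutinized variables may
-- select different branches, but erasure says that such a variable can be read off the output, so
-- the corresponding outputs are orthogonal (`Erases.separated`).
--
-- Classical expressions are handled by an evaluation relation `Expr.Ev` that mentions neither
-- contexts nor derivations. Their pure operators are partial injections of basis states (`PInj`),
-- their superoperators send a basis state to a basis state or to zero (`IsResult`), and both are
-- described by `Expr.Ev`; this gives independence of the derivation. Beyond classical expressions,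
-- independence is proved for `Det` expressions, whose `ctrl` scrutinees are classical; all
-- isometric programs are of this kind. Contexts are determined as well (`PureTyping.ctx_unique`),
-- except for `Null` expressions, whose operators vanish.
--
-- All these facts depend on each other, so they are bundled into `Expr.Good` and `Prog.Good` and
-- proved by one structural induction on the syntax. Inside it, orthogonality and spanning are
-- applied to patterns that are subterms; `Expr.Hereditary` carries the induction hypotheses for the
-- programs and subpatterns inside them.

/-- The input type of a program. -/
def Prog.src : Prog → Ty
  | .u3 _ _ _ => Ty.bit
  | .left T₀ _ => T₀
  | .right _ T₁ => T₁
  | .lam T _ _ => T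
  | .rphase T _ _ _ => T
  | .pmatch T _ _ _ _ => T

theorem CohTyping.src_eq {f : Prog} {T T' : Ty} (d : CohTyping f T T') : T = f.src := by
  cases d <;> rfl

theorem ChanTyping.src_eq {f : Prog} {T T' : Ty} (d : ChanTyping f T T') : T = f.src := by
  cases d with
  | channel d => exact d.src_eq
  | lam d d' => rfl

/-- Pure expressions whose operator vanishes because of a `ctrl` without branches. -/
def Expr.Null : Expr → Prop
  | .unit => False
  | .var _ => False
  | .pair e₀ e₁ => e₀.Null ∨ e₁.Null
  | .ctrl _ _ _ _ b _ => ∀ k, (b k).Null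
  | .mmatch _ _ _ _ _ _ => False
  | .tryCatch _ _ => False
  | .app _ e => e.Null

/-- Patterns: the expressions that occur in orthogonality and spanning judgments. -/
def Expr.Pat : Expr → Prop
  | .unit => True
  | .var _ => True
  | .pair e₀ e₁ => e₀.Pat ∧ e₁.Pat
  | .ctrl _ _ _ _ _ _ => False
  | .mmatch _ _ _ _ _ _ => False
  | .tryCatch _ _ => False
  | .app _ e => e.Pat

mutual
  /-- Expressions whose `ctrl` subexpressions only scrutinize classical expressions. -/
  def Expr.Det : Expr → Prop
    | .unit => True
    | .var _ => True
    | .pair e₀ e₁ => e₀.Det ∧ e₁.Det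
    | .ctrl e _ _ _ b _ => e.Classical ∧ ∀ k, (b k).Det
    | .mmatch _ _ _ _ _ _ => True
    | .tryCatch _ _ => True
    | .app f e => f.Det ∧ e.Det
  /-- Programs whose `ctrl` subexpressions only scrutinize classical expressions. -/
  def Prog.Det : Prog → Prop
    | .u3 _ _ _ => True
    | .left _ _ => True
    | .right _ _ => True
    | .lam _ e e' => e.Det ∧ e'.Det
    | .rphase _ e _ _ => e.Det
    | .pmatch _ _ p b _ => ∀ k, (p k).Det ∧ (b k).Det
end

mutual
  theorem Expr.Classical.det : ∀ {e : Expr}, e.Classical → e.Det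
    | .unit, _ => by simp [Expr.Det]
    | .var _, _ => by simp [Expr.Det]
    | .pair e₀ e₁, h => by
        simp only [Expr.Classical, Expr.Det] at h ⊢
        exact ⟨Expr.Classical.det h.1, Expr.Classical.det h.2⟩
    | .ctrl e _ _ p b _, h => by
        simp only [Expr.Classical, Expr.Det] at h ⊢
        exact ⟨h.1, fun k => Expr.Classical.det (h.2 k).2⟩
    | .mmatch _ _ _ _ _ _, _ => by simp [Expr.Det]
    | .tryCatch _ _, _ => by simp [Expr.Det]
    | .app f e, h => by
        simp only [Expr.Classical, Expr.Det] at h ⊢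
        exact ⟨Prog.Classical.det h.1, Expr.Classical.det h.2⟩
  theorem Prog.Classical.det : ∀ {f : Prog}, f.Classical → f.Det
    | .u3 _ _ _, _ => by simp [Prog.Det]
    | .left _ _, _ => by simp [Prog.Det]
    | .right _ _, _ => by simp [Prog.Det]
    | .lam _ e e', h => by
        simp only [Prog.Classical, Prog.Det] at h ⊢
        exact ⟨Expr.Classical.det h.1, Expr.Classical.det h.2⟩
    | .rphase _ e _ _, h => by simp [Prog.Classical] at h
    | .pmatch _ _ p b _, h => by
        simp only [Prog.Classical, Prog.Det] at h ⊢
        exact fun k => ⟨Expr.Classical.det (h k).1, Expr.Classical.det (h k).2⟩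
end

/-- A pattern has no `ctrl` outside the programs it applies, and `Null` does not look into programs.
Hence uniqueness of contexts always applies to patterns. -/
theorem Expr.Pat.not_null : ∀ {e : Expr}, e.Pat → ¬ e.Null
  | .unit, _ => by simp [Expr.Null]
  | .var _, _ => by simp [Expr.Null]
  | .pair e₀ e₁, h => by
      simp only [Expr.Pat, Expr.Null] at h ⊢
      exact not_or.2 ⟨h.1.not_null, h.2.not_null⟩
  | .ctrl _ _ _ _ _ _, h => by simp [Expr.Pat] at h
  | .mmatch _ _ _ _ _ _, h => by simp [Expr.Pat] at h
  | .tryCatch _ _, h => by simp [Expr.Pat] at h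
  | .app f e, h => by
      simp only [Expr.Pat, Expr.Null] at h ⊢
      exact Expr.Pat.not_null h

mutual
  -- The isometry rule for `ctrl` demands a classical scrutinee, and the programs in spanning
  -- patterns are themselves isometric. Nothing is demanded of `match` and `try`, which have no pure
  -- typing.
  theorem Spanning.det : ∀ {T : Ty} {l : List Expr}, Spanning T l → ∀ e ∈ l, e.Det
    | _, _, .void => by simp
    | _, _, .unit => by simp [Expr.Det]
    | _, _, .var T x => by simp [Expr.Det]
    | _, _, .unApp h df hf hdim => by
        have h1 := h.det
        have h2 := hf.det
        simp only [List.mem_map, forall_exists_index, and_imp, forall_apply_eq_imp_iff₂, Expr.Det]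
        exact fun e he => ⟨h2, h1 e he⟩
    | _, _, .sum h h' => by
        have h1 := h.det
        have h2 := h'.det
        simp only [List.mem_append, List.mem_map]
        rintro _ (⟨e, he, rfl⟩ | ⟨e, he, rfl⟩)
        · simpa [Expr.Det, Prog.Det] using h1 e he
        · simpa [Expr.Det, Prog.Det] using h2 e he
    | _, _, .pair h h' hfv => by
        have h1 := h.det
        have h2 := fun q hq => (h' q hq).det
        simp only [List.mem_flatMap, List.mem_map]
        rintro _ ⟨q, hq, e, he, rfl⟩
        simpa [Expr.Det] using ⟨h1 _ (List.mem_map_of_mem hq), h2 q hq e he⟩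
  theorem IsoExpr.det : ∀ {e : Expr}, IsoExpr e → e.Det
    | _, .unit => by simp [Expr.Det]
    | _, .var x => by simp [Expr.Det]
    | _, .pair h₀ h₁ => by
        have h1 := h₀.det
        have h2 := h₁.det
        simp [Expr.Det, h1, h2]
    | _, .ctrl hc he hs hb => by
        have h1 := fun k => (hb k).det
        simpa [Expr.Det] using ⟨hc, h1⟩
    | _, .mmatch hc he hs hb => by simp [Expr.Det]
    | _, .tryLeft h => by simp [Expr.Det]
    | _, .catchRight h => by simp [Expr.Det]
    | _, .app hf he => by
        have h1 := hf.det
        have h2 := he.det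
        simp [Expr.Det, h1, h2]
  theorem IsoProg.det : ∀ {f : Prog}, IsoProg f → f.Det
    | _, .u3 _ _ _ => by simp [Prog.Det]
    | _, .left _ _ => by simp [Prog.Det]
    | _, .right _ _ => by simp [Prog.Det]
    | _, .lam hs h => by
        have h1 := hs.det
        have h2 := h.det
        simpa [Prog.Det, h2] using h1
    | _, .rphase h => by
        have h2 := h.det
        simpa [Prog.Det] using h2
    | _, .pmatch hs hb => by
        have h1 := hs.det
        have h2 := fun k => (hb k).det
        simp only [List.mem_ofFn, forall_exists_index, forall_apply_eq_imp_iff] at h1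
        simpa [Prog.Det] using fun k => ⟨h1 k, h2 k⟩
end

theorem Spanning.pat : ∀ {T : Ty} {l : List Expr}, Spanning T l → ∀ e ∈ l, e.Pat
  | _, _, .void => by simp
  | _, _, .unit => by simp [Expr.Pat]
  | _, _, .var T x => by simp [Expr.Pat]
  | _, _, .unApp h df hf hdim => by
      have h1 := h.pat
      simpa only [List.mem_map, forall_exists_index, and_imp, forall_apply_eq_imp_iff₂, Expr.Pat]
        using h1
  | _, _, .sum h h' => by
      have h1 := h.pat
      have h2 := h'.pat
      simp only [List.mem_append, List.mem_map]
      rintro _ (⟨e, he, rfl⟩ | ⟨e, he, rfl⟩)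
      · simpa [Expr.Pat] using h1 e he
      · simpa [Expr.Pat] using h2 e he
  | _, _, .pair h h' hfv => by
      have h1 := h.pat
      have h2 := fun q hq => (h' q hq).pat
      simp only [List.mem_flatMap, List.mem_map]
      rintro _ ⟨q, hq, e, he, rfl⟩
      simpa [Expr.Pat] using ⟨h1 _ (List.mem_map_of_mem hq), h2 q hq e he⟩

theorem Ortho.pat : ∀ {T : Ty} {l : List Expr}, Ortho T l → ∀ e ∈ l, e.Pat
  | _, _, .void => by simp
  | _, _, .unit => by simp [Expr.Pat]
  | _, _, .var T x => by simp [Expr.Pat]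
  | _, _, .isoApp h df hf => by
      have h1 := h.pat
      simpa only [List.mem_map, forall_exists_index, and_imp, forall_apply_eq_imp_iff₂, Expr.Pat]
        using h1
  | _, _, .sum h h' => by
      have h1 := h.pat
      have h2 := h'.pat
      simp only [List.mem_append, List.mem_map]
      rintro _ (⟨e, he, rfl⟩ | ⟨e, he, rfl⟩)
      · simpa [Expr.Pat] using h1 e he
      · simpa [Expr.Pat] using h2 e he
  | _, _, .pair h h' hfv => by
      have h1 := h.pat
      have h2 := fun q hq => (h' q hq).pat
      simp only [List.mem_flatMap, List.mem_map]
      rintro _ ⟨q, hq, e, he, rfl⟩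
      simpa [Expr.Pat] using ⟨h1 _ (List.mem_map_of_mem hq), h2 q hq e he⟩
  | _, _, .sub h hs => fun e he => h.pat e (hs.subset he)

theorem Ortho.pat_ofFn {T : Ty} {n : ℕ} {p : Fin n → Expr} (h : Ortho T (List.ofFn p))
    (k : Fin n) : (p k).Pat :=
  h.pat _ (List.mem_ofFn.2 ⟨k, rfl⟩)

-- How far an expression determines its contexts.

theorem Ctx.mem_dom {Δ : Ctx} {x : Var} : x ∈ Δ.dom ↔ ∃ T, (x, T) ∈ Δ.bindings := by
  simp [Ctx.dom]

theorem Ctx.mem_dom_of_mem {Δ : Ctx} {x : Var} {T : Ty} (h : (x, T) ∈ Δ.bindings) : x ∈ Δ.dom :=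
  Ctx.mem_dom.2 ⟨T, h⟩

@[simp] theorem Ctx.dom_empty : Ctx.empty.dom = ∅ := rfl

@[simp] theorem Ctx.dom_single (x : Var) (T : Ty) : (Ctx.single x T).dom = {x} := rfl

theorem Ctx.Join.dom {A B C : Ctx} (h : Ctx.Join A B C) : C.dom = A.dom ∪ B.dom := by
  simp [Ctx.dom, h.union, Finset.image_union]

theorem Ctx.dom_mono {A B : Ctx} (h : A.bindings ⊆ B.bindings) : A.dom ⊆ B.dom :=
  Finset.image_subset_image h

theorem Ctx.Join.eq {A B C C' : Ctx} (h : Ctx.Join A B C) (h' : Ctx.Join A B C') : C = C' :=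
  Ctx.ext (h.union.trans h'.union.symm)

/-- With `D₀ = Δ, Δ₀` and `D₁ = Δ, Δ₁` and `D = Δ, Δ₀, Δ₁`, the context `D` is the union of `D₀`
and `D₁`. -/
theorem Ctx.Join.bindings_pair {Δ Δ₀ Δ₁ D₀ D₁ D : Ctx} (h₀ : Ctx.Join Δ Δ₀ D₀)
    (h₁ : Ctx.Join Δ Δ₁ D₁) (h : Ctx.Join D₀ Δ₁ D) : D.bindings = D₀.bindings ∪ D₁.bindings := by
  ext b
  simp only [h.union, h₁.union, h₀.union, Finset.mem_union]
  tauto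

theorem Ctx.Join.dom_pair {Δ Δ₀ Δ₁ D₀ D₁ D : Ctx} (h₀ : Ctx.Join Δ Δ₀ D₀)
    (h₁ : Ctx.Join Δ Δ₁ D₁) (h : Ctx.Join D₀ Δ₁ D) : D.dom = D₀.dom ∪ D₁.dom := by
  simp [Ctx.dom, Ctx.Join.bindings_pair h₀ h₁ h, Finset.image_union]

/-- With an empty classical context every variable of a pattern has to be quantum, and the pure
rules for patterns never weaken the quantum context. -/
theorem PureTyping.dom_eq_FV : ∀ {e : Expr} {Δ : Ctx} {T : Ty},
    PureTyping Ctx.empty Δ e T → e.Pat → Δ.dom = e.FV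
  | .unit, _, _, d, _ => by cases d; simp [Expr.FV]
  | .var x, _, _, d, _ => by
      cases d with
      | cvar h => simp [Ctx.empty] at h
      | qvar h => simp [Expr.FV]
  | .pair e₀ e₁, _, _, d, hp => by
      simp only [Expr.Pat] at hp
      cases d with
      | pair h₀ h₁ h d₀ d₁ =>
        rw [Ctx.Join.dom_pair h₀ h₁ h, d₀.dom_eq_FV hp.1, d₁.dom_eq_FV hp.2, Expr.FV]
  | .ctrl _ _ _ _ _ _, _, _, _, hp => by simp [Expr.Pat] at hp
  | .mmatch _ _ _ _ _ _, _, _, _, hp => by simp [Expr.Pat] at hp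
  | .tryCatch _ _, _, _, _, hp => by simp [Expr.Pat] at hp
  | .app f e, _, _, d, hp => by
      simp only [Expr.Pat] at hp
      cases d with
      | app df de => rw [de.dom_eq_FV hp, Expr.FV]

/-- The quantum context of a pure expression is determined, unless its operator vanishes. -/
theorem PureTyping.ctx_unique : ∀ {e : Expr} {Γ Δ Δ' : Ctx} {T : Ty},
    PureTyping Γ Δ e T → PureTyping Γ Δ' e T → ¬ e.Null → Δ = Δ'
  | .unit, _, _, _, _, d, d', _ => by cases d; cases d'; rfl
  | .var x, _, _, _, _, d, d', _ => by
      cases d with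
      | cvar h =>
        cases d' with
        | cvar h' => rfl
        | qvar h' => exact absurd (Ctx.mem_dom_of_mem h) h'
      | qvar h =>
        cases d' with
        | cvar h' => exact absurd (Ctx.mem_dom_of_mem h') h
        | qvar h' => rfl
  | .pair e₀ e₁, _, _, _, _, d, d', hn => by
      simp only [Expr.Null, not_or] at hn
      cases d with
      | pair h₀ h₁ h d₀ d₁ =>
        cases d' with
        | pair h₀' h₁' h' d₀' d₁' =>
          have := d₀.ctx_unique d₀' hn.1
          have := d₁.ctx_unique d₁' hn.2
          subst_vars
          exact Ctx.ext ((Ctx.Join.bindings_pair h₀ h₁ h).trans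
            (Ctx.Join.bindings_pair h₀' h₁' h').symm)
  | .ctrl e T n p b T', _, _, _, _, d, d', hn => by
      simp only [Expr.Null, not_forall] at hn
      obtain ⟨k, hk⟩ := hn
      cases d with
      | ctrl hD hΓ de ho dp hc her db =>
        cases d' with
        | ctrl hD' hΓ' de' ho' dp' hc' her' db' =>
          -- Branch `k` is not null. Its pattern fixes the bound context, hence the classical
          -- context of the branch, and the branch then fixes the quantum context of the whole
          -- expression.
          have h1 := (dp k).ctx_unique (dp' k) (ho.pat_ofFn k).not_null
          have h2 := (hΓ k).eq (h1 ▸ hΓ' k)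
          exact (db k).ctx_unique (h2 ▸ db' k) hk
  | .mmatch _ _ _ _ _ _, _, _, _, _, d, _, _ => by cases d
  | .tryCatch _ _, _, _, _, _, d, _, _ => by cases d
  | .app f e, _, _, _, _, d, d', hn => by
      simp only [Expr.Null] at hn
      cases d with
      | app df de =>
        cases d' with
        | app df' de' =>
          have := df.src_eq.trans df'.src_eq.symm
          subst this
          exact de.ctx_unique de' hn

/-- A variable that is both classical and quantum is never consumed. -/
theorem PureTyping.null_of_overlap : ∀ {e : Expr} {Γ Δ : Ctx} {T : Ty},
    PureTyping Γ Δ e T → ∀ {x : Var}, x ∈ Γ.dom → x ∈ Δ.dom → e.Null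
  | .unit, _, _, _, d, _, _, hΔ => by cases d; simp at hΔ
  | .var y, _, _, _, d, x, hΓ, hΔ => by
      cases d with
      | cvar h => simp at hΔ
      | qvar h =>
        rw [Ctx.dom_single, Finset.mem_singleton] at hΔ
        exact absurd (hΔ ▸ hΓ) h
  | .pair e₀ e₁, _, _, _, d, x, hΓ, hΔ => by
      cases d with
      | pair h₀ h₁ h d₀ d₁ =>
        rw [Ctx.Join.dom_pair h₀ h₁ h, Finset.mem_union] at hΔ
        exact hΔ.imp (d₀.null_of_overlap hΓ) (d₁.null_of_overlap hΓ)
  | .ctrl e T n p b T', _, _, _, d, x, hx, hΔ => by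
      cases d with
      | ctrl hD hΓ de ho dp hc her db =>
        rw [Expr.Null]
        exact fun k => (db k).null_of_overlap (Ctx.dom_mono (hΓ k).left_sub hx) hΔ
  | .mmatch _ _ _ _ _ _, _, _, _, d, _, _, _ => by cases d
  | .tryCatch _ _, _, _, _, d, _, _, _ => by cases d
  | .app f e, _, _, _, d, x, hΓ, hΔ => by
      cases d with
      | app df de => exact de.null_of_overlap hΓ hΔ

/-- Following the erasure derivation down an entry leads to an occurrence of `x`, unless a `ctrl`
without branches cuts the path. So if `x` is available neither classically nor as a quantum
variable, the entry must be null. -/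
theorem Erases.null_of_notMem {T : Ty} {x : Var} {l : List Expr} (h : Erases T x l) :
    ∀ e ∈ l, ∀ {Γ Δ : Ctx}, PureTyping Γ Δ e T → x ∉ Γ.dom → x ∉ Δ.dom → e.Null := by
  induction h with
  | gphase y r h ih =>
    intro e he Γ Δ d hΓ hΔ
    simp only [List.mem_append, List.mem_cons] at he ih
    rcases he with he | rfl | he
    · exact ih e (.inl he) d hΓ hΔ
    · cases d with
      | app df de =>
        cases df
        rw [Expr.Null]
        exact ih _ (.inr (.inl rfl)) de hΓ hΔ
    · exact ih e (.inr (.inr he)) d hΓ hΔ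
  | ctrl hp h ih =>
    intro e he Γ Δ d hΓ hΔ
    simp only [List.mem_append, List.mem_cons, List.mem_ofFn] at he ih
    rcases he with he | rfl | he
    · exact ih e (.inl (.inl he)) d hΓ hΔ
    · cases d with
      | ctrl hD hJ de ho dp hc her db =>
        rw [Expr.Null]
        refine fun k => ih _ (.inl (.inr ⟨k, rfl⟩)) (db k) ?_ hΔ
        -- The no-capture premise enters here: the pattern does not add `x` to the classical context
        -- of the branch.
        rw [(hJ k).dom, (dp k).dom_eq_FV (ho.pat_ofFn k), Finset.mem_union]
        exact not_or.2 ⟨hΓ, hp k⟩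
    · exact ih e (.inr he) d hΓ hΔ
  | var n =>
    intro e he Γ Δ d hΓ hΔ
    obtain rfl := (List.mem_replicate.1 he).2
    cases d with
    | cvar h => exact absurd (Ctx.mem_dom_of_mem h) hΓ
    | qvar h => simp at hΔ
  | pair₀ h ih =>
    intro e he Γ Δ d hΓ hΔ
    obtain ⟨q, hq, rfl⟩ := List.mem_map.1 he
    cases d with
    | pair h₀ h₁ h d₀ d₁ =>
      rw [Ctx.Join.dom_pair h₀ h₁ h, Finset.mem_union, not_or] at hΔ
      exact .inl (ih _ (List.mem_map_of_mem hq) d₀ hΓ hΔ.1)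
  | pair₁ h ih =>
    intro e he Γ Δ d hΓ hΔ
    obtain ⟨q, hq, rfl⟩ := List.mem_map.1 he
    cases d with
    | pair h₀ h₁ h d₀ d₁ =>
      rw [Ctx.Join.dom_pair h₀ h₁ h, Finset.mem_union, not_or] at hΔ
      exact .inr (ih _ (List.mem_map_of_mem hq) d₁ hΓ hΔ.2)

/-- Induction over the discarding rule, the only mixed rule besides `mix` that does not change the
expression. -/
theorem MixedTyping.discard_induction_aux
    {Q : ∀ {Γ Δ : Ctx} {e : Expr} {T : Ty}, MixedTyping Γ Δ e T → Prop}
    (discard : ∀ {Γ Δ Δ₀ D : Ctx} {e : Expr} {T : Ty} (h : Ctx.Join Δ Δ₀ D)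
      (d : MixedTyping Γ Δ e T), Q d → Q (.discard h d))
    (other : ∀ {Γ Δ : Ctx} {e : Expr} {T : Ty} (d : MixedTyping Γ Δ e T),
      (∀ {Δ' Δ₀ : Ctx} (h : Ctx.Join Δ' Δ₀ Δ) (d' : MixedTyping Γ Δ' e T), d ≠ .discard h d') →
      Q d) :
    ∀ {Γ Δ : Ctx} {e : Expr} {T : Ty} (d : MixedTyping Γ Δ e T), Q d
  | _, _, _, _, .discard h d => discard h d (d.discard_induction_aux discard other)
  | _, _, _, _, .mix d => other _ (by simp)
  | _, _, _, _, .pair h₀ h₁ h d₀ d₁ => other _ (by simp)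
  | _, _, _, _, .tryCatch h d₀ d₁ => other _ (by simp)
  | _, _, _, _, .app df de => other _ (by simp)
  | _, _, _, _, .mmatch h₀ h₁ h hΓ de ho dp hc db => other _ (by simp)

/-- Discarding changes only the quantum context. The other indices are held fixed by stating the
motive of the general induction along equations. -/
theorem MixedTyping.discard_induction {Γ : Ctx} {e : Expr} {T : Ty}
    {Q : ∀ {Δ : Ctx}, MixedTyping Γ Δ e T → Prop}
    (discard : ∀ {Δ Δ₀ D : Ctx} (h : Ctx.Join Δ Δ₀ D) (d : MixedTyping Γ Δ e T),
      Q d → Q (.discard h d))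
    (other : ∀ {Δ : Ctx} (d : MixedTyping Γ Δ e T),
      (∀ {Δ' Δ₀ : Ctx} (h : Ctx.Join Δ' Δ₀ Δ) (d' : MixedTyping Γ Δ' e T), d ≠ .discard h d') →
      Q d)
    {Δ : Ctx} (d : MixedTyping Γ Δ e T) : Q d := by
  refine MixedTyping.discard_induction_aux
    (Q := fun {Γ' _ e' T'} d => ∀ (h₁ : Γ' = Γ) (h₂ : e' = e) (h₃ : T' = T), Q (h₁ ▸ h₂ ▸ h₃ ▸ d))
    ?_ ?_ d rfl rfl rfl
  · rintro _ _ _ _ _ _ h d₁ hd₁ rfl rfl rfl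
    exact discard h d₁ (hd₁ rfl rfl rfl)
  · rintro _ _ _ _ d₁ hd₁ rfl rfl rfl
    exact other d₁ hd₁

/-! ### Values and valuations -/

/-- The value `(v₀, v₁)`. -/
def Val.mk {T₀ T₁ : Ty} (v₀ : Val T₀) (v₁ : Val T₁) : Val (Ty.tensor T₀ T₁) := (v₀, v₁)

/-- The value `left v`. -/
def Val.inl {T₀ : Ty} (T₁ : Ty) (v : Val T₀) : Val (Ty.sum T₀ T₁) :=
  (Sum.inl v : Val T₀ ⊕ Val T₁)

/-- The value `right v`. -/
def Val.inr {T₁ : Ty} (T₀ : Ty) (v : Val T₁) : Val (Ty.sum T₀ T₁) :=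
  (Sum.inr v : Val T₀ ⊕ Val T₁)

theorem Val.eq_mk {T₀ T₁ : Ty} (v : Val (Ty.tensor T₀ T₁)) : ∃ v₀ v₁, v = Val.mk v₀ v₁ :=
  ⟨v.1, v.2, rfl⟩

theorem Val.eq_inl_or_inr {T₀ T₁ : Ty} (v : Val (Ty.sum T₀ T₁)) :
    (∃ w, v = Val.inl T₁ w) ∨ ∃ w, v = Val.inr T₀ w := by
  rcases (v : Val T₀ ⊕ Val T₁) with w | w
  · exact .inl ⟨w, rfl⟩
  · exact .inr ⟨w, rfl⟩

@[simp] theorem Val.mk_inj {T₀ T₁ : Ty} {v₀ w₀ : Val T₀} {v₁ w₁ : Val T₁} :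
    Val.mk v₀ v₁ = Val.mk w₀ w₁ ↔ v₀ = w₀ ∧ v₁ = w₁ := Prod.mk.injEq _ _ _ _ ▸ Iff.rfl

@[simp] theorem Val.inl_inj {T₀ T₁ : Ty} {v w : Val T₀} : Val.inl T₁ v = Val.inl T₁ w ↔ v = w :=
  Sum.inl_injective.eq_iff

@[simp] theorem Val.inr_inj {T₀ T₁ : Ty} {v w : Val T₁} : Val.inr T₀ v = Val.inr T₀ w ↔ v = w :=
  Sum.inr_injective.eq_iff

@[simp] theorem Val.inl_ne_inr {T₀ T₁ : Ty} {v : Val T₀} {w : Val T₁} :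
    Val.inl T₁ v ≠ Val.inr T₀ w := Sum.inl_ne_inr

@[simp] theorem Val.inr_ne_inl {T₀ T₁ : Ty} {v : Val T₀} {w : Val T₁} :
    Val.inr T₀ w ≠ Val.inl T₁ v := Sum.inr_ne_inl

@[simp] theorem CohTyping.sem_left_inl {T₀ T₁ : Ty} (v w : Val T₀) :
    (CohTyping.left T₀ T₁).sem (Val.inl T₁ v) w = if v = w then 1 else 0 := by
  simp only [CohTyping.sem]
  change (if (Sum.inl v : Val T₀ ⊕ Val T₁) = Sum.inl w then (1 : ℂ) else 0) = _
  exact if_congr Sum.inl_injective.eq_iff rfl rfl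

@[simp] theorem CohTyping.sem_left_inr {T₀ T₁ : Ty} (v : Val T₁) (w : Val T₀) :
    (CohTyping.left T₀ T₁).sem (Val.inr T₀ v) w = 0 := by
  simp only [CohTyping.sem]
  change (if (Sum.inr v : Val T₀ ⊕ Val T₁) = Sum.inl w then (1 : ℂ) else 0) = _
  exact if_neg Sum.inr_ne_inl

@[simp] theorem CohTyping.sem_right_inl {T₀ T₁ : Ty} (v : Val T₀) (w : Val T₁) :
    (CohTyping.right T₀ T₁).sem (Val.inl T₁ v) w = 0 := by
  simp only [CohTyping.sem]
  change (if (Sum.inl v : Val T₀ ⊕ Val T₁) = Sum.inr w then (1 : ℂ) else 0) = _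
  exact if_neg Sum.inl_ne_inr

@[simp] theorem CohTyping.sem_right_inr {T₀ T₁ : Ty} (v w : Val T₁) :
    (CohTyping.right T₀ T₁).sem (Val.inr T₀ v) w = if v = w then 1 else 0 := by
  simp only [CohTyping.sem]
  change (if (Sum.inr v : Val T₀ ⊕ Val T₁) = Sum.inr w then (1 : ℂ) else 0) = _
  exact if_congr Sum.inr_injective.eq_iff rfl rfl

theorem Val.sum_tensor {M : Type} [AddCommMonoid M] {T₀ T₁ : Ty}
    (f : Val (Ty.tensor T₀ T₁) → M) : ∑ v, f v = ∑ v₀, ∑ v₁, f (Val.mk v₀ v₁) := by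
  rw [← Fintype.sum_prod_type']
  exact Fintype.sum_equiv (Equiv.refl (Val T₀ × Val T₁)) _ _ fun _ => rfl

theorem Val.sum_sum {M : Type} [AddCommMonoid M] {T₀ T₁ : Ty}
    (f : Val (Ty.sum T₀ T₁) → M) :
    ∑ v, f v = ∑ v₀ : Val T₀, f (Val.inl T₁ v₀) + ∑ v₁ : Val T₁, f (Val.inr T₀ v₁) := by
  refine Eq.trans ?_ (Fintype.sum_sum_type fun v : Val T₀ ⊕ Val T₁ => f v)
  exact Fintype.sum_equiv (Equiv.refl (Val T₀ ⊕ Val T₁)) _ _ fun _ => rfl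

/-- A value together with its type. -/
abbrev TVal : Type := Σ T : Ty, Val T

/-- An environment assigns a value to every variable. -/
abbrev Env : Type := Var → TVal

/-- The environment `ρ` extends the valuation `τ`. -/
def Valuation.Below {Δ : Ctx} (τ : Valuation Δ) (ρ : Env) : Prop :=
  ∀ b : Δ.bindings, ρ b.1.1 = ⟨b.1.2, τ b⟩

/-- The environment `ρ` extends the valuation `τ` outside of the domain of `Γ`. -/
def Valuation.BelowOff (Γ : Ctx) {Δ : Ctx} (τ : Valuation Δ) (ρ : Env) : Prop :=
  ∀ b : Δ.bindings, b.1.1 ∉ Γ.dom → ρ b.1.1 = ⟨b.1.2, τ b⟩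

theorem Valuation.Below.eq {Δ : Ctx} {τ τ' : Valuation Δ} {ρ : Env} (h : τ.Below ρ)
    (h' : τ'.Below ρ) : τ = τ' := by
  funext b
  have := (h b).symm.trans (h' b)
  simpa using this

theorem Valuation.Below.belowOff {Γ Δ : Ctx} {τ : Valuation Δ} {ρ : Env} (h : τ.Below ρ) :
    τ.BelowOff Γ ρ := fun b _ => h b

theorem Valuation.Below.restrict {A C : Ctx} {τ : Valuation C} {ρ : Env} (h : τ.Below ρ)
    (hs : A.bindings ⊆ C.bindings) : (τ.restrict hs).Below ρ := fun b => h ⟨b.1, hs b.2⟩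

theorem Valuation.BelowOff.restrict {Γ A C : Ctx} {τ : Valuation C} {ρ : Env}
    (h : τ.BelowOff Γ ρ) (hs : A.bindings ⊆ C.bindings) : (τ.restrict hs).BelowOff Γ ρ :=
  fun b => h ⟨b.1, hs b.2⟩

theorem Valuation.BelowOff.below {Γ Δ : Ctx} {τ : Valuation Δ} {ρ : Env}
    (h : τ.BelowOff Γ ρ) (hd : ∀ x ∈ Γ.dom, x ∉ Δ.dom) : τ.Below ρ :=
  fun b => h b fun hb => hd _ hb (Ctx.mem_dom_of_mem b.2)

theorem Valuation.Below.join {A B C : Ctx} {σ : Valuation A} {σ' : Valuation B} {ρ : Env}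
    (hσ : σ.Below ρ) (hσ' : σ'.Below ρ) (h : Ctx.Join A B C) :
    (Valuation.join h σ σ').Below ρ := by
  intro b
  unfold Valuation.join
  split
  · exact hσ ⟨b.1, ‹_›⟩
  · exact hσ' ⟨b.1, _⟩

theorem Valuation.exists_below {Δ : Ctx} {ρ : Env}
    (h : ∀ b ∈ Δ.bindings, ∃ v : Val b.2, ρ b.1 = ⟨b.2, v⟩) : ∃ τ : Valuation Δ, τ.Below ρ :=
  ⟨fun b => (h b.1 b.2).choose, fun b => (h b.1 b.2).choose_spec⟩

theorem Valuation.below_empty (τ : Valuation Ctx.empty) (ρ : Env) : τ.Below ρ :=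
  fun b => absurd b.2 (Finset.notMem_empty _)

instance : Unique (Valuation Ctx.empty) where
  default := Valuation.empty
  uniq τ := (Valuation.below_empty τ fun _ => ⟨Ty.unit, ()⟩).eq (Valuation.below_empty _ _)

theorem Valuation.exists_env {Δ : Ctx} (τ : Valuation Δ) : ∃ ρ : Env, τ.Below ρ := by
  classical
  refine ⟨fun x => if h : ∃ T, (x, T) ∈ Δ.bindings then ⟨h.choose, τ ⟨_, h.choose_spec⟩⟩
    else ⟨Ty.unit, ()⟩, ?_⟩
  rintro ⟨⟨x, T⟩, hb⟩
  have h : ∃ T, (x, T) ∈ Δ.bindings := ⟨T, hb⟩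
  simp only [h, dif_pos]
  -- The chosen type agrees with `T` only because a context binds a variable once; the statement is
  -- generalized so that this equation can be substituted.
  have key : ∀ T' (h' : (x, T') ∈ Δ.bindings),
      (⟨T', τ ⟨_, h'⟩⟩ : TVal) = ⟨T, τ ⟨(x, T), hb⟩⟩ := by
    intro T' h'
    obtain rfl := Δ.functional _ _ _ hb h'
    rfl
  exact key _ h.choose_spec

/-- The typing rules do not exclude a variable that is both classical and quantum. On such a
variable the environment follows the classical valuation, whence `Valuation.BelowOff` for the
quantum one. -/
theorem Valuation.exists_env_pair {Γ Δ : Ctx} (σ : Valuation Γ) (τ : Valuation Δ) :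
    ∃ ρ : Env, σ.Below ρ ∧ τ.BelowOff Γ ρ := by
  obtain ⟨ρ₁, h₁⟩ := σ.exists_env
  obtain ⟨ρ₂, h₂⟩ := τ.exists_env
  refine ⟨fun x => if x ∈ Γ.dom then ρ₁ x else ρ₂ x, fun b => ?_, fun b hb => ?_⟩
  · simp only [Ctx.mem_dom_of_mem b.2, if_true]
    exact h₁ b
  · simp only [hb, if_false]
    exact h₂ b

/-- A valuation of `Δ, Δ₀, Δ₁` is determined by its restrictions to `Δ, Δ₀` and `Δ, Δ₁`. -/
theorem Valuation.eq_of_restrict {A B C : Ctx} (hA : A.bindings ⊆ C.bindings)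
    (hB : B.bindings ⊆ C.bindings) (h : C.bindings = A.bindings ∪ B.bindings)
    {τ τ' : Valuation C} (h₀ : τ.restrict hA = τ'.restrict hA)
    (h₁ : τ.restrict hB = τ'.restrict hB) : τ = τ' := by
  funext b
  obtain hb | hb := Finset.mem_union.1 (h.subset b.2)
  · exact congrFun h₀ ⟨b.1, hb⟩
  · exact congrFun h₁ ⟨b.1, hb⟩

/-! ### Null expressions -/

/-- This makes the exceptions to uniqueness of contexts and to disjointness of the two contexts
harmless. -/
theorem PureTyping.sem_eq_zero : ∀ {e : Expr} {Γ Δ : Ctx} {T : Ty} (d : PureTyping Γ Δ e T),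
    e.Null → ∀ σ, d.sem σ = 0
  | .unit, _, _, _, _, h, _ => by simp [Expr.Null] at h
  | .var y, _, _, _, _, h, _ => by simp [Expr.Null] at h
  | .pair e₀ e₁, _, _, _, d, h, σ => by
      simp only [Expr.Null] at h
      cases d with
      | pair h₀ h₁ hD d₀ d₁ =>
        ext v τ
        simp only [PureTyping.sem, Matrix.of_apply, Matrix.zero_apply]
        rcases h with h | h
        · simp [d₀.sem_eq_zero h σ]
        · simp [d₁.sem_eq_zero h σ]
  | .ctrl e T n p b T', _, _, _, d, h, σ => by
      rw [Expr.Null] at h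
      cases d with
      | ctrl hD hΓ de ho dp hc her db =>
        ext v τ
        have := fun k => (db k).sem_eq_zero (h k)
        simp [PureTyping.sem, this]
  | .mmatch _ _ _ _ _ _, _, _, _, d, _, _ => by cases d
  | .tryCatch _ _, _, _, _, d, _, _ => by cases d
  | .app f e, _, _, _, d, h, σ => by
      simp only [Expr.Null] at h
      cases d with
      | app df de => simp [PureTyping.sem, de.sem_eq_zero h σ]

/-! ### Partial injections -/

/-- The matrix of a partial injection of basis vectors. -/
structure PInj {m k : Type} (M : Matrix m k ℂ) : Prop where
  zero_or_one : ∀ i j, M i j = 0 ∨ M i j = 1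
  row : ∀ {i j j'}, M i j = 1 → M i j' = 1 → j = j'
  col : ∀ {i i' j}, M i j = 1 → M i' j = 1 → i = i'

theorem PInj.eq_one {m k : Type} {M : Matrix m k ℂ} (h : PInj M) {i : m} {j : k}
    (hij : M i j ≠ 0) : M i j = 1 := (h.zero_or_one i j).resolve_left hij

theorem PInj.eq_zero {m k : Type} {M : Matrix m k ℂ} (h : PInj M) {i : m} {j : k}
    (hij : M i j ≠ 1) : M i j = 0 := (h.zero_or_one i j).resolve_right hij

theorem conjTranspose_eq_one {m k : Type} {M : Matrix m k ℂ} {i : k} {j : m} :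
    Mᴴ i j = 1 ↔ M j i = 1 := by
  rw [Matrix.conjTranspose_apply]
  exact star_injective.eq_iff' (star_one ℂ)

theorem PInj.conjTranspose {m k : Type} {M : Matrix m k ℂ} (h : PInj M) : PInj Mᴴ where
  zero_or_one i j := by
    rcases h.zero_or_one j i with h | h <;> simp [h]
  row h₁ h₂ := h.col (conjTranspose_eq_one.1 h₁) (conjTranspose_eq_one.1 h₂)
  col h₁ h₂ := h.row (conjTranspose_eq_one.1 h₁) (conjTranspose_eq_one.1 h₂)

/-- Column `l` of `B` is a single basis vector, so only one summand of the product survives; `A` is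
arbitrary. -/
theorem PInj.mul_apply_of_right {m n k : Type} [Fintype n] (A : Matrix m n ℂ)
    {B : Matrix n k ℂ} (hB : PInj B) {j : n} {l : k} (h : B j l = 1) (i : m) :
    (A * B) i l = A i j := by
  classical
  rw [Matrix.mul_apply, Finset.sum_eq_single j]
  · simp [h]
  · intro j' _ hj
    rw [hB.eq_zero fun h' => hj (hB.col h' h), mul_zero]
  · simp

theorem PInj.mul_eq_one {m n k : Type} [Fintype n] {A : Matrix m n ℂ} {B : Matrix n k ℂ}
    (hA : PInj A) (hB : PInj B) {i : m} {l : k} :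
    (A * B) i l = 1 ↔ ∃ j, A i j = 1 ∧ B j l = 1 := by
  constructor
  · intro h
    have h1 : (A * B) i l ≠ 0 := by rw [h]; exact one_ne_zero
    rw [Matrix.mul_apply] at h1
    obtain ⟨j, _, hj⟩ := Finset.exists_ne_zero_of_sum_ne_zero h1
    exact ⟨j, hA.eq_one (left_ne_zero_of_mul hj), hB.eq_one (right_ne_zero_of_mul hj)⟩
  · rintro ⟨j, h1, h2⟩
    rw [PInj.mul_apply_of_right A hB h2, h1]

theorem PInj.mul {m n k : Type} [Fintype n] {A : Matrix m n ℂ} {B : Matrix n k ℂ}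
    (hA : PInj A) (hB : PInj B) : PInj (A * B) where
  zero_or_one i l := by
    by_cases h : ∃ j, B j l = 1
    · obtain ⟨j, hj⟩ := h
      rw [PInj.mul_apply_of_right A hB hj]
      exact hA.zero_or_one i j
    · left
      rw [Matrix.mul_apply]
      exact Finset.sum_eq_zero fun j _ => by rw [hB.eq_zero fun h' => h ⟨j, h'⟩, mul_zero]
  row h₁ h₂ := by
    obtain ⟨j, h1, h2⟩ := (hA.mul_eq_one hB).1 h₁
    obtain ⟨j', h1', h2'⟩ := (hA.mul_eq_one hB).1 h₂
    obtain rfl := hA.row h1 h1'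
    exact hB.row h2 h2'
  col h₁ h₂ := by
    obtain ⟨j, h1, h2⟩ := (hA.mul_eq_one hB).1 h₁
    obtain ⟨j', h1', h2'⟩ := (hA.mul_eq_one hB).1 h₂
    obtain rfl := hB.col h2 h2'
    exact hA.col h1 h1'

/-- Two partial injections that both reach `i` are not orthogonal. -/
theorem PInj.inner_eq_one {m k k' : Type} [Fintype m] {A : Matrix m k ℂ} {B : Matrix m k' ℂ}
    (hA : PInj A) (hB : PInj B) {i : m} {j : k} {j' : k'} (h : A i j = 1) (h' : B i j' = 1) :
    (Aᴴ * B) j j' = 1 :=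
  (hA.conjTranspose.mul_eq_one hB).2 ⟨i, by simp [h], h'⟩

theorem PInj.sum_apply {ι m k : Type} [Fintype ι] {A : ι → Matrix m k ℂ} {i : m} {j : k}
    {a : ι} (h : ∀ b, A b i j ≠ 0 → b = a) : (∑ b, A b) i j = A a i j := by
  classical
  rw [Matrix.sum_apply, Finset.sum_eq_single a]
  · intro b _ hb
    by_contra h'
    exact hb (h b h')
  · simp

theorem PInj.sum_eq_one {ι m k : Type} [Fintype ι] {A : ι → Matrix m k ℂ}
    (hA : ∀ a, PInj (A a)) (hc : ∀ {a b i i' j}, A a i j = 1 → A b i' j = 1 → a = b)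
    {i : m} {j : k} : (∑ a, A a) i j = 1 ↔ ∃ a, A a i j = 1 := by
  constructor
  · intro h
    have h1 : (∑ a, A a) i j ≠ 0 := by rw [h]; exact one_ne_zero
    rw [Matrix.sum_apply] at h1
    obtain ⟨a, _, ha⟩ := Finset.exists_ne_zero_of_sum_ne_zero h1
    exact ⟨a, (hA a).eq_one ha⟩
  · rintro ⟨a, ha⟩
    rw [PInj.sum_apply (a := a) fun b hb => hc ((hA b).eq_one hb) ha, ha]

/-- Distinct summands share neither rows nor columns, so their entries never add up or collide. -/
theorem PInj.sum {ι m k : Type} [Fintype ι] {A : ι → Matrix m k ℂ} (hA : ∀ a, PInj (A a))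
    (hr : ∀ {a b i j j'}, A a i j = 1 → A b i j' = 1 → a = b)
    (hc : ∀ {a b i i' j}, A a i j = 1 → A b i' j = 1 → a = b) : PInj (∑ a, A a) where
  zero_or_one i j := by
    by_cases h : ∃ a, A a i j = 1
    · exact .inr ((PInj.sum_eq_one hA hc).2 h)
    · left
      rw [Matrix.sum_apply]
      exact Finset.sum_eq_zero fun a _ => (hA a).eq_zero fun h' => h ⟨a, h'⟩
  row h₁ h₂ := by
    obtain ⟨a, h1⟩ := (PInj.sum_eq_one hA hc).1 h₁
    obtain ⟨b, h2⟩ := (PInj.sum_eq_one hA hc).1 h₂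
    obtain rfl := hr h1 h2
    exact (hA a).row h1 h2
  col h₁ h₂ := by
    obtain ⟨a, h1⟩ := (PInj.sum_eq_one hA hc).1 h₁
    obtain ⟨b, h2⟩ := (PInj.sum_eq_one hA hc).1 h₂
    obtain rfl := hc h1 h2
    exact (hA a).col h1 h2

/-! ### Superoperators on basis states -/

theorem superop_ketbra {m k : Type} [Fintype m] [DecidableEq m] (F : m → m → Matrix k k ℂ)
    (i j : m) : superop F (ketbra i j) = F i j := by
  change ∑ i', ∑ j', ketbra i j i' j' • F i' j' = F i j
  rw [Finset.sum_eq_single i, Finset.sum_eq_single j]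
  · simp [ketbra]
  · intro j' _ hj
    simp [ketbra, Ne.symm hj]
  · simp
  · intro i' _ hi
    simp [ketbra, Ne.symm hi]
  · simp

theorem conjugation_ketbra_apply {m k : Type} [Fintype m] [DecidableEq m] (A : Matrix k m ℂ)
    (j : m) (i i' : k) : conjugation A (ketbra j j) i i' = A i j * star (A i' j) := by
  change (A * (Matrix.single j j 1 : Matrix m m ℂ) * Aᴴ) i i' = _
  rw [Matrix.mul_apply, Finset.sum_eq_single j]
  · simp
  · intro j' _ hj
    simp [Matrix.mul_single_apply_of_ne _ _ _ _ _ hj]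
  · simp

theorem trace_ketbra {m : Type} [Fintype m] [DecidableEq m] (i : m) :
    Matrix.trace (ketbra i i) = 1 := by simp [ketbra]

/-- `M` is the state `|v⟩⟨v|` if `v` is the unique result satisfying `P`, and it is zero if there
is no such result. -/
def IsResult {k : Type} [DecidableEq k] (P : k → Prop) (M : Matrix k k ℂ) : Prop :=
  (∃ v, (∀ u, P u ↔ u = v) ∧ M = ketbra v v) ∨ (∀ u, ¬ P u) ∧ M = 0

theorem IsResult.unique {k : Type} [DecidableEq k] {P : k → Prop} {M M' : Matrix k k ℂ}
    (h : IsResult P M) (h' : IsResult P M') : M = M' := by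
  rcases h with ⟨v, hv, rfl⟩ | ⟨hP, rfl⟩ <;> rcases h' with ⟨v', hv', rfl⟩ | ⟨hP', rfl⟩
  · rw [(hv' v).1 ((hv v).2 rfl)]
  · exact absurd ((hv v).2 rfl) (hP' v)
  · exact absurd ((hv' v').2 rfl) (hP v')
  · rfl

theorem IsResult.congr {k : Type} [DecidableEq k] {P P' : k → Prop} {M : Matrix k k ℂ}
    (h : IsResult P M) (hP : ∀ u, P' u ↔ P u) : IsResult P' M := by
  rwa [show P' = P from funext fun u => propext (hP u)]

theorem IsResult.eq_ketbra {k : Type} [DecidableEq k] {P : k → Prop} {M : Matrix k k ℂ}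
    (h : IsResult P M) {v : k} (hv : P v) : M = ketbra v v := by
  rcases h with ⟨u, hu, rfl⟩ | ⟨hP, rfl⟩
  · rw [(hu v).1 hv]
  · exact absurd hv (hP v)

theorem IsResult.of_unique {k : Type} [DecidableEq k] {P : k → Prop} {M : Matrix k k ℂ}
    {v : k} (hv : P v) (hu : ∀ u, P u → u = v) (hM : M = ketbra v v) : IsResult P M :=
  .inl ⟨v, fun u => ⟨hu u, fun h => h ▸ hv⟩, hM⟩

/-- Column `j` of a partial injection is a basis vector or zero. -/
theorem PInj.isResult {m k : Type} [Fintype m] [DecidableEq m] [DecidableEq k]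
    {A : Matrix k m ℂ} (hA : PInj A) (j : m) :
    IsResult (fun i => A i j = 1) (conjugation A (ketbra j j)) := by
  by_cases h : ∃ i, A i j = 1
  · obtain ⟨i, hi⟩ := h
    refine .of_unique hi (fun u hu => hA.col hu hi) ?_
    ext u u'
    rw [conjugation_ketbra_apply]
    by_cases hu : u = i
    · subst hu
      by_cases hu' : u' = u
      · subst hu'; simp [hi, ketbra]
      · rw [hA.eq_zero (i := u') fun h' => hu' (hA.col h' hi)]
        simp [ketbra, Ne.symm hu']
    · rw [hA.eq_zero (i := u) fun h' => hu (hA.col h' hi)]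
      simp [ketbra, Ne.symm hu]
  · push Not at h
    refine .inr ⟨h, ?_⟩
    ext u u'
    rw [conjugation_ketbra_apply, hA.eq_zero (h u)]
    simp

theorem PInj.isResult_iff {m k : Type} [Fintype m] [DecidableEq m] [DecidableEq k]
    {A : Matrix k m ℂ} (hA : PInj A) {j : m} {P : k → Prop} (hP : ∀ i, P i ↔ A i j = 1) :
    IsResult P (conjugation A (ketbra j j)) := (hA.isResult j).congr hP

/-! ### Pairs, conditionals and erasure -/

theorem PureTyping.sem_pair_apply {Γ Δ Δ₀ Δ₁ D₀ D₁ D : Ctx} {e₀ e₁ : Expr} {T₀ T₁ : Ty}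
    (h₀ : Ctx.Join Δ Δ₀ D₀) (h₁ : Ctx.Join Δ Δ₁ D₁) (h : Ctx.Join D₀ Δ₁ D)
    (d₀ : PureTyping Γ D₀ e₀ T₀) (d₁ : PureTyping Γ D₁ e₁ T₁) (σ : Valuation Γ)
    (v₀ : Val T₀) (v₁ : Val T₁) (τ : Valuation D) :
    (PureTyping.pair h₀ h₁ h d₀ d₁).sem σ (Val.mk v₀ v₁) τ =
      d₀.sem σ v₀ (τ.restrict h.left_sub) * d₁.sem σ v₁ (τ.restrict (h₀.second_sub h₁ h)) := by
  simp only [PureTyping.sem]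
  rfl

/-- At a fixed input valuation the output of a pair is a product vector, even if the components
share variables. Inner products of product vectors factor. -/
theorem inner_pair {T₀ T₁ : Ty} {m m₀ m₁ k k₀ k₁ : Type}
    {A : Matrix (Val (Ty.tensor T₀ T₁)) m ℂ} {A₀ : Matrix (Val T₀) m₀ ℂ}
    {A₁ : Matrix (Val T₁) m₁ ℂ} {B : Matrix (Val (Ty.tensor T₀ T₁)) k ℂ}
    {B₀ : Matrix (Val T₀) k₀ ℂ} {B₁ : Matrix (Val T₁) k₁ ℂ}
    {i : m} {i₀ : m₀} {i₁ : m₁} {j : k} {j₀ : k₀} {j₁ : k₁}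
    (hA : ∀ v₀ v₁, A (Val.mk v₀ v₁) i = A₀ v₀ i₀ * A₁ v₁ i₁)
    (hB : ∀ v₀ v₁, B (Val.mk v₀ v₁) j = B₀ v₀ j₀ * B₁ v₁ j₁) :
    (Aᴴ * B) i j = (A₀ᴴ * B₀) i₀ j₀ * (A₁ᴴ * B₁) i₁ j₁ := by
  simp only [Matrix.mul_apply, Matrix.conjTranspose_apply]
  rw [Val.sum_tensor, Finset.sum_mul_sum]
  refine Finset.sum_congr rfl fun v₀ _ => Finset.sum_congr rfl fun v₁ _ => ?_
  rw [hA, hB, star_mul']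
  ring

/-- The operator of a `ctrl` expression is a combination of those of its branches, with
coefficients that only depend on the scrutinized part of the valuation. -/
theorem PureTyping.sem_ctrl_apply {Γ Δ Δ' D : Ctx} {e : Expr} {T T' : Ty} {n : ℕ}
    {p b : Fin n → Expr} {Γp Γb : Fin n → Ctx}
    (hD : Ctx.Join Δ Δ' D) (hΓ : ∀ j, Ctx.Join Γ (Γp j) (Γb j))
    (de : MixedTyping Γ Δ e T) (ho : Ortho T (List.ofFn p))
    (dp : ∀ j, PureTyping Ctx.empty (Γp j) (p j) T) (hc : ∀ j, (p j).Classical)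
    (her : ∀ x ∈ Δ.dom, Erases T' x (List.ofFn b)) (db : ∀ j, PureTyping (Γb j) D (b j) T')
    (σ : Valuation Γ) (w : Val T') (τ : Valuation D) :
    (PureTyping.ctrl hD hΓ de ho dp hc her db).sem σ w τ =
      ∑ j, ∑ σj : Valuation (Γp j),
        (∑ v, de.sem σ (ketbra (τ.restrict hD.left_sub) (τ.restrict hD.left_sub)) v v *
          ((dp j).sem Valuation.empty)ᴴ σj v) *
        (db j).sem (Valuation.join (hΓ j) σ σj) w τ := by
  simp only [PureTyping.sem, Matrix.of_apply, Finset.mul_sum, Finset.sum_mul]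
  rw [Finset.sum_comm]
  refine Finset.sum_congr rfl fun j _ => ?_
  rw [Finset.sum_comm]
  simp only [mul_assoc]

/-- The outputs of two expressions are orthogonal when their inputs differ at `x`. -/
def Expr.Separated (T : Ty) (x : Var) (e₁ e₂ : Expr) : Prop :=
  ∀ {Γ₁ Δ₁ Γ₂ Δ₂ : Ctx} (d₁ : PureTyping Γ₁ Δ₁ e₁ T) (d₂ : PureTyping Γ₂ Δ₂ e₂ T)
    (σ₁ : Valuation Γ₁) (σ₂ : Valuation Γ₂) {S : Ty} (h₁ : (x, S) ∈ Δ₁.bindings)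
    (h₂ : (x, S) ∈ Δ₂.bindings) (τ₁ : Valuation Δ₁) (τ₂ : Valuation Δ₂),
    τ₁ ⟨(x, S), h₁⟩ ≠ τ₂ ⟨(x, S), h₂⟩ → ((d₁.sem σ₁)ᴴ * d₂.sem σ₂) τ₁ τ₂ = 0

theorem Expr.Separated.symm {T : Ty} {x : Var} {e₁ e₂ : Expr} (h : Expr.Separated T x e₁ e₂) :
    Expr.Separated T x e₂ e₁ := by
  intro Γ₁ Δ₁ Γ₂ Δ₂ d₁ d₂ σ₁ σ₂ S h₁ h₂ τ₁ τ₂ hne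
  have := h d₂ d₁ σ₂ σ₁ h₂ h₁ τ₂ τ₁ hne.symm
  rw [← Matrix.conjTranspose_conjTranspose ((d₁.sem σ₁)ᴴ * d₂.sem σ₂),
    Matrix.conjTranspose_mul, Matrix.conjTranspose_conjTranspose, Matrix.conjTranspose_apply, this,
    star_zero]

/-- Both phases coincide, so the projection and its complement recombine to the identity, whatever
the pattern. -/
theorem CohTyping.sem_gphase {T T' S : Ty} {y : Var} {r : ℝ}
    (d : CohTyping (Prog.gphase T y r) S T') :
    ∃ h : S = T', d.sem = Complex.exp (Complex.I * r) • (h ▸ 1) := by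
  cases d with
  | rphase r r' d => exact ⟨rfl, by simp only [CohTyping.sem]; rw [← smul_add]; congr 1; abel⟩

theorem Expr.Separated.gphase {T : Ty} {x y : Var} {r : ℝ} {e₁ e₂ : Expr}
    (h : Expr.Separated T x e₁ e₂) :
    Expr.Separated T x (Expr.app (Prog.gphase T y r) e₁) e₂ := by
  intro Γ₁ Δ₁ Γ₂ Δ₂ d₁ d₂ σ₁ σ₂ S h₁ h₂ τ₁ τ₂ hne
  cases d₁ with
  | app df de =>
    obtain ⟨hS, hd⟩ := df.sem_gphase
    subst hS
    have := h de d₂ σ₁ σ₂ h₁ h₂ τ₁ τ₂ hne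
    simp [PureTyping.sem, hd, this]

/-- At a fixed valuation the output is a linear combination of branch outputs at the same valuation,
each of them orthogonal to the other output. The coefficients play no role. -/
theorem Expr.Separated.ctrl {T T' : Ty} {x : Var} {e e₂ : Expr} {n : ℕ} {p b : Fin n → Expr}
    (h : ∀ k, Expr.Separated T x (b k) e₂) :
    Expr.Separated T x (Expr.ctrl e T' n p b T) e₂ := by
  intro Γ₁ Δ₁ Γ₂ Δ₂ d₁ d₂ σ₁ σ₂ S h₁ h₂ τ₁ τ₂ hne
  cases d₁ with
  | ctrl hD hΓ de ho dp hc her db =>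
    rename_i Γp Γb
    obtain ⟨c, hs⟩ : ∃ c : ∀ j, Valuation (Γp j) → ℂ, ∀ w,
        (PureTyping.ctrl hD hΓ de ho dp hc her db).sem σ₁ w τ₁ =
          ∑ j, ∑ σj, c j σj * (db j).sem (Valuation.join (hΓ j) σ₁ σj) w τ₁ :=
      ⟨_, fun w => PureTyping.sem_ctrl_apply hD hΓ de ho dp hc her db σ₁ w τ₁⟩
    rw [Matrix.mul_apply]
    simp only [Matrix.conjTranspose_apply, hs, star_sum, Finset.sum_mul]
    rw [Finset.sum_comm]
    refine Finset.sum_eq_zero fun j _ => ?_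
    rw [Finset.sum_comm]
    refine Finset.sum_eq_zero fun σj _ => ?_
    have := h j (db j) d₂ (Valuation.join (hΓ j) σ₁ σj) σ₂ h₁ h₂ τ₁ τ₂ hne
    rw [Matrix.mul_apply] at this
    simp only [Matrix.conjTranspose_apply] at this
    simp only [star_mul', mul_assoc, ← Finset.mul_sum, this, mul_zero]

/-- By symmetry it suffices to replace entries on one side: the passage from `l` to `l'` is made
first in one argument, then in the other. -/
theorem Expr.Separated.extend {T : Ty} {x : Var} {l l' : List Expr}
    (h : ∀ e₁ ∈ l, ∀ e₂ ∈ l, Expr.Separated T x e₁ e₂)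
    (h' : ∀ e₂, (∀ e₁ ∈ l, Expr.Separated T x e₁ e₂) → ∀ e₁ ∈ l', Expr.Separated T x e₁ e₂) :
    ∀ e₁ ∈ l', ∀ e₂ ∈ l', Expr.Separated T x e₁ e₂ := by
  intro e₁ he₁ e₂ he₂
  refine h' e₂ (fun e he => ?_) e₁ he₁
  exact Expr.Separated.symm (h' e (fun e' he' => h e' he' e he) e₂ he₂)

/-- An erasable variable is copied into the same place of the output by all non-null entries, up to
phases and linear combinations. Outputs for different values of it are therefore orthogonal, across
entries as well as within one. -/
theorem Erases.separated {T : Ty} {x : Var} {l : List Expr} (h : Erases T x l) :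
    ∀ e₁ ∈ l, ∀ e₂ ∈ l, Expr.Separated T x e₁ e₂ := by
  induction h with
  | gphase y r h ih =>
    refine Expr.Separated.extend ih fun e₂ h₂ e₁ he₁ => ?_
    simp only [List.mem_append, List.mem_cons] at he₁ h₂
    rcases he₁ with he | rfl | he
    · exact h₂ _ (.inl he)
    · exact Expr.Separated.gphase (h₂ _ (.inr (.inl rfl)))
    · exact h₂ _ (.inr (.inr he))
  | ctrl hp h ih =>
    refine Expr.Separated.extend ih fun e₂ h₂ e₁ he₁ => ?_
    simp only [List.mem_append, List.mem_cons, List.mem_ofFn] at he₁ h₂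
    rcases he₁ with he | rfl | he
    · exact h₂ _ (.inl (.inl he))
    · exact Expr.Separated.ctrl fun k => h₂ _ (.inl (.inr ⟨k, rfl⟩))
    · exact h₂ _ (.inr he)
  | @var T x n =>
    intro e₁ he₁ e₂ he₂
    obtain rfl := (List.mem_replicate.1 he₁).2
    obtain rfl := (List.mem_replicate.1 he₂).2
    intro Γ₁ Δ₁ Γ₂ Δ₂ d₁ d₂ σ₁ σ₂ S h₁ h₂ τ₁ τ₂ hne
    cases d₁ with
    | cvar h => exact absurd h₁ (Finset.notMem_empty _)
    | qvar h =>
      cases d₂ with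
      | cvar h => exact absurd h₂ (Finset.notMem_empty _)
      | qvar h =>
        obtain rfl : S = T := by simpa [Ctx.single] using h₁
        rw [Matrix.mul_apply]
        refine Finset.sum_eq_zero fun v _ => ?_
        simp only [PureTyping.sem, Matrix.of_apply, Matrix.conjTranspose_apply]
        by_cases hv : v = τ₁ ⟨(x, S), h₁⟩
        · rw [if_neg (hv.trans_ne hne), mul_zero]
        · rw [if_neg hv, star_zero, zero_mul]
  | @pair₀ T₀ T₁ x l hl ih =>
    intro e₁ he₁ e₂ he₂
    obtain ⟨q₁, hq₁, rfl⟩ := List.mem_map.1 he₁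
    obtain ⟨q₂, hq₂, rfl⟩ := List.mem_map.1 he₂
    intro Γ₁ Δ₁ Γ₂ Δ₂ d₁ d₂ σ₁ σ₂ S h₁ h₂ τ₁ τ₂ hne
    by_cases hn₁ : (Expr.pair q₁.1 q₁.2).Null
    · simp [d₁.sem_eq_zero hn₁]
    by_cases hn₂ : (Expr.pair q₂.1 q₂.2).Null
    · simp [d₂.sem_eq_zero hn₂]
    -- In a non-null pair the quantum variable `x` is not classical too, so the component that
    -- erases it must have it in its quantum context. Otherwise that component would be null.
    have hx₁ := fun hΓ => hn₁ (d₁.null_of_overlap hΓ (Ctx.mem_dom_of_mem h₁))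
    have hx₂ := fun hΓ => hn₂ (d₂.null_of_overlap hΓ (Ctx.mem_dom_of_mem h₂))
    simp only [Expr.Null, not_or] at hn₁ hn₂
    cases d₁ with
    | pair ha ha' ha'' d₀ d₁ =>
      cases d₂ with
      | pair hb hb' hb'' d₀' d₁' =>
        have hy₁ := of_not_not fun h =>
          hn₁.1 (hl.null_of_notMem _ (List.mem_map_of_mem hq₁) d₀ hx₁ h)
        have hy₂ := of_not_not fun h =>
          hn₂.1 (hl.null_of_notMem _ (List.mem_map_of_mem hq₂) d₀' hx₂ h)
        obtain ⟨S₁, hS₁⟩ := Ctx.mem_dom.1 hy₁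
        obtain rfl := Ctx.functional _ _ _ _ h₁ (ha''.left_sub hS₁)
        obtain ⟨S₂, hS₂⟩ := Ctx.mem_dom.1 hy₂
        obtain rfl := Ctx.functional _ _ _ _ h₂ (hb''.left_sub hS₂)
        rw [inner_pair (fun v₀ v₁ => PureTyping.sem_pair_apply _ _ _ _ _ _ v₀ v₁ _)
          (fun v₀ v₁ => PureTyping.sem_pair_apply _ _ _ _ _ _ v₀ v₁ _)]
        rw [ih _ (List.mem_map_of_mem hq₁) _ (List.mem_map_of_mem hq₂) d₀ d₀' σ₁ σ₂ hS₁ hS₂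
          _ _ hne, zero_mul]
  | @pair₁ T₀ T₁ x l hl ih =>
    intro e₁ he₁ e₂ he₂
    obtain ⟨q₁, hq₁, rfl⟩ := List.mem_map.1 he₁
    obtain ⟨q₂, hq₂, rfl⟩ := List.mem_map.1 he₂
    intro Γ₁ Δ₁ Γ₂ Δ₂ d₁ d₂ σ₁ σ₂ S h₁ h₂ τ₁ τ₂ hne
    by_cases hn₁ : (Expr.pair q₁.1 q₁.2).Null
    · simp [d₁.sem_eq_zero hn₁]
    by_cases hn₂ : (Expr.pair q₂.1 q₂.2).Null
    · simp [d₂.sem_eq_zero hn₂]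
    have hx₁ := fun hΓ => hn₁ (d₁.null_of_overlap hΓ (Ctx.mem_dom_of_mem h₁))
    have hx₂ := fun hΓ => hn₂ (d₂.null_of_overlap hΓ (Ctx.mem_dom_of_mem h₂))
    simp only [Expr.Null, not_or] at hn₁ hn₂
    cases d₁ with
    | pair ha ha' ha'' d₀ d₁ =>
      cases d₂ with
      | pair hb hb' hb'' d₀' d₁' =>
        have hy₁ := of_not_not fun h =>
          hn₁.2 (hl.null_of_notMem _ (List.mem_map_of_mem hq₁) d₁ hx₁ h)
        have hy₂ := of_not_not fun h =>
          hn₂.2 (hl.null_of_notMem _ (List.mem_map_of_mem hq₂) d₁' hx₂ h)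
        obtain ⟨S₁, hS₁⟩ := Ctx.mem_dom.1 hy₁
        obtain rfl := Ctx.functional _ _ _ _ h₁ (ha.second_sub ha' ha'' hS₁)
        obtain ⟨S₂, hS₂⟩ := Ctx.mem_dom.1 hy₂
        obtain rfl := Ctx.functional _ _ _ _ h₂ (hb.second_sub hb' hb'' hS₂)
        rw [inner_pair (fun v₀ v₁ => PureTyping.sem_pair_apply _ _ _ _ _ _ v₀ v₁ _)
          (fun v₀ v₁ => PureTyping.sem_pair_apply _ _ _ _ _ _ v₀ v₁ _)]
        rw [ih _ (List.mem_map_of_mem hq₁) _ (List.mem_map_of_mem hq₂) d₁ d₁' σ₁ σ₂ hS₁ hS₂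
          _ _ hne, mul_zero]

/-! ### Evaluation of classical expressions -/

mutual
  /-- `e.Ev ρ T v`: in the environment `ρ`, the classical expression `e` of type `T` evaluates
  to `v`. -/
  def Expr.Ev : Expr → Env → (T : Ty) → Val T → Prop
    | .unit, _, T, v => (⟨T, v⟩ : TVal) = ⟨Ty.unit, ()⟩
    | .var x, ρ, T, v => ρ x = ⟨T, v⟩
    | .pair e₀ e₁, ρ, T, v => ∃ (T₀ T₁ : Ty) (v₀ : Val T₀) (v₁ : Val T₁),
        e₀.Ev ρ T₀ v₀ ∧ e₁.Ev ρ T₁ v₁ ∧ (⟨T, v⟩ : TVal) = ⟨Ty.tensor T₀ T₁, Val.mk v₀ v₁⟩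
    | .ctrl e S _ p b _, ρ, T, v => ∃ u : Val S, e.Ev ρ S u ∧ ∃ j ρ', (p j).Ev ρ' S u ∧
        (b j).Ev (fun x => if x ∈ (p j).FV then ρ' x else ρ x) T v
    | .mmatch e S _ p b _, ρ, T, v => ∃ u : Val S, e.Ev ρ S u ∧ ∃ j ρ', (p j).Ev ρ' S u ∧
        (b j).Ev (fun x => if x ∈ (p j).FV then ρ' x else ρ x) T v
    | .tryCatch e₀ e₁, ρ, T, v => e₀.Ev ρ T v ∨ (∀ u, ¬ e₀.Ev ρ T u) ∧ e₁.Ev ρ T v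
    | .app f e, ρ, T, v => ∃ u, e.Ev ρ f.src u ∧ f.Ev f.src T u v
  /-- `f.Ev T T' u v`: the classical program `f` maps the value `u` of type `T` to the value `v`
  of type `T'`. -/
  def Prog.Ev : Prog → (T T' : Ty) → Val T → Val T' → Prop
    | .u3 _ _ _, _, _, _, _ => False
    | .left T₀ T₁, T, T', u, v => ∃ w : Val T₀, (⟨T, u⟩ : TVal) = ⟨T₀, w⟩ ∧
        (⟨T', v⟩ : TVal) = ⟨Ty.sum T₀ T₁, Val.inl T₁ w⟩
    | .right T₀ T₁, T, T', u, v => ∃ w : Val T₁, (⟨T, u⟩ : TVal) = ⟨T₁, w⟩ ∧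
        (⟨T', v⟩ : TVal) = ⟨Ty.sum T₀ T₁, Val.inr T₀ w⟩
    | .lam _ e e', T, T', u, v => ∃ ρ, e.Ev ρ T u ∧ e'.Ev ρ T' v
    | .rphase _ _ _ _, _, _, _, _ => False
    | .pmatch _ _ p b _, T, T', u, v => ∃ j ρ, (p j).Ev ρ T u ∧ (b j).Ev ρ T' v
end

theorem Expr.ev_pair {e₀ e₁ : Expr} {ρ : Env} {T₀ T₁ : Ty} {v₀ : Val T₀} {v₁ : Val T₁} :
    (Expr.pair e₀ e₁).Ev ρ (Ty.tensor T₀ T₁) (Val.mk v₀ v₁) ↔ e₀.Ev ρ T₀ v₀ ∧ e₁.Ev ρ T₁ v₁ := by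
  rw [Expr.Ev]
  constructor
  · rintro ⟨S₀, S₁, u₀, u₁, h₀, h₁, h⟩
    obtain ⟨hT, h⟩ := Sigma.mk.inj h
    cases hT
    obtain ⟨rfl, rfl⟩ := Prod.mk.inj (eq_of_heq h)
    exact ⟨h₀, h₁⟩
  · rintro ⟨h₀, h₁⟩
    exact ⟨T₀, T₁, v₀, v₁, h₀, h₁, rfl⟩

/-! ### The properties established by induction on the syntax -/

/-- The semantic properties of an expression: classical expressions are partial functions on basis
states, described by the evaluation relation, the semantics does not depend on the derivation, and
isometric expressions are isometric. -/
structure Expr.Good (e : Expr) : Prop where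
  pure_classical : ∀ {Γ Δ : Ctx} {T : Ty} (d : PureTyping Γ Δ e T), e.Classical →
    ∀ σ, PInj (d.sem σ) ∧ ∀ ρ : Env, σ.Below ρ →
      ∀ v, e.Ev ρ T v ↔ ∃ τ : Valuation Δ, τ.Below ρ ∧ d.sem σ v τ = 1
  mixed_classical : ∀ {Γ Δ : Ctx} {T : Ty} (d : MixedTyping Γ Δ e T), e.Classical →
    ∀ (σ : Valuation Γ) (ρ : Env), σ.Below ρ → ∀ τ : Valuation Δ, τ.BelowOff Γ ρ →
      IsResult (e.Ev ρ T) (d.sem σ (ketbra τ τ))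
  unique : e.Det → ∀ {Γ Δ : Ctx} {T : Ty} (d d' : PureTyping Γ Δ e T) (σ : Valuation Γ),
    d.sem σ = d'.sem σ
  iso : IsoExpr e → ∀ {Γ Δ : Ctx} {T : Ty} (d : PureTyping Γ Δ e T) (σ : Valuation Γ),
    (d.sem σ)ᴴ * d.sem σ = 1
  total : IsoExpr e → e.Classical → ∀ {Γ Δ : Ctx} {T : Ty}, MixedTyping Γ Δ e T →
    ∀ (σ : Valuation Γ) (ρ : Env), σ.Below ρ → ∀ τ : Valuation Δ, τ.BelowOff Γ ρ →
      ∃ v, e.Ev ρ T v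

/-- The semantic properties of a program, as for expressions. -/
structure Prog.Good (f : Prog) : Prop where
  coh_classical : ∀ {T T' : Ty} (d : CohTyping f T T'), f.Classical →
    PInj d.sem ∧ ∀ u v, f.Ev T T' u v ↔ d.sem v u = 1
  chan_classical : ∀ {T T' : Ty} (d : ChanTyping f T T'), f.Classical →
    ∀ u, IsResult (f.Ev T T' u) (d.sem (ketbra u u))
  unique : f.Det → ∀ {T T' : Ty} (d d' : CohTyping f T T'), d.sem = d'.sem
  iso : IsoProg f → ∀ {T T' : Ty} (d : CohTyping f T T'), d.semᴴ * d.sem = 1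
  total : IsoProg f → f.Classical → ∀ {T T' : Ty}, ChanTyping f T T' → ∀ u, ∃ v, f.Ev T T' u v

/-- A pattern is hereditarily good if all its subpatterns and the programs applied in it are. -/
def Expr.Hereditary : Expr → Prop
  | .unit => Expr.unit.Good
  | .var x => (Expr.var x).Good
  | .pair e₀ e₁ => (Expr.pair e₀ e₁).Good ∧ e₀.Hereditary ∧ e₁.Hereditary
  | .ctrl e T n p b T' => (Expr.ctrl e T n p b T').Good
  | .mmatch e T n p b T' => (Expr.mmatch e T n p b T').Good
  | .tryCatch e₀ e₁ => (Expr.tryCatch e₀ e₁).Good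
  | .app f e => (Expr.app f e).Good ∧ f.Good ∧ e.Hereditary

theorem Expr.Hereditary.good {e : Expr} (h : e.Hereditary) : e.Good := by
  cases e <;> simp only [Expr.Hereditary] at h
  all_goals first | exact h | exact h.1

/-! ### Orthogonality of the patterns of an orthogonality judgment -/

/-- The operators of two closed expressions have orthogonal images. -/
def Expr.Orthogonal (T : Ty) (e e' : Expr) : Prop :=
  ∀ (Δ Δ' : Ctx) (d : PureTyping Ctx.empty Δ e T) (d' : PureTyping Ctx.empty Δ' e' T),
    (d.sem Valuation.empty)ᴴ * d'.sem Valuation.empty = 0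

theorem Expr.Orthogonal.symm {T : Ty} {e e' : Expr} (h : Expr.Orthogonal T e e') :
    Expr.Orthogonal T e' e := by
  intro Δ Δ' d d'
  have := h _ _ d' d
  rw [← Matrix.conjTranspose_conjTranspose ((d.sem _)ᴴ * d'.sem _),
    Matrix.conjTranspose_mul, Matrix.conjTranspose_conjTranspose, this,
    Matrix.conjTranspose_zero]

/-- The two derivations may type `f` differently. Uniqueness makes the two operators equal, and then
the isometry cancels from the inner product. -/
theorem Expr.Orthogonal.app {T' : Ty} {f : Prog} {e e' : Expr} (hf : f.Good)
    (hd : f.Det) (hiso : IsoProg f) (h : Expr.Orthogonal f.src e e') :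
    Expr.Orthogonal T' (Expr.app f e) (Expr.app f e') := by
  intro Δ Δ' d d'
  cases d with
  | app df de =>
    cases d' with
    | app df' de' =>
      obtain rfl := df.src_eq
      obtain rfl := df'.src_eq
      simp only [PureTyping.sem]
      rw [hf.unique hd df' df, Matrix.conjTranspose_mul, Matrix.mul_assoc,
        ← Matrix.mul_assoc _ df.sem, hf.iso hiso, Matrix.one_mul, h _ _ de de']

theorem Expr.orthogonal_left_right {T₀ T₁ T : Ty} {e e' : Expr} :
    Expr.Orthogonal T (Expr.app (Prog.left T₀ T₁) e) (Expr.app (Prog.right T₀ T₁) e') := by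
  intro Δ Δ' d d'
  cases d with
  | app df de =>
    cases df with
    | left =>
      cases d' with
      | app df' de' =>
        cases df' with
        | right =>
          simp only [PureTyping.sem]
          rw [Matrix.conjTranspose_mul, Matrix.mul_assoc, ← Matrix.mul_assoc _ (CohTyping.sem _)]
          have : (CohTyping.left T₀ T₁).semᴴ * (CohTyping.right T₀ T₁).sem = 0 := by
            ext u v
            rw [Matrix.mul_apply, Val.sum_sum]
            simp
          rw [this]
          simp

theorem Expr.Orthogonal.pair_left {T₀ T₁ : Ty} {e₀ e₁ e₀' e₁' : Expr}
    (h : Expr.Orthogonal T₀ e₀ e₀') :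
    Expr.Orthogonal (Ty.tensor T₀ T₁) (Expr.pair e₀ e₁) (Expr.pair e₀' e₁') := by
  intro Δ Δ' d d'
  cases d with
  | pair h₀ h₁ hD d₀ d₁ =>
    cases d' with
    | pair h₀' h₁' hD' d₀' d₁' =>
      ext τ τ'
      rw [inner_pair (fun v₀ v₁ => PureTyping.sem_pair_apply _ _ _ _ _ _ v₀ v₁ _)
        (fun v₀ v₁ => PureTyping.sem_pair_apply _ _ _ _ _ _ v₀ v₁ _), h _ _ d₀ d₀']
      simp

theorem Expr.Orthogonal.pair_right {T₀ T₁ : Ty} {e₀ e₁ e₀' e₁' : Expr}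
    (h : Expr.Orthogonal T₁ e₁ e₁') :
    Expr.Orthogonal (Ty.tensor T₀ T₁) (Expr.pair e₀ e₁) (Expr.pair e₀' e₁') := by
  intro Δ Δ' d d'
  cases d with
  | pair h₀ h₁ hD d₀ d₁ =>
    cases d' with
    | pair h₀' h₁' hD' d₀' d₁' =>
      ext τ τ'
      rw [inner_pair (fun v₀ v₁ => PureTyping.sem_pair_apply _ _ _ _ _ _ v₀ v₁ _)
        (fun v₀ v₁ => PureTyping.sem_pair_apply _ _ _ _ _ _ v₀ v₁ _), h _ _ d₁ d₁']
      simp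

/-- Hereditary goodness is assumed inside the relation, pair by pair, because the subsequence rule
passes through a longer list whose further entries need not be known to be good. -/
theorem Ortho.pairwise : ∀ {T : Ty} {l : List Expr}, Ortho T l →
    l.Pairwise fun e e' => e.Hereditary → e'.Hereditary → Expr.Orthogonal T e e'
  | _, _, .void => List.Pairwise.nil
  | _, _, .unit => List.pairwise_singleton _ _
  | _, _, .var _ x => List.pairwise_singleton _ _
  | _, _, .isoApp h df hf => by
      have ih := h.pairwise
      obtain rfl := df.src_eq
      rw [List.pairwise_map]
      refine ih.imp fun {a b} hab ha hb => ?_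
      simp only [Expr.Hereditary] at ha hb
      exact Expr.Orthogonal.app ha.2.1 hf.det hf (hab ha.2.2 hb.2.2)
  | _, _, .sum (T₀ := T₀) (T₁ := T₁) h h' => by
      have ih := h.pairwise
      have ih' := h'.pairwise
      rw [List.pairwise_append, List.pairwise_map, List.pairwise_map]
      refine ⟨ih.imp fun {a b} hab ha hb => ?_, ih'.imp fun {a b} hab ha hb => ?_, ?_⟩
      · simp only [Expr.Hereditary] at ha hb
        exact Expr.Orthogonal.app ha.2.1 (IsoProg.left _ _).det (.left _ _) (hab ha.2.2 hb.2.2)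
      · simp only [Expr.Hereditary] at ha hb
        exact Expr.Orthogonal.app ha.2.1 (IsoProg.right _ _).det (.right _ _) (hab ha.2.2 hb.2.2)
      · intro a ha b hb _ _
        obtain ⟨a, _, rfl⟩ := List.mem_map.1 ha
        obtain ⟨b, _, rfl⟩ := List.mem_map.1 hb
        exact Expr.orthogonal_left_right
  | _, _, .pair h h' hfv => by
      have ih := h.pairwise
      have ih' := fun q hq => (h' q hq).pairwise
      rw [List.pairwise_flatMap]
      refine ⟨fun q hq => ?_, ?_⟩
      · rw [List.pairwise_map]
        refine (ih' q hq).imp fun {a b} hab ha hb => ?_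
        simp only [Expr.Hereditary] at ha hb
        exact Expr.Orthogonal.pair_right (hab ha.2.2 hb.2.2)
      · rw [List.pairwise_map] at ih
        refine ih.imp fun {q q'} hab a ha b hb hga hgb => ?_
        obtain ⟨a, _, rfl⟩ := List.mem_map.1 ha
        obtain ⟨b, _, rfl⟩ := List.mem_map.1 hb
        simp only [Expr.Hereditary] at hga hgb
        exact Expr.Orthogonal.pair_left (hab hga.2.1 hgb.2.1)
  | _, _, .sub h hs => by
      have ih := h.pairwise
      exact ih.sublist hs

theorem Ortho.orthogonal {T : Ty} {l : List Expr} (h : Ortho T l) (hl : ∀ e ∈ l, e.Hereditary)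
    {i j : Fin l.length} (hij : i ≠ j) : Expr.Orthogonal T (l.get i) (l.get j) := by
  have h1 := List.pairwise_iff_get.1 h.pairwise
  rcases lt_or_gt_of_ne hij with h2 | h2
  · exact h1 i j h2 (hl _ (l.get_mem i)) (hl _ (l.get_mem j))
  · exact Expr.Orthogonal.symm (h1 j i h2 (hl _ (l.get_mem j)) (hl _ (l.get_mem i)))

theorem Ortho.orthogonal_ofFn {T : Ty} {n : ℕ} {p : Fin n → Expr} (h : Ortho T (List.ofFn p))
    (hp : ∀ k, (p k).Hereditary) {i j : Fin n} (hij : i ≠ j) :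
    Expr.Orthogonal T (p i) (p j) := by
  have h1 := h.orthogonal (by simpa [List.mem_ofFn] using hp)
    (i := ⟨i, by simp⟩) (j := ⟨j, by simp⟩) (by simpa [Fin.ext_iff] using hij)
  simpa using h1

/-! ### Completeness of the patterns of a spanning judgment -/

open Classical in
/-- The operator `⟦e⟧⟦e⟧†` of a closed expression `e` of type `T`. -/
noncomputable def Expr.proj (T : Ty) (e : Expr) : Matrix (Val T) (Val T) ℂ :=
  if h : Nonempty (Σ Δ, PureTyping Ctx.empty Δ e T) then
    h.some.2.sem Valuation.empty * (h.some.2.sem Valuation.empty)ᴴ else 0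

/-- The chosen derivation has the same context because a pattern is not null, and then the same
operator by uniqueness. -/
theorem PureTyping.proj_eq {Δ : Ctx} {e : Expr} {T : Ty} (d : PureTyping Ctx.empty Δ e T)
    (hg : e.Good) (hd : e.Det) (hp : e.Pat) :
    e.proj T = d.sem Valuation.empty * (d.sem Valuation.empty)ᴴ := by
  have h : Nonempty (Σ Δ, PureTyping Ctx.empty Δ e T) := ⟨⟨Δ, d⟩⟩
  rw [Expr.proj, dif_pos h]
  generalize h.some = s
  obtain ⟨Δ', d'⟩ := s
  obtain rfl := d.ctx_unique d' hp.not_null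
  rw [hg.unique hd d d']

theorem PureTyping.pInj_qvar {Γ : Ctx} {x : Var} {T : Ty} (h : x ∉ Γ.dom) (σ : Valuation Γ) :
    PInj ((PureTyping.qvar (T := T) h).sem σ) := by
  simp only [PureTyping.sem]
  refine ⟨fun i j => ?_, fun {i j j'} h₁ h₂ => ?_, fun {i i' j} h₁ h₂ => ?_⟩
  · simp only [Matrix.of_apply]
    split <;> simp
  · simp only [Matrix.of_apply, ite_eq_left_iff, zero_ne_one, imp_false, not_not] at h₁ h₂
    funext b
    obtain ⟨b, hb⟩ := b
    obtain rfl := Finset.mem_singleton.1 hb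
    exact h₁.symm.trans h₂
  · simp only [Matrix.of_apply, ite_eq_left_iff, zero_ne_one, imp_false, not_not] at h₁ h₂
    exact h₁.trans h₂.symm

theorem Valuation.exists_single (x : Var) {T : Ty} (v : Val T) :
    ∃ τ : Valuation (Ctx.single x T), τ ⟨(x, T), Finset.mem_singleton_self (x, T)⟩ = v := by
  obtain ⟨τ, hτ⟩ := Valuation.exists_below (Δ := Ctx.single x T) (ρ := fun _ => ⟨T, v⟩) (by
    rintro b hb
    obtain rfl := Finset.mem_singleton.1 hb
    exact ⟨v, rfl⟩)
  refine ⟨τ, ?_⟩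
  have := hτ ⟨(x, T), Finset.mem_singleton_self (x, T)⟩
  simpa using this.symm

theorem PureTyping.qvar_mul_conjTranspose {Γ : Ctx} {x : Var} {T : Ty} (h : x ∉ Γ.dom)
    (σ : Valuation Γ) :
    (PureTyping.qvar (T := T) h).sem σ * ((PureTyping.qvar (T := T) h).sem σ)ᴴ = 1 := by
  ext v w
  obtain ⟨τ, hτ⟩ := Valuation.exists_single x w
  rw [PInj.mul_apply_of_right _ (PureTyping.pInj_qvar h σ).conjTranspose (j := τ)
    (conjTranspose_eq_one.2 (by simp [PureTyping.sem, hτ]))]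
  simp [PureTyping.sem, hτ, Matrix.one_apply]

theorem PureTyping.proj_app {T T' : Ty} {f : Prog} {e : Expr} (df : CohTyping f T T')
    (hg : (Expr.app f e).Hereditary) (hd : f.Det) (hde : e.Det) (hp : e.Pat)
    (ht : Nonempty (Σ Δ, PureTyping Ctx.empty Δ (Expr.app f e) T')) :
    (Expr.app f e).proj T' = df.sem * e.proj T * df.semᴴ := by
  simp only [Expr.Hereditary] at hg
  obtain ⟨Δ, d⟩ := ht
  rw [d.proj_eq hg.1 (by simp [Expr.Det, hd, hde]) (by simpa [Expr.Pat] using hp)]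
  cases d with
  | app df' de =>
    obtain rfl := df.src_eq
    obtain rfl := df'.src_eq
    rw [de.proj_eq hg.2.2.good hde hp, hg.2.1.unique hd df df']
    simp only [PureTyping.sem, Matrix.conjTranspose_mul, Matrix.mul_assoc]

theorem PureTyping.nonempty_of_app {T T' : Ty} {f : Prog} {e : Expr} (df : CohTyping f T T')
    (ht : Nonempty (Σ Δ, PureTyping Ctx.empty Δ (Expr.app f e) T')) :
    Nonempty (Σ Δ, PureTyping Ctx.empty Δ e T) := by
  obtain ⟨Δ, d⟩ := ht
  cases d with
  | app df' de =>
    obtain rfl := df.src_eq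
    obtain rfl := df'.src_eq
    exact ⟨⟨Δ, de⟩⟩

/-- Conjugating the sum of the projections of a list of patterns. -/
theorem sum_proj_app {T T' : Ty} {f : Prog} {l : List Expr} (df : CohTyping f T T')
    (hg : ∀ e ∈ l, (Expr.app f e).Hereditary) (hd : f.Det) (hde : ∀ e ∈ l, e.Det)
    (hp : ∀ e ∈ l, e.Pat)
    (ht : ∀ e ∈ l, Nonempty (Σ Δ, PureTyping Ctx.empty Δ (Expr.app f e) T')) :
    ((l.map (Expr.app f)).map (Expr.proj T')).sum =
      df.sem * (l.map (Expr.proj T)).sum * df.semᴴ := by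
  rw [List.map_map]
  induction l with
  | nil => simp
  | cons a l ih =>
    simp only [List.map_cons, List.sum_cons, Function.comp_apply, List.forall_mem_cons] at *
    rw [PureTyping.proj_app df hg.1 hd hde.1 hp.1 ht.1, ih hg.2 hde.2 hp.2 ht.2, Matrix.mul_add,
      Matrix.add_mul]

theorem left_mul_add_right_mul (T₀ T₁ : Ty) :
    (CohTyping.left T₀ T₁).sem * (CohTyping.left T₀ T₁).semᴴ +
      (CohTyping.right T₀ T₁).sem * (CohTyping.right T₀ T₁).semᴴ = 1 := by
  ext v w
  rw [Matrix.add_apply, Matrix.mul_apply, Matrix.mul_apply]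
  rcases Val.eq_inl_or_inr v with ⟨v, rfl⟩ | ⟨v, rfl⟩ <;>
    rcases Val.eq_inl_or_inr w with ⟨w, rfl⟩ | ⟨w, rfl⟩ <;>
    simp [Matrix.one_apply, eq_comm]

/-- The tensor product of two matrices. -/
def Val.kron {T₀ T₁ : Ty} (A : Matrix (Val T₀) (Val T₀) ℂ) (B : Matrix (Val T₁) (Val T₁) ℂ) :
    Matrix (Val (Ty.tensor T₀ T₁)) (Val (Ty.tensor T₀ T₁)) ℂ :=
  Matrix.of fun v w => A v.1 w.1 * B v.2 w.2

theorem Val.kron_mk {T₀ T₁ : Ty} (A : Matrix (Val T₀) (Val T₀) ℂ)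
    (B : Matrix (Val T₁) (Val T₁) ℂ) (v₀ w₀ : Val T₀) (v₁ w₁ : Val T₁) :
    Val.kron A B (Val.mk v₀ v₁) (Val.mk w₀ w₁) = A v₀ w₀ * B v₁ w₁ := rfl

theorem Val.one_kron_one (T₀ T₁ : Ty) :
    Val.kron (1 : Matrix (Val T₀) (Val T₀) ℂ) (1 : Matrix (Val T₁) (Val T₁) ℂ) = 1 := by
  ext v w
  obtain ⟨v₀, v₁, rfl⟩ := Val.eq_mk v
  obtain ⟨w₀, w₁, rfl⟩ := Val.eq_mk w
  rw [Val.kron_mk, Matrix.one_apply, Matrix.one_apply, Matrix.one_apply]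
  by_cases h₀ : v₀ = w₀ <;> by_cases h₁ : v₁ = w₁ <;> simp [h₀, h₁]

theorem Val.kron_sum {T₀ T₁ : Ty} {α : Type} (A : Matrix (Val T₀) (Val T₀) ℂ)
    (g : α → Matrix (Val T₁) (Val T₁) ℂ) (l : List α) :
    (l.map fun a => Val.kron A (g a)).sum = Val.kron A (l.map g).sum := by
  induction l with
  | nil => ext v w; simp [Val.kron]
  | cons a l ih =>
    simp only [List.map_cons, List.sum_cons, ih]
    ext v w
    simp [Val.kron, mul_add]

theorem Val.sum_kron {T₀ T₁ : Ty} {α : Type} (B : Matrix (Val T₁) (Val T₁) ℂ)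
    (g : α → Matrix (Val T₀) (Val T₀) ℂ) (l : List α) :
    (l.map fun a => Val.kron (g a) B).sum = Val.kron (l.map g).sum B := by
  induction l with
  | nil => ext v w; simp [Val.kron]
  | cons a l ih =>
    simp only [List.map_cons, List.sum_cons, ih]
    ext v w
    simp [Val.kron, add_mul]

/-- Restriction to two parts that cover the context is always injective; disjointness of the parts
gives surjectivity. -/
theorem Valuation.restrict_bijective {A B C : Ctx} (hA : A.bindings ⊆ C.bindings)
    (hB : B.bindings ⊆ C.bindings) (h : C.bindings = A.bindings ∪ B.bindings)
    (hd : Disjoint A.dom B.dom) :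
    Function.Bijective fun τ : Valuation C => (τ.restrict hA, τ.restrict hB) := by
  constructor
  · intro τ τ' hτ
    simp only [Prod.mk.injEq] at hτ
    exact Valuation.eq_of_restrict hA hB h hτ.1 hτ.2
  · rintro ⟨τ₀, τ₁⟩
    obtain ⟨ρ, h₀, h₁⟩ := τ₀.exists_env_pair τ₁
    have h₁ := h₁.below fun x hx => Finset.disjoint_left.1 hd hx
    obtain ⟨τ, hτ⟩ := Valuation.exists_below (Δ := C) (ρ := ρ) (by
      intro b hb
      rw [h, Finset.mem_union] at hb
      rcases hb with hb | hb
      · exact ⟨_, h₀ ⟨b, hb⟩⟩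
      · exact ⟨_, h₁ ⟨b, hb⟩⟩)
    exact ⟨τ, Prod.ext ((hτ.restrict hA).eq h₀) ((hτ.restrict hB).eq h₁)⟩

/-- The sum over valuations of the pair splits into a double sum because the components share no
variable. With a shared variable, as in `(x, x)`, only a diagonal part would be reached. -/
theorem PureTyping.proj_pair {T₀ T₁ : Ty} {e₀ e₁ : Expr}
    (hg : (Expr.pair e₀ e₁).Hereditary) (hd₀ : e₀.Det) (hd₁ : e₁.Det) (hp₀ : e₀.Pat)
    (hp₁ : e₁.Pat) (hfv : Disjoint e₀.FV e₁.FV)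
    (ht : Nonempty (Σ Δ, PureTyping Ctx.empty Δ (Expr.pair e₀ e₁) (Ty.tensor T₀ T₁))) :
    (Expr.pair e₀ e₁).proj (Ty.tensor T₀ T₁) = Val.kron (e₀.proj T₀) (e₁.proj T₁) := by
  simp only [Expr.Hereditary] at hg
  obtain ⟨Δ, d⟩ := ht
  rw [d.proj_eq hg.1 (by simp [Expr.Det, hd₀, hd₁]) (by simp [Expr.Pat, hp₀, hp₁])]
  cases d with
  | pair h₀ h₁ h d₀ d₁ =>
    rw [d₀.proj_eq hg.2.1.good hd₀ hp₀, d₁.proj_eq hg.2.2.good hd₁ hp₁]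
    have hdis := d₀.dom_eq_FV hp₀ ▸ d₁.dom_eq_FV hp₁ ▸ hfv
    have hb := Valuation.restrict_bijective h.left_sub (h₀.second_sub h₁ h)
      (Ctx.Join.bindings_pair h₀ h₁ h) hdis
    ext v w
    obtain ⟨v₀, v₁, rfl⟩ := Val.eq_mk v
    obtain ⟨w₀, w₁, rfl⟩ := Val.eq_mk w
    rw [Val.kron_mk, Matrix.mul_apply, Matrix.mul_apply, Matrix.mul_apply, Finset.sum_mul_sum,
      ← Fintype.sum_prod_type', ← hb.sum_comp]
    refine Finset.sum_congr rfl fun τ _ => ?_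
    simp only [Matrix.conjTranspose_apply]
    rw [PureTyping.sem_pair_apply, PureTyping.sem_pair_apply, star_mul']
    ring

theorem isEmpty_of_one_eq_zero {m : Type} [Fintype m] [DecidableEq m]
    (h : (0 : Matrix m m ℂ) = 1) : IsEmpty m :=
  ⟨fun i => by simpa using congrFun (congrFun h i) i⟩

/-- The projections onto the images of the patterns of a spanning judgment add up to the
identity. -/
theorem Spanning.sum_proj : ∀ {T : Ty} {l : List Expr}, Spanning T l →
    (∀ e ∈ l, e.Hereditary) → (∀ e ∈ l, Nonempty (Σ Δ, PureTyping Ctx.empty Δ e T)) →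
    (l.map (Expr.proj T)).sum = 1
  | _, _, .void, _, _ => by
      ext v
      exact Empty.elim v
  | _, _, .unit, hg, ht => by
      rw [List.map_singleton, List.sum_singleton]
      rw [PureTyping.unit.proj_eq (hg _ (List.mem_singleton_self _)).good (by simp [Expr.Det])
        (by simp [Expr.Pat])]
      ext v w
      obtain rfl : v = w := rfl
      rw [Matrix.mul_apply]
      simp [PureTyping.sem]
  | _, _, .var T x, hg, ht => by
      rw [List.map_singleton, List.sum_singleton]
      have hx : x ∉ Ctx.empty.dom := by simp
      rw [(PureTyping.qvar hx).proj_eq (hg _ (List.mem_singleton_self _)).good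
        (by simp [Expr.Det]) (by simp [Expr.Pat]), PureTyping.qvar_mul_conjTranspose]
  | _, _, .unApp (T := T) (T' := T') (l := l) h df hf hdim, hg, ht => by
      have ih := h.sum_proj
      have hdet := h.det
      have hpat := h.pat
      simp only [List.forall_mem_map] at hg ht
      have hcard : Fintype.card (Val T) = Fintype.card (Val T') := by simpa using hdim
      have ih := ih (fun e he => by
        have := hg e he
        simp only [Expr.Hereditary] at this
        exact this.2.2) fun e he => PureTyping.nonempty_of_app df (ht e he)
      rw [sum_proj_app df hg hf.det hdet hpat ht, ih, Matrix.mul_one]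
      -- Goodness of `f` is available only through an entry of the list. If there is none, the
      -- completeness relation upstairs reads `0 = 1`, so both spaces have dimension zero.
      cases l with
      | nil =>
        have := isEmpty_of_one_eq_zero ih
        have : IsEmpty (Val T') := Fintype.card_eq_zero_iff.1 (by rw [← hcard]; simp)
        exact Subsingleton.elim _ _
      | cons a l =>
        have := hg a (by simp)
        simp only [Expr.Hereditary] at this
        -- An isometry between spaces of equal dimension is unitary.
        exact (Matrix.mul_eq_one_comm_of_card_eq _ _ _ hcard).1 (this.2.1.iso hf df)
  | _, _, .sum (T₀ := T₀) (T₁ := T₁) h h', hg, ht => by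
      have ih := h.sum_proj
      have hdet := h.det
      have hpat := h.pat
      have ih' := h'.sum_proj
      have hdet' := h'.det
      have hpat' := h'.pat
      simp only [List.mem_append, or_imp, forall_and, List.forall_mem_map] at hg ht
      have ih := ih (fun e he => by
        have := hg.1 e he
        simp only [Expr.Hereditary] at this
        exact this.2.2) fun e he => PureTyping.nonempty_of_app (.left _ _) (ht.1 e he)
      have ih' := ih' (fun e he => by
        have := hg.2 e he
        simp only [Expr.Hereditary] at this
        exact this.2.2) fun e he => PureTyping.nonempty_of_app (.right _ _) (ht.2 e he)
      rw [List.map_append, List.sum_append,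
        sum_proj_app (.left T₀ T₁) hg.1 (IsoProg.left _ _).det hdet hpat ht.1,
        sum_proj_app (.right T₀ T₁) hg.2 (IsoProg.right _ _).det hdet' hpat' ht.2, ih, ih',
        Matrix.mul_one, Matrix.mul_one, left_mul_add_right_mul]
  | _, _, .pair (T₀ := T₀) (T₁ := T₁) (l := l) h h' hfv, hg, ht => by
      have ih := h.sum_proj
      have hdet := h.det
      have hpat := h.pat
      have ih' := fun q hq => (h' q hq).sum_proj
      have hdet' := fun q hq => (h' q hq).det
      have hpat' := fun q hq => (h' q hq).pat
      have hg : ∀ q ∈ l, ∀ e ∈ q.2, (Expr.pair q.1 e).Hereditary := fun q hq e he =>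
        hg _ (List.mem_flatMap.2 ⟨q, hq, List.mem_map_of_mem he⟩)
      have ht : ∀ q ∈ l, ∀ e ∈ q.2, Nonempty (Σ Δ, PureTyping Ctx.empty Δ (Expr.pair q.1 e)
        (Ty.tensor T₀ T₁)) := fun q hq e he =>
        ht _ (List.mem_flatMap.2 ⟨q, hq, List.mem_map_of_mem he⟩)
      have ih' : ∀ q ∈ l, (q.2.map (Expr.proj T₁)).sum = 1 := fun q hq =>
        ih' q hq (fun e he => by
          have := hg q hq e he
          simp only [Expr.Hereditary] at this
          exact this.2.2) fun e he => by
          obtain ⟨Δ, d⟩ := ht q hq e he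
          cases d with
          | pair h₀ h₁ h d₀ d₁ => exact ⟨⟨_, d₁⟩⟩
      -- A first component is known to be typed and good only if it occurs in some pair, so every
      -- inner list must be nonempty. This can fail only in dimension zero, where the claim is
      -- trivial.
      rcases isEmpty_or_nonempty (Val T₁) with hT | hT
      · have : IsEmpty (Val (Ty.tensor T₀ T₁)) := ⟨fun v => hT.elim v.2⟩
        exact Subsingleton.elim _ _
      · have hne : ∀ q ∈ l, ∃ e, e ∈ q.2 := by
          intro q hq
          refine List.exists_mem_of_ne_nil _ fun hq' => ?_
          have := ih' q hq
          rw [hq'] at this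
          exact (isEmpty_of_one_eq_zero this).elim hT.some
        have ih : ((l.map Prod.fst).map (Expr.proj T₀)).sum = 1 := ih
          (by
            rw [List.forall_mem_map]
            intro q hq
            obtain ⟨e, he⟩ := hne q hq
            have := hg q hq e he
            simp only [Expr.Hereditary] at this
            exact this.2.1)
          (by
            rw [List.forall_mem_map]
            intro q hq
            obtain ⟨e, he⟩ := hne q hq
            obtain ⟨Δ, d⟩ := ht q hq e he
            cases d with
            | pair h₀ h₁ h d₀ d₁ => exact ⟨⟨_, d₀⟩⟩)
        rw [List.map_flatMap, List.flatMap_def, List.sum_flatten, List.map_map]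
        -- For each first component the inner sum collapses to the identity of the second factor.
        rw [List.map_congr_left (g := fun q => Val.kron (q.1.proj T₀) 1)]
        · rw [Val.sum_kron, ← Val.one_kron_one, ← ih, List.map_map]
          rfl
        · intro q hq
          rw [Function.comp_apply, List.map_map, ← ih' q hq, ← Val.kron_sum]
          refine congrArg List.sum (List.map_congr_left fun e he => ?_)
          exact PureTyping.proj_pair (hg q hq e he) (hdet _ (List.mem_map_of_mem hq))
            (hdet' q hq e he) (hpat _ (List.mem_map_of_mem hq)) (hpat' q hq e he)
            (hfv q hq e he) (ht q hq e he)

theorem Spanning.sum_ofFn {T : Ty} {n : ℕ} {p : Fin n → Expr} (h : Spanning T (List.ofFn p))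
    (hp : ∀ k, (p k).Hereditary) {Δ : Fin n → Ctx}
    (d : ∀ k, PureTyping Ctx.empty (Δ k) (p k) T) :
    ∑ k, (d k).sem Valuation.empty * ((d k).sem Valuation.empty)ᴴ = 1 := by
  have h1 := h.sum_proj (by simpa [List.mem_ofFn] using hp)
    (by simpa only [List.mem_ofFn, forall_exists_index, forall_apply_eq_imp_iff] using
      fun k => ⟨⟨_, d k⟩⟩)
  rw [List.map_ofFn, List.sum_ofFn] at h1
  rw [← h1]
  refine Finset.sum_congr rfl fun k _ => ?_
  have hk : p k ∈ List.ofFn p := List.mem_ofFn.2 ⟨k, rfl⟩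
  rw [Function.comp_apply, (d k).proj_eq (hp k).good (h.det _ hk) (h.pat _ hk)]

/-! ### Selecting a branch -/

theorem ketbra_apply {m : Type} [DecidableEq m] (i j a b : m) :
    ketbra i j a b = if i = a ∧ j = b then 1 else 0 := Matrix.single_apply ..

theorem sum_ketbra_smul {m M : Type} [Fintype m] [DecidableEq m] [AddCommGroup M] [Module ℂ M]
    (u : m) (F : m → M) : ∑ v, ketbra u u v v • F v = F u := by
  rw [Finset.sum_eq_single u]
  · simp [ketbra_apply]
  · intro v _ hv
    simp [ketbra_apply, hv.symm]
  · simp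

/-- A basis value reached by two patterns would give an inner product equal to one, against
orthogonality; within one pattern injectivity applies. -/
theorem PInj.select_unique {ι m : Type} [Fintype m] {κ : ι → Type} {A : ∀ j, Matrix m (κ j) ℂ}
    (hA : ∀ j, PInj (A j)) (ho : ∀ j j', j ≠ j' → (A j)ᴴ * A j' = 0) {u : m} {j j' : ι}
    {s : κ j} {s' : κ j'} (h : A j u s = 1) (h' : A j' u s' = 1) :
    (⟨j, s⟩ : Σ j, κ j) = ⟨j', s'⟩ := by
  by_cases hj : j = j'
  · subst hj
    rw [(hA j).row h h']
  · have := (hA j).inner_eq_one (hA j') h h'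
    rw [ho j j' hj] at this
    simp at this

theorem PInj.sum_select {ι m M : Type} [Fintype ι] [Fintype m] [AddCommGroup M] [Module ℂ M]
    {κ : ι → Type} [∀ j, Fintype (κ j)] {A : ∀ j, Matrix m (κ j) ℂ}
    (hA : ∀ j, PInj (A j)) (ho : ∀ j j', j ≠ j' → (A j)ᴴ * A j' = 0) {u : m} {j : ι}
    {s : κ j} (h : A j u s = 1) (X : ∀ j, κ j → M) :
    ∑ j', ∑ s', (A j')ᴴ s' u • X j' s' = X j s := by
  classical
  rw [← Fintype.sum_sigma' (fun j' s' => (A j')ᴴ s' u • X j' s'), Finset.sum_eq_single ⟨j, s⟩]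
  · rw [conjTranspose_eq_one.2 h, one_smul]
  · rintro ⟨j', s'⟩ _ hne
    rw [(hA j').conjTranspose.eq_zero fun h' =>
      hne (PInj.select_unique hA ho (conjTranspose_eq_one.1 h') h), zero_smul]
  · simp

theorem PInj.sum_select_eq_zero {ι m M : Type} [Fintype ι] [AddCommGroup M]
    [Module ℂ M] {κ : ι → Type} [∀ j, Fintype (κ j)] {A : ∀ j, Matrix m (κ j) ℂ}
    (hA : ∀ j, PInj (A j)) {u : m} (h : ∀ j s, A j u s ≠ 1) (X : ∀ j, κ j → M) :
    ∑ j', ∑ s', (A j')ᴴ s' u • X j' s' = 0 :=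
  Finset.sum_eq_zero fun j' _ => Finset.sum_eq_zero fun s' _ => by
    rw [(hA j').conjTranspose.eq_zero fun h' => h j' s' (conjTranspose_eq_one.1 h'), zero_smul]

/-- If no pattern reached `u`, the diagonal entry at `u` of the completeness relation would vanish.
-/
theorem PInj.exists_select {ι m : Type} [Fintype ι] [DecidableEq m] {κ : ι → Type}
    [∀ j, Fintype (κ j)] {A : ∀ j, Matrix m (κ j) ℂ} (hA : ∀ j, PInj (A j))
    (h : ∑ j, A j * (A j)ᴴ = 1) (u : m) : ∃ j s, A j u s = 1 := by
  by_contra! hne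
  have h1 := congrFun (congrFun h u) u
  rw [Matrix.sum_apply, Matrix.one_apply_eq, Finset.sum_eq_zero] at h1
  · simp at h1
  · intro j _
    rw [Matrix.mul_apply]
    exact Finset.sum_eq_zero fun s _ => by rw [(hA j).eq_zero (hne j s), zero_mul]

theorem PInj.exists_of_iso {m k : Type} [Fintype m] [DecidableEq k] {A : Matrix m k ℂ}
    (hA : PInj A) (h : Aᴴ * A = 1) (j : k) : ∃ i, A i j = 1 := by
  by_contra! hne
  have h1 := congrFun (congrFun h j) j
  rw [Matrix.mul_apply, Matrix.one_apply_eq, Finset.sum_eq_zero] at h1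
  · simp at h1
  · exact fun i _ => by rw [hA.eq_zero (hne i), mul_zero]

/-- A result matrix determines the predicate, since the states of basis values are nonzero and
distinct. This compares evaluation in different environments that extend the same valuations. -/
theorem IsResult.iff_iff {k : Type} [DecidableEq k] {P P' : k → Prop} {M : Matrix k k ℂ}
    (h : IsResult P M) (h' : IsResult P' M) (u : k) : P u ↔ P' u := by
  have hne : ∀ v : k, ketbra v v ≠ (0 : Matrix k k ℂ) := fun v hv => by
    have := congrFun (congrFun hv v) v
    simp [ketbra_apply] at this
  rcases h with ⟨v, hv, hM⟩ | ⟨hP, hM⟩ <;> rcases h' with ⟨v', hv', hM'⟩ | ⟨hP', hM'⟩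
  · have : v = v' := by
      have := congrFun (congrFun (hM.symm.trans hM') v') v'
      simpa [ketbra_apply] using this
    rw [hv, hv', this]
  · exact absurd (hM.symm.trans hM') (hne v)
  · exact absurd (hM'.symm.trans hM) (hne v')
  · exact iff_of_false (hP u) (hP' u)

/-! ### Mixed derivations ending in the rules `mix` and `discard` -/

/-- The pure semantics of a classical expression agrees with evaluation. -/
def Expr.PureClassical (e : Expr) : Prop :=
  ∀ {Γ Δ : Ctx} {T : Ty} (d : PureTyping Γ Δ e T), e.Classical →
    ∀ σ, PInj (d.sem σ) ∧ ∀ ρ : Env, σ.Below ρ →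
      ∀ v, e.Ev ρ T v ↔ ∃ τ : Valuation Δ, τ.Below ρ ∧ d.sem σ v τ = 1

/-- A null expression has neither an operator nor a value. Otherwise the two contexts are disjoint,
so the environment extends all of `τ` and selects exactly its column. -/
theorem Expr.PureClassical.mix_isResult {e : Expr} (h : e.PureClassical) {Γ Δ : Ctx} {T : Ty}
    (d : PureTyping Γ Δ e T) (hc : e.Classical) {σ : Valuation Γ} {ρ : Env} (hσ : σ.Below ρ)
    {τ : Valuation Δ} (hτ : τ.BelowOff Γ ρ) :
    IsResult (e.Ev ρ T) ((MixedTyping.mix d).sem σ (ketbra τ τ)) := by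
  obtain ⟨hd, hv⟩ := h d hc σ
  simp only [MixedTyping.sem]
  refine hd.isResult_iff fun v => ?_
  rw [hv ρ hσ]
  by_cases hn : e.Null
  · simp [d.sem_eq_zero hn]
  · have hτ := hτ.below fun x hx hx' => hn (d.null_of_overlap hx hx')
    constructor
    · rintro ⟨τ', hτ', h'⟩
      rwa [hτ.eq hτ']
    · exact fun h => ⟨τ, hτ, h⟩

/-- Matrix entries are zero or one, and which of them occurs is decided by `Expr.Ev`, which knows
nothing of the derivation. -/
theorem Expr.PureClassical.unique {e : Expr} (h : e.PureClassical) (hc : e.Classical)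
    {Γ Δ : Ctx} {T : Ty} (d d' : PureTyping Γ Δ e T) (σ : Valuation Γ) : d.sem σ = d'.sem σ := by
  by_cases hn : e.Null
  · rw [d.sem_eq_zero hn, d'.sem_eq_zero hn]
  ext v τ
  obtain ⟨ρ, hσ, hτ⟩ := σ.exists_env_pair τ
  have hτ := hτ.below fun x hx hx' => hn (d.null_of_overlap hx hx')
  have key : ∀ d : PureTyping Γ Δ e T, d.sem σ v τ = 1 ↔ e.Ev ρ T v := fun d => by
    rw [(h d hc σ).2 ρ hσ]
    exact ⟨fun h => ⟨τ, hτ, h⟩, fun ⟨τ', hτ', h⟩ => hτ.eq hτ' ▸ h⟩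
  rcases (h d hc σ).1.zero_or_one v τ with h1 | h1
  · rw [h1, (h d' hc σ).1.eq_zero]
    rw [Ne, key, ← key d, h1]
    exact zero_ne_one
  · rw [h1, (key d').2 ((key d).1 h1)]

/-- The rules `mix` and `discard` are treated once for all expressions: a discarded basis state
contributes trace one, and the environment condition passes to the smaller context. Only the rule
specific to the expression is left. -/
theorem Expr.PureClassical.mixed {e : Expr} (h : e.PureClassical) {Γ : Ctx} {T : Ty}
    (hc : e.Classical)
    (other : ∀ {Δ : Ctx} (d : MixedTyping Γ Δ e T), (∀ d', d ≠ .mix d') →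
      (∀ {Δ' Δ₀ : Ctx} (h : Ctx.Join Δ' Δ₀ Δ) (d' : MixedTyping Γ Δ' e T), d ≠ .discard h d') →
      ∀ (σ : Valuation Γ) (ρ : Env), σ.Below ρ → ∀ τ : Valuation Δ, τ.BelowOff Γ ρ →
        IsResult (e.Ev ρ T) (d.sem σ (ketbra τ τ)))
    {Δ : Ctx} (d : MixedTyping Γ Δ e T) :
      ∀ (σ : Valuation Γ) (ρ : Env), σ.Below ρ → ∀ τ : Valuation Δ, τ.BelowOff Γ ρ →
        IsResult (e.Ev ρ T) (d.sem σ (ketbra τ τ)) := by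
  refine MixedTyping.discard_induction (Q := fun {Δ} d => ∀ (σ : Valuation Γ) (ρ : Env),
    σ.Below ρ → ∀ τ : Valuation Δ, τ.BelowOff Γ ρ →
        IsResult (e.Ev ρ T) (d.sem σ (ketbra τ τ))) ?_ ?_ d
  · intro Δ' Δ₀ D hJ d ih σ ρ hσ τ hτ
    simp only [MixedTyping.sem]
    rw [superop_ketbra, trace_ketbra, one_smul]
    exact ih σ ρ hσ _ (hτ.restrict hJ.left_sub)
  · intro Δ' d hd
    by_cases hm : ∃ d', d = .mix d'
    · obtain ⟨d', rfl⟩ := hm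
      exact fun σ ρ hσ τ hτ => h.mix_isResult d' hc hσ hτ
    · exact other d (fun d' hd' => hm ⟨d', hd'⟩) hd

/-- An isometric partial injection has an entry one in every column, which gives a value in the
`mix` case. -/
theorem Expr.PureClassical.total {e : Expr} (h : e.PureClassical)
    (hiso : ∀ {Γ Δ : Ctx} {T : Ty} (d : PureTyping Γ Δ e T) (σ : Valuation Γ),
      (d.sem σ)ᴴ * d.sem σ = 1) {Γ : Ctx} {T : Ty} (hc : e.Classical)
    (other : ∀ {Δ : Ctx} (d : MixedTyping Γ Δ e T), (∀ d', d ≠ .mix d') →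
      (∀ {Δ' Δ₀ : Ctx} (h : Ctx.Join Δ' Δ₀ Δ) (d' : MixedTyping Γ Δ' e T), d ≠ .discard h d') →
      ∀ (σ : Valuation Γ) (ρ : Env), σ.Below ρ → ∀ τ : Valuation Δ, τ.BelowOff Γ ρ →
        ∃ v, e.Ev ρ T v)
    {Δ : Ctx} (d : MixedTyping Γ Δ e T) :
      ∀ (σ : Valuation Γ) (ρ : Env), σ.Below ρ → ∀ τ : Valuation Δ, τ.BelowOff Γ ρ →
        ∃ v, e.Ev ρ T v := by
  refine MixedTyping.discard_induction (Q := fun {Δ} d => ∀ (σ : Valuation Γ) (ρ : Env),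
    σ.Below ρ → ∀ τ : Valuation Δ, τ.BelowOff Γ ρ → ∃ v, e.Ev ρ T v) ?_ ?_ d
  · intro Δ' Δ₀ D hJ d ih σ ρ hσ τ hτ
    exact ih σ ρ hσ _ (hτ.restrict hJ.left_sub)
  · intro Δ' d hd
    by_cases hm : ∃ d', d = .mix d'
    · obtain ⟨d, rfl⟩ := hm
      intro σ ρ hσ τ hτ
      obtain ⟨hP, hv⟩ := h d hc σ
      obtain ⟨v, h1⟩ := hP.exists_of_iso (hiso d σ) τ
      refine ⟨v, (hv ρ hσ v).2 ⟨τ, hτ.below fun x hx hx' => ?_, h1⟩⟩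
      rw [d.sem_eq_zero (d.null_of_overlap hx hx')] at h1
      simp at h1
    · exact other d (fun d' hd' => hm ⟨d', hd'⟩) hd

/-! ### Units and variables -/

theorem Expr.good_unit : Expr.unit.Good := by
  have hpc : Expr.unit.PureClassical := by
    intro Γ Δ T d hc σ
    cases d
    refine ⟨⟨fun i j => .inr (by simp [PureTyping.sem]), fun _ _ => Subsingleton.elim _ _,
      fun _ _ => rfl⟩, fun ρ hσ v => ?_⟩
    refine iff_of_true (by rw [Expr.Ev]; rfl) ⟨default, Valuation.below_empty _ _, ?_⟩
    simp [PureTyping.sem]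
  have hiso : ∀ {Γ Δ : Ctx} {T : Ty} (d : PureTyping Γ Δ Expr.unit T) (σ : Valuation Γ),
      (d.sem σ)ᴴ * d.sem σ = 1 := by
    intro Γ Δ T d σ
    cases d
    ext τ τ'
    obtain rfl : τ = τ' := Subsingleton.elim _ _
    rw [Matrix.mul_apply, Matrix.one_apply_eq]
    simp only [PureTyping.sem, Matrix.conjTranspose_apply, Matrix.of_apply, star_one, mul_one,
      Finset.sum_const, nsmul_eq_mul]
    rw [show (Finset.univ : Finset (Val Ty.unit)).card = 1 from rfl, Nat.cast_one]
  refine ⟨hpc, fun d hc => hpc.mixed hc (fun d h h' => ?_) d, ?_, fun _ => hiso,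
    fun _ hc _ _ _ d => hpc.total hiso hc (fun d h h' => ?_) d⟩
  · cases d with
    | mix d => exact absurd rfl (h d)
    | discard hJ d => exact absurd rfl (h' hJ d)
  · intro _ Γ Δ T d d' σ
    exact hpc.unique (by simp [Expr.Classical]) d d' σ
  · cases d with
    | mix d => exact absurd rfl (h d)
    | discard hJ d => exact absurd rfl (h' hJ d)

theorem PureTyping.pInj_cvar {Γ : Ctx} {x : Var} {T : Ty} (h : (x, T) ∈ Γ.bindings)
    (σ : Valuation Γ) : PInj ((PureTyping.cvar h).sem σ) := by
  simp only [PureTyping.sem]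
  refine ⟨fun i j => ?_, fun _ _ => Subsingleton.elim _ _, fun {i i' j} h₁ h₂ => ?_⟩
  · simp only [Matrix.of_apply]
    split <;> simp
  · simp only [Matrix.of_apply, ite_eq_left_iff, zero_ne_one, imp_false, not_not] at h₁ h₂
    exact h₁.trans h₂.symm

theorem PInj.conjTranspose_mul_self {m k : Type} [Fintype m] [DecidableEq k] {A : Matrix m k ℂ}
    (hA : PInj A) (h : ∀ j, ∃ i, A i j = 1) : Aᴴ * A = 1 := by
  ext j j'
  obtain ⟨i, hi⟩ := h j'
  rw [PInj.mul_apply_of_right _ hA hi, Matrix.conjTranspose_apply, Matrix.one_apply]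
  split_ifs with hj
  · rw [hj, hi, star_one]
  · rw [hA.eq_zero fun h' => hj (hA.row h' hi), star_zero]

theorem Expr.good_var (x : Var) : (Expr.var x).Good := by
  have hpc : (Expr.var x).PureClassical := by
    intro Γ Δ T d hc σ
    cases d with
    | cvar h =>
      refine ⟨PureTyping.pInj_cvar h σ, fun ρ hσ v => ?_⟩
      rw [Expr.Ev, hσ ⟨(x, T), h⟩]
      simp only [PureTyping.sem, Matrix.of_apply, ite_eq_left_iff, zero_ne_one, imp_false, not_not,
        Sigma.mk.injEq, heq_eq_eq, true_and]
      exact ⟨fun h => ⟨default, Valuation.below_empty _ _, h.symm⟩, fun ⟨_, _, h⟩ => h.symm⟩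
    | qvar h =>
      refine ⟨PureTyping.pInj_qvar h σ, fun ρ hσ v => ?_⟩
      rw [Expr.Ev]
      simp only [PureTyping.sem, Matrix.of_apply, ite_eq_left_iff, zero_ne_one, imp_false, not_not]
      constructor
      · intro hv
        obtain ⟨τ, hτ⟩ := Valuation.exists_below (Δ := Ctx.single x T) (ρ := ρ) (by
          rintro b hb
          obtain rfl := Finset.mem_singleton.1 hb
          exact ⟨v, hv⟩)
        refine ⟨τ, hτ, ?_⟩
        have := hv.symm.trans (hτ ⟨(x, T), Finset.mem_singleton_self (x, T)⟩)
        simpa using this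
      · rintro ⟨τ, hτ, rfl⟩
        exact hτ ⟨(x, T), Finset.mem_singleton_self (x, T)⟩
  have hiso : ∀ {Γ Δ : Ctx} {T : Ty} (d : PureTyping Γ Δ (Expr.var x) T) (σ : Valuation Γ),
      (d.sem σ)ᴴ * d.sem σ = 1 := by
    intro Γ Δ T d σ
    cases d with
    | cvar h =>
      refine (PureTyping.pInj_cvar h σ).conjTranspose_mul_self fun τ => ⟨σ ⟨(x, T), h⟩, ?_⟩
      simp [PureTyping.sem]
    | qvar h =>
      refine (PureTyping.pInj_qvar h σ).conjTranspose_mul_self fun τ =>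
        ⟨τ ⟨(x, T), Finset.mem_singleton_self (x, T)⟩, ?_⟩
      simp [PureTyping.sem]
  refine ⟨hpc, fun d hc => hpc.mixed hc (fun d h h' => ?_) d, ?_, fun _ => hiso,
    fun _ hc _ _ _ d => hpc.total hiso hc (fun d h h' => ?_) d⟩
  · cases d with
    | mix d => exact absurd rfl (h d)
    | discard hJ d => exact absurd rfl (h' hJ d)
  · intro _ Γ Δ T d d' σ
    exact hpc.unique (by simp [Expr.Classical]) d d' σ
  · cases d with
    | mix d => exact absurd rfl (h d)
    | discard hJ d => exact absurd rfl (h' hJ d)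

/-! ### Pairs -/

/-- Injectivity survives sharing of variables: the components recover both restrictions of the
input, and these cover the whole context. -/
theorem PInj.pair {T₀ T₁ : Ty} {A B C : Ctx} (hA : A.bindings ⊆ C.bindings)
    (hB : B.bindings ⊆ C.bindings) (h : C.bindings = A.bindings ∪ B.bindings)
    {M₀ : Matrix (Val T₀) (Valuation A) ℂ} {M₁ : Matrix (Val T₁) (Valuation B) ℂ}
    {M : Matrix (Val (Ty.tensor T₀ T₁)) (Valuation C) ℂ} (h₀ : PInj M₀) (h₁ : PInj M₁)
    (hM : ∀ v₀ v₁ τ, M (Val.mk v₀ v₁) τ = M₀ v₀ (τ.restrict hA) * M₁ v₁ (τ.restrict hB)) :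
    PInj M ∧ ∀ v₀ v₁ τ, M (Val.mk v₀ v₁) τ = 1 ↔
      M₀ v₀ (τ.restrict hA) = 1 ∧ M₁ v₁ (τ.restrict hB) = 1 := by
  have key : ∀ v₀ v₁ τ, M (Val.mk v₀ v₁) τ = 1 ↔
      M₀ v₀ (τ.restrict hA) = 1 ∧ M₁ v₁ (τ.restrict hB) = 1 := by
    intro v₀ v₁ τ
    rw [hM]
    rcases h₀.zero_or_one v₀ (τ.restrict hA) with h0 | h0 <;>
      rcases h₁.zero_or_one v₁ (τ.restrict hB) with h1 | h1 <;> simp [h0, h1]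
  refine ⟨⟨fun v τ => ?_, fun {v τ τ'} h' h'' => ?_, fun {v v' τ} h' h'' => ?_⟩, key⟩
  · obtain ⟨v₀, v₁, rfl⟩ := Val.eq_mk v
    rw [hM]
    rcases h₀.zero_or_one v₀ (τ.restrict hA) with h0 | h0 <;>
      rcases h₁.zero_or_one v₁ (τ.restrict hB) with h1 | h1 <;> simp [h0, h1]
  · obtain ⟨v₀, v₁, rfl⟩ := Val.eq_mk v
    rw [key] at h' h''
    exact Valuation.eq_of_restrict hA hB h (h₀.row h'.1 h''.1) (h₁.row h'.2 h''.2)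
  · obtain ⟨v₀, v₁, rfl⟩ := Val.eq_mk v
    obtain ⟨v₀', v₁', rfl⟩ := Val.eq_mk v'
    rw [key] at h' h''
    rw [Val.mk_inj]
    exact ⟨h₀.col h'.1 h''.1, h₁.col h'.2 h''.2⟩

theorem IsResult.kronecker {T₀ T₁ : Ty} {P₀ : Val T₀ → Prop} {P₁ : Val T₁ → Prop}
    {P : Val (Ty.tensor T₀ T₁) → Prop} {M₀ : Matrix (Val T₀) (Val T₀) ℂ}
    {M₁ : Matrix (Val T₁) (Val T₁) ℂ} (h₀ : IsResult P₀ M₀) (h₁ : IsResult P₁ M₁)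
    (hP : ∀ v₀ v₁, P (Val.mk v₀ v₁) ↔ P₀ v₀ ∧ P₁ v₁) :
    IsResult P (Val.kron M₀ M₁) := by
  rcases h₀ with ⟨v₀, hv₀, rfl⟩ | ⟨hP₀, rfl⟩
  · rcases h₁ with ⟨v₁, hv₁, rfl⟩ | ⟨hP₁, rfl⟩
    · refine .inl ⟨Val.mk v₀ v₁, fun u => ?_, ?_⟩
      · obtain ⟨u₀, u₁, rfl⟩ := Val.eq_mk u
        rw [hP, hv₀, hv₁, Val.mk_inj]
      · ext u w
        obtain ⟨u₀, u₁, rfl⟩ := Val.eq_mk u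
        obtain ⟨w₀, w₁, rfl⟩ := Val.eq_mk w
        rw [Val.kron_mk, ketbra_apply, ketbra_apply, ketbra_apply, ite_zero_mul_ite_zero]
        refine if_congr ?_ (by simp) rfl
        simp only [Val.mk_inj]
        tauto
    · refine .inr ⟨fun u => ?_, ?_⟩
      · obtain ⟨u₀, u₁, rfl⟩ := Val.eq_mk u
        rw [hP]
        exact fun h => hP₁ _ h.2
      · ext u w
        simp [Val.kron]
  · refine .inr ⟨fun u => ?_, ?_⟩
    · obtain ⟨u₀, u₁, rfl⟩ := Val.eq_mk u
      rw [hP]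
      exact fun h => hP₀ _ h.1
    · ext u w
      simp [Val.kron]

theorem MixedTyping.sem_pair_ketbra {Γ Δ Δ₀ Δ₁ D₀ D₁ D : Ctx} {e₀ e₁ : Expr} {T₀ T₁ : Ty}
    (h₀ : Ctx.Join Δ Δ₀ D₀) (h₁ : Ctx.Join Δ Δ₁ D₁) (h : Ctx.Join D₀ Δ₁ D)
    (d₀ : MixedTyping Γ D₀ e₀ T₀) (d₁ : MixedTyping Γ D₁ e₁ T₁) (σ : Valuation Γ)
    (τ : Valuation D) :
    (MixedTyping.pair h₀ h₁ h d₀ d₁).sem σ (ketbra τ τ) =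
      Val.kron (d₀.sem σ (ketbra (τ.restrict h.left_sub) (τ.restrict h.left_sub)))
        (d₁.sem σ (ketbra (τ.restrict (h₀.second_sub h₁ h)) (τ.restrict (h₀.second_sub h₁ h)))) := by
  simp only [MixedTyping.sem]
  exact superop_ketbra _ _ _

theorem Expr.good_pair {e₀ e₁ : Expr} (g₀ : e₀.Good) (g₁ : e₁.Good) :
    (Expr.pair e₀ e₁).Good := by
  have hpc : (Expr.pair e₀ e₁).PureClassical := by
    intro Γ Δ T d hc σ
    simp only [Expr.Classical] at hc
    cases d with
    | pair h₀ h₁ h d₀ d₁ =>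
      obtain ⟨p₀, i₀⟩ := g₀.pure_classical d₀ hc.1 σ
      obtain ⟨p₁, i₁⟩ := g₁.pure_classical d₁ hc.2 σ
      have hb := Ctx.Join.bindings_pair h₀ h₁ h
      obtain ⟨hP, key⟩ := PInj.pair h.left_sub (h₀.second_sub h₁ h) hb p₀ p₁
        (PureTyping.sem_pair_apply h₀ h₁ h d₀ d₁ σ)
      refine ⟨hP, fun ρ hσ v => ?_⟩
      obtain ⟨v₀, v₁, rfl⟩ := Val.eq_mk v
      rw [Expr.ev_pair, i₀ ρ hσ, i₁ ρ hσ]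
      constructor
      · rintro ⟨⟨τ₀, b₀, s₀⟩, τ₁, b₁, s₁⟩
        obtain ⟨τ, hτ⟩ := Valuation.exists_below (Δ := Δ) (ρ := ρ) (by
          intro b hb'
          rw [hb, Finset.mem_union] at hb'
          rcases hb' with hb' | hb'
          · exact ⟨_, b₀ ⟨b, hb'⟩⟩
          · exact ⟨_, b₁ ⟨b, hb'⟩⟩)
        refine ⟨τ, hτ, (key _ _ _).2 ⟨?_, ?_⟩⟩
        · rwa [(hτ.restrict _).eq b₀]
        · rwa [(hτ.restrict _).eq b₁]
      · rintro ⟨τ, hτ, hs⟩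
        obtain ⟨s₀, s₁⟩ := (key _ _ _).1 hs
        exact ⟨⟨_, hτ.restrict _, s₀⟩, _, hτ.restrict _, s₁⟩
  have hiso : IsoExpr (Expr.pair e₀ e₁) → ∀ {Γ Δ : Ctx} {T : Ty}
      (d : PureTyping Γ Δ (Expr.pair e₀ e₁) T) (σ : Valuation Γ),
      (d.sem σ)ᴴ * d.sem σ = 1 := by
    intro hi Γ Δ T d σ
    cases hi with
    | pair i₀ i₁ =>
      cases d with
      | pair h₀ h₁ h d₀ d₁ =>
        ext τ τ'
        rw [inner_pair (PureTyping.sem_pair_apply h₀ h₁ h d₀ d₁ σ · · τ)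
          (PureTyping.sem_pair_apply h₀ h₁ h d₀ d₁ σ · · τ'), g₀.iso i₀, g₁.iso i₁]
        simp only [Matrix.one_apply]
        rw [ite_zero_mul_ite_zero]
        refine if_congr ⟨fun hr => ?_, fun h => by simp [h]⟩ (by simp) rfl
        exact Valuation.eq_of_restrict _ _ (Ctx.Join.bindings_pair h₀ h₁ h) hr.1 hr.2
  refine ⟨hpc, fun d hc => hpc.mixed hc (fun d h h' => ?_) d, ?_, hiso,
    fun hi hc _ _ _ d => hpc.total (hiso hi) hc (fun d h h' => ?_) d⟩
  · intro σ ρ hσ τ hτ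
    simp only [Expr.Classical] at hc
    cases d with
    | mix d => exact absurd rfl (h d)
    | discard hJ d => exact absurd rfl (h' hJ d)
    | pair h₀ h₁ hJ d₀ d₁ =>
      rw [MixedTyping.sem_pair_ketbra]
      exact IsResult.kronecker (g₀.mixed_classical d₀ hc.1 σ ρ hσ _ (hτ.restrict hJ.left_sub))
        (g₁.mixed_classical d₁ hc.2 σ ρ hσ _ (hτ.restrict (h₀.second_sub h₁ hJ)))
        fun _ _ => Expr.ev_pair
  · intro hdet Γ Δ T d d' σ
    simp only [Expr.Det] at hdet
    -- In the non-null case the component contexts are determined, although the split into shared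
    -- and private variables need not agree.
    by_cases hn : (Expr.pair e₀ e₁).Null
    · rw [d.sem_eq_zero hn, d'.sem_eq_zero hn]
    simp only [Expr.Null, not_or] at hn
    cases d with
    | pair h₀ h₁ h d₀ d₁ =>
      cases d' with
      | pair h₀' h₁' h' d₀' d₁' =>
        obtain rfl := d₀.ctx_unique d₀' hn.1
        obtain rfl := d₁.ctx_unique d₁' hn.2
        ext v τ
        obtain ⟨v₀, v₁, rfl⟩ := Val.eq_mk v
        rw [PureTyping.sem_pair_apply, PureTyping.sem_pair_apply, g₀.unique hdet.1 d₀ d₀',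
          g₁.unique hdet.2 d₁ d₁']
  · intro σ ρ hσ τ hτ
    simp only [Expr.Classical] at hc
    cases hi with
    | pair i₀ i₁ =>
      cases d with
      | mix d => exact absurd rfl (h d)
      | discard hJ d => exact absurd rfl (h' hJ d)
      | pair h₀ h₁ hJ d₀ d₁ =>
        obtain ⟨v₀, hv₀⟩ := g₀.total i₀ hc.1 d₀ σ ρ hσ _ (hτ.restrict hJ.left_sub)
        obtain ⟨v₁, hv₁⟩ := g₁.total i₁ hc.2 d₁ σ ρ hσ _ (hτ.restrict (h₀.second_sub h₁ hJ))
        exact ⟨Val.mk v₀ v₁, Expr.ev_pair.2 ⟨hv₀, hv₁⟩⟩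

/-! ### Applications and `try` -/

theorem Expr.good_app {f : Prog} {e : Expr} (gf : f.Good) (ge : e.Good) :
    (Expr.app f e).Good := by
  have hpc : (Expr.app f e).PureClassical := by
    intro Γ Δ T d hc σ
    simp only [Expr.Classical] at hc
    cases d with
    | app df de =>
      obtain rfl := df.src_eq
      obtain ⟨pf, hf⟩ := gf.coh_classical df hc.1
      obtain ⟨pe, he⟩ := ge.pure_classical de hc.2 σ
      simp only [PureTyping.sem]
      refine ⟨pf.mul pe, fun ρ hσ v => ?_⟩
      simp only [Expr.Ev, he ρ hσ, hf, pf.mul_eq_one pe]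
      constructor
      · rintro ⟨u, ⟨τ, hτ, h₁⟩, h₂⟩
        exact ⟨τ, hτ, u, h₂, h₁⟩
      · rintro ⟨τ, hτ, u, h₂, h₁⟩
        exact ⟨u, ⟨τ, hτ, h₁⟩, h₂⟩
  have hiso : IsoExpr (Expr.app f e) → ∀ {Γ Δ : Ctx} {T : Ty}
      (d : PureTyping Γ Δ (Expr.app f e) T) (σ : Valuation Γ),
      (d.sem σ)ᴴ * d.sem σ = 1 := by
    intro hi Γ Δ T d σ
    cases hi with
    | app hf he =>
      cases d with
      | app df de =>
        simp only [PureTyping.sem]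
        rw [Matrix.conjTranspose_mul, Matrix.mul_assoc, ← Matrix.mul_assoc _ df.sem,
          gf.iso hf, Matrix.one_mul, ge.iso he]
  refine ⟨hpc, fun d hc => hpc.mixed hc (fun d h h' => ?_) d, ?_, hiso,
    fun hi hc _ _ _ d => hpc.total (hiso hi) hc (fun d h h' => ?_) d⟩
  · intro σ ρ hσ τ hτ
    simp only [Expr.Classical] at hc
    cases d with
    | mix d => exact absurd rfl (h d)
    | discard hJ d => exact absurd rfl (h' hJ d)
    | app df de =>
      obtain rfl := df.src_eq
      simp only [MixedTyping.sem, LinearMap.comp_apply]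
      rcases ge.mixed_classical de hc.2 σ ρ hσ τ hτ with ⟨u, hu, hM⟩ | ⟨hP, hM⟩
      · rw [hM]
        refine (gf.chan_classical df hc.1 u).congr fun v => ?_
        simp [Expr.Ev, hu]
      · rw [hM, map_zero]
        exact .inr ⟨fun v => by simp [Expr.Ev, hP], rfl⟩
  · intro hdet Γ Δ T d d' σ
    simp only [Expr.Det] at hdet
    cases d with
    | app df de =>
      cases d' with
      | app df' de' =>
        obtain rfl := df.src_eq
        obtain rfl := df'.src_eq
        simp only [PureTyping.sem]
        rw [gf.unique hdet.1 df df', ge.unique hdet.2 de de']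
  · intro σ ρ hσ τ hτ
    simp only [Expr.Classical] at hc
    cases hi with
    | app hf he =>
      cases d with
      | mix d => exact absurd rfl (h d)
      | discard hJ d => exact absurd rfl (h' hJ d)
      | app df de =>
        obtain rfl := df.src_eq
        obtain ⟨u, hu⟩ := ge.total he hc.2 de σ ρ hσ τ hτ
        obtain ⟨v, hv⟩ := gf.total hf hc.1 df u
        exact ⟨v, by rw [Expr.Ev]; exact ⟨u, hu, hv⟩⟩

theorem Expr.good_tryCatch {e₀ e₁ : Expr} (g₀ : e₀.Good) (g₁ : e₁.Good) :
    (Expr.tryCatch e₀ e₁).Good := by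
  have hpc : (Expr.tryCatch e₀ e₁).PureClassical := fun {Γ Δ T} d => by cases d
  have hiso : ∀ {Γ Δ : Ctx} {T : Ty} (d : PureTyping Γ Δ (Expr.tryCatch e₀ e₁) T)
      (σ : Valuation Γ), (d.sem σ)ᴴ * d.sem σ = 1 := fun {Γ Δ T} d => by cases d
  refine ⟨hpc, fun d hc => hpc.mixed hc (fun d h h' => ?_) d, fun _ {Γ Δ T} d => (by cases d),
    fun _ => hiso, fun hi hc _ _ T d => hpc.total hiso hc (fun d h h' => ?_) d⟩
  · intro σ ρ hσ τ hτ
    simp only [Expr.Classical] at hc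
    cases d with
    | mix d => exact absurd rfl (h d)
    | discard hJ d => exact absurd rfl (h' hJ d)
    | tryCatch hJ d₀ d₁ =>
      simp only [MixedTyping.sem]
      rw [superop_ketbra, trace_ketbra, trace_ketbra, one_smul]
      -- The first result has trace one or zero, so exactly one of the two alternatives contributes.
      rcases g₀.mixed_classical d₀ hc.1 σ ρ hσ _ (hτ.restrict hJ.left_sub) with
        ⟨v, hv, hM⟩ | ⟨hP, hM⟩
      · rw [hM, trace_ketbra, sub_self, zero_smul, add_zero]
        refine .inl ⟨v, fun u => ?_, rfl⟩
        simp [Expr.Ev, hv]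
      · rw [hM, Matrix.trace_zero, sub_zero, one_smul, zero_add]
        refine (g₁.mixed_classical d₁ hc.2 σ ρ hσ _ (hτ.restrict hJ.right_sub)).congr fun u => ?_
        simp [Expr.Ev, hP]
  · intro σ ρ hσ τ hτ
    simp only [Expr.Classical] at hc
    simp only [Expr.Ev]
    cases d with
    | mix d => exact absurd rfl (h d)
    | discard hJ d => exact absurd rfl (h' hJ d)
    | tryCatch hJ d₀ d₁ =>
      cases hi with
      | tryLeft i =>
        obtain ⟨v, hv⟩ := g₀.total i hc.1 d₀ σ ρ hσ _ (hτ.restrict hJ.left_sub)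
        exact ⟨v, .inl hv⟩
      | catchRight i =>
        by_cases h₀ : ∃ v, e₀.Ev ρ T v
        · obtain ⟨v, hv⟩ := h₀
          exact ⟨v, .inl hv⟩
        · obtain ⟨v, hv⟩ := g₁.total i hc.2 d₁ σ ρ hσ _ (hτ.restrict hJ.right_sub)
          exact ⟨v, .inr ⟨fun u hu => h₀ ⟨u, hu⟩, hv⟩⟩

/-! ### `ctrl` and `match` -/

/-- The environment `ρ`, overridden by `ρ'` on the variables of a pattern, extends `σ, s`. -/
theorem Valuation.Below.override {Γ Γp Γb : Ctx} (hJ : Ctx.Join Γ Γp Γb) {σ : Valuation Γ}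
    {s : Valuation Γp} {ρ ρ' : Env} {V : Finset Var} (hV : Γp.dom = V) (hσ : σ.Below ρ)
    (hs : s.Below ρ') :
    (Valuation.join hJ σ s).Below fun x => if x ∈ V then ρ' x else ρ x := by
  refine Valuation.Below.join (fun b => ?_) (fun b => ?_) hJ
  · have : b.1.1 ∉ V := by
      rw [← hV]
      exact Finset.disjoint_left.1 hJ.disjoint (Ctx.mem_dom_of_mem b.2)
    simp only [this, if_false]
    exact hσ b
  · have : b.1.1 ∈ V := by
      rw [← hV]
      exact Ctx.mem_dom_of_mem b.2
    simp only [this, if_true]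
    exact hs b

/-- The overridden variables are classical in the branch, so the condition on the quantum valuation
exempts them. -/
theorem Valuation.BelowOff.override {Γ Γp Γb Δ : Ctx} (hJ : Ctx.Join Γ Γp Γb) {τ : Valuation Δ}
    {ρ : Env} (ρ' : Env) {V : Finset Var} (hV : Γp.dom = V) (hτ : τ.BelowOff Γ ρ) :
    τ.BelowOff Γb fun x => if x ∈ V then ρ' x else ρ x := by
  intro b hb
  rw [hJ.dom, hV, Finset.mem_union, not_or] at hb
  simp only [hb.2, if_false]
  exact hτ b hb.1

section Ctrl

variable {Γ Δ Δ' D : Ctx} {e : Expr} {T T' : Ty} {n : ℕ} {p b : Fin n → Expr}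
  {Γp Γb : Fin n → Ctx}

theorem patterns_pInj (hp : ∀ k, (p k).Hereditary)
    (dp : ∀ j, PureTyping Ctx.empty (Γp j) (p j) T) (hc : ∀ j, (p j).Classical) (j : Fin n) :
    PInj ((dp j).sem Valuation.empty) :=
  ((hp j).good.pure_classical (dp j) (hc j) _).1

theorem patterns_orthogonal (hp : ∀ k, (p k).Hereditary) (ho : Ortho T (List.ofFn p))
    (dp : ∀ j, PureTyping Ctx.empty (Γp j) (p j) T) (j j' : Fin n) (h : j ≠ j') :
    ((dp j).sem Valuation.empty)ᴴ * (dp j').sem Valuation.empty = 0 :=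
  ho.orthogonal_ofFn hp h _ _ (dp j) (dp j')

theorem pattern_ev_iff (hp : ∀ k, (p k).Hereditary)
    (dp : ∀ j, PureTyping Ctx.empty (Γp j) (p j) T) (hc : ∀ j, (p j).Classical) {j : Fin n}
    {ρ : Env} {u : Val T} :
    (p j).Ev ρ T u ↔ ∃ s : Valuation (Γp j), s.Below ρ ∧ (dp j).sem Valuation.empty u s = 1 :=
  ((hp j).good.pure_classical (dp j) (hc j) _).2 ρ (Valuation.below_empty _ _) u

variable (hD : Ctx.Join Δ Δ' D) (hΓ : ∀ j, Ctx.Join Γ (Γp j) (Γb j))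
  (de : MixedTyping Γ Δ e T) (ho : Ortho T (List.ofFn p))
  (dp : ∀ j, PureTyping Ctx.empty (Γp j) (p j) T) (hc : ∀ j, (p j).Classical)
  (her : ∀ x ∈ Δ.dom, Erases T' x (List.ofFn b)) (db : ∀ j, PureTyping (Γb j) D (b j) T')

/-- Once the scrutinee has the definite value `u` and a pattern reaches `u`, orthogonality of the
patterns collapses all sums to one branch. -/
theorem PureTyping.sem_ctrl_eq (hp : ∀ k, (p k).Hereditary) {σ : Valuation Γ} {τ : Valuation D}
    {u : Val T}
    (hu : de.sem σ (ketbra (τ.restrict hD.left_sub) (τ.restrict hD.left_sub)) = ketbra u u)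
    {j : Fin n} {s : Valuation (Γp j)} (hs : (dp j).sem Valuation.empty u s = 1) (w : Val T') :
    (PureTyping.ctrl hD hΓ de ho dp hc her db).sem σ w τ =
      (db j).sem (Valuation.join (hΓ j) σ s) w τ := by
  simp only [PureTyping.sem, Matrix.of_apply, hu, ← smul_eq_mul]
  rw [sum_ketbra_smul]
  exact PInj.sum_select (patterns_pInj hp dp hc) (patterns_orthogonal hp ho dp) hs
    fun j s => (db j).sem (Valuation.join (hΓ j) σ s) w τ

theorem PureTyping.exists_of_sem_ctrl (hp : ∀ k, (p k).Hereditary) {σ : Valuation Γ}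
    {τ : Valuation D} {P : Val T → Prop}
    (he : IsResult P (de.sem σ (ketbra (τ.restrict hD.left_sub) (τ.restrict hD.left_sub))))
    {w : Val T'} (hw : (PureTyping.ctrl hD hΓ de ho dp hc her db).sem σ w τ ≠ 0) :
    ∃ u j s, P u ∧
      de.sem σ (ketbra (τ.restrict hD.left_sub) (τ.restrict hD.left_sub)) = ketbra u u ∧
      (dp j).sem Valuation.empty u s = 1 := by
  rcases he with ⟨u, hu, hM⟩ | ⟨_, hM⟩
  · by_contra! hne
    refine hw ?_
    simp only [PureTyping.sem, Matrix.of_apply, hM, ← smul_eq_mul]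
    rw [sum_ketbra_smul]
    exact PInj.sum_select_eq_zero (patterns_pInj hp dp hc)
      (fun j s => hne u j s ((hu u).2 rfl) hM)
      fun j s => (db j).sem (Valuation.join (hΓ j) σ s) w τ
  · refine absurd ?_ hw
    simp [PureTyping.sem, hM]

/-- The two inputs differ at some scrutinized variable. That variable is erased by the branches, so
it separates the outputs whichever branches are taken. -/
theorem ctrl_separated (her : ∀ x ∈ Δ.dom, Erases T' x (List.ofFn b)) {τ τ' : Valuation D}
    (hτ : τ.restrict hD.left_sub ≠ τ'.restrict hD.left_sub) (j j' : Fin n)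
    (σ₁ : Valuation (Γb j)) (σ₂ : Valuation (Γb j')) :
    (((db j).sem σ₁)ᴴ * (db j').sem σ₂) τ τ' = 0 := by
  obtain ⟨⟨⟨x, S⟩, hx⟩, hne⟩ := Function.ne_iff.1 hτ
  have hj : ∀ j, b j ∈ List.ofFn b := fun j => List.mem_ofFn.2 ⟨j, rfl⟩
  exact (her x (Ctx.mem_dom_of_mem hx)).separated _ (hj j) _ (hj j') (db j) (db j') σ₁ σ₂
    (hD.left_sub hx) (hD.left_sub hx) τ τ' hne

/-- Each nonzero column is a column of a single branch. The only issue is injectivity across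
columns. -/
theorem PureTyping.pInj_ctrl (hp : ∀ k, (p k).Hereditary) (ge : e.Good)
    (gb : ∀ k, (b k).Good) (hce : e.Classical) (hcb : ∀ k, (b k).Classical) (σ : Valuation Γ) :
    PInj ((PureTyping.ctrl hD hΓ de ho dp hc her db).sem σ) := by
  have hb : ∀ j s, PInj ((db j).sem (Valuation.join (hΓ j) σ s)) := fun j s =>
    ((gb j).pure_classical (db j) (hcb j) _).1
  have branch : ∀ {w τ}, (PureTyping.ctrl hD hΓ de ho dp hc her db).sem σ w τ ≠ 0 →
      ∃ u j s, de.sem σ (ketbra (τ.restrict hD.left_sub) (τ.restrict hD.left_sub)) = ketbra u u ∧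
        (dp j).sem Valuation.empty u s = 1 := by
    intro w τ hw
    obtain ⟨ρ, hσ, hτ⟩ := σ.exists_env_pair (τ.restrict hD.left_sub)
    obtain ⟨u, j, s, _, h⟩ := PureTyping.exists_of_sem_ctrl hD hΓ de ho dp hc her db hp
      (ge.mixed_classical de hce σ ρ hσ _ hτ) hw
    exact ⟨u, j, s, h⟩
  refine ⟨fun w τ => ?_, fun {w τ τ'} h h' => ?_, fun {w w' τ} h h' => ?_⟩
  · by_cases hw : (PureTyping.ctrl hD hΓ de ho dp hc her db).sem σ w τ = 0
    · exact .inl hw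
    · obtain ⟨u, j, s, hu, hs⟩ := branch hw
      rw [PureTyping.sem_ctrl_eq hD hΓ de ho dp hc her db hp hu hs]
      exact (hb j s).zero_or_one w τ
  · obtain ⟨u, j, s, hu, hs⟩ := branch (by rw [h]; exact one_ne_zero)
    rw [PureTyping.sem_ctrl_eq hD hΓ de ho dp hc her db hp hu hs] at h
    -- Equal scrutinized parts select the same branch, which is injective. Different parts give
    -- orthogonal outputs, so they cannot reach the same basis value.
    by_cases hτ : τ.restrict hD.left_sub = τ'.restrict hD.left_sub
    · rw [hτ] at hu
      rw [PureTyping.sem_ctrl_eq hD hΓ de ho dp hc her db hp hu hs] at h'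
      exact (hb j s).row h h'
    · obtain ⟨u', j', s', hu', hs'⟩ := branch (by rw [h']; exact one_ne_zero)
      rw [PureTyping.sem_ctrl_eq hD hΓ de ho dp hc her db hp hu' hs'] at h'
      have h1 := (hb j s).inner_eq_one (hb j' s') h h'
      rw [ctrl_separated hD db her hτ] at h1
      simp at h1
  · obtain ⟨u, j, s, hu, hs⟩ := branch (by rw [h]; exact one_ne_zero)
    rw [PureTyping.sem_ctrl_eq hD hΓ de ho dp hc her db hp hu hs] at h h'
    exact (hb j s).col h h'

/-- Totality of the scrutinee and completeness of the patterns select a branch for every input.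
Inputs with equal scrutinized parts are compared by the isometry of that branch, all others by
erasure. The branches need not be classical. -/
theorem PureTyping.iso_ctrl (hp : ∀ k, (p k).Hereditary) (ge : e.Good)
    (gb : ∀ k, (b k).Good) (hce : e.Classical) (he : IsoExpr e) (hs : Spanning T (List.ofFn p))
    (hb : ∀ j, IsoExpr (b j)) (σ : Valuation Γ) :
    ((PureTyping.ctrl hD hΓ de ho dp hc her db).sem σ)ᴴ *
      (PureTyping.ctrl hD hΓ de ho dp hc her db).sem σ = 1 := by
  have branch : ∀ τ : Valuation D, ∃ u j s,
      de.sem σ (ketbra (τ.restrict hD.left_sub) (τ.restrict hD.left_sub)) = ketbra u u ∧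
        (dp j).sem Valuation.empty u s = 1 := by
    intro τ
    obtain ⟨ρ, hσ, hτ⟩ := σ.exists_env_pair (τ.restrict hD.left_sub)
    obtain ⟨u, hu⟩ := ge.total he hce de σ ρ hσ _ hτ
    obtain ⟨j, s, h⟩ := PInj.exists_select (patterns_pInj hp dp hc) (hs.sum_ofFn hp dp) u
    exact ⟨u, j, s, (ge.mixed_classical de hce σ ρ hσ _ hτ).eq_ketbra hu, h⟩
  ext τ τ'
  obtain ⟨u, j, s, hu, hs⟩ := branch τ
  rw [Matrix.mul_apply]
  simp only [Matrix.conjTranspose_apply,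
    PureTyping.sem_ctrl_eq hD hΓ de ho dp hc her db hp hu hs]
  by_cases hτ : τ.restrict hD.left_sub = τ'.restrict hD.left_sub
  · rw [hτ] at hu
    simp only [PureTyping.sem_ctrl_eq hD hΓ de ho dp hc her db hp hu hs]
    have := congrFun (congrFun ((gb j).iso (hb j) (db j) (Valuation.join (hΓ j) σ s)) τ) τ'
    rwa [Matrix.mul_apply] at this
  · obtain ⟨u', j', s', hu', hs'⟩ := branch τ'
    simp only [PureTyping.sem_ctrl_eq hD hΓ de ho dp hc her db hp hu' hs']
    have := ctrl_separated hD db her hτ j j' (Valuation.join (hΓ j) σ s)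
      (Valuation.join (hΓ j') σ s')
    rw [Matrix.mul_apply] at this
    rw [Matrix.one_apply_ne fun h => hτ (by rw [h])]
    exact this

end Ctrl

theorem Expr.good_ctrl {e : Expr} {T T' : Ty} {n : ℕ} {p b : Fin n → Expr} (ge : e.Good)
    (hp : ∀ k, (p k).Hereditary) (gb : ∀ k, (b k).Good) : (Expr.ctrl e T n p b T').Good := by
  have hpc : (Expr.ctrl e T n p b T').PureClassical := by
    intro Γ D S d hcl σ
    simp only [Expr.Classical] at hcl
    cases d with
    | ctrl hD hΓ de ho dp hc her db =>
      refine ⟨PureTyping.pInj_ctrl hD hΓ de ho dp hc her db hp ge gb hcl.1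
        (fun k => (hcl.2 k).2) σ, fun ρ hσ w => ?_⟩
      have hV := fun j => (dp j).dom_eq_FV (ho.pat_ofFn j)
      simp only [Expr.Ev]
      constructor
      · rintro ⟨u, hu, j, ρ', hpj, hbj⟩
        obtain ⟨s, hs, hsu⟩ := (pattern_ev_iff hp dp hc).1 hpj
        obtain ⟨τ, hτ, hw⟩ := (((gb j).pure_classical (db j) (hcl.2 j).2 _).2 _
          (hσ.override (hΓ j) (hV j) hs) w).1 hbj
        -- The branch is evaluated in an environment overridden on the pattern variables. None of
        -- them occurs in the quantum context, for otherwise the branch would be null and have no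
        -- entry one.
        have hτ : τ.Below ρ := by
          intro a
          have := hτ a
          beta_reduce at this
          rwa [if_neg] at this
          intro ha
          rw [← hV j] at ha
          have hn := (db j).null_of_overlap (Ctx.dom_mono (hΓ j).right_sub ha)
            (Ctx.mem_dom_of_mem a.2)
          rw [(db j).sem_eq_zero hn] at hw
          simp at hw
        have hM := (ge.mixed_classical de hcl.1 σ ρ hσ _
          (hτ.restrict hD.left_sub).belowOff).eq_ketbra hu
        exact ⟨τ, hτ, (PureTyping.sem_ctrl_eq hD hΓ de ho dp hc her db hp hM hsu w).trans hw⟩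
      · rintro ⟨τ, hτ, hw⟩
        obtain ⟨u, j, s, hu, hM, hs⟩ := PureTyping.exists_of_sem_ctrl hD hΓ de ho dp hc her db hp
          (ge.mixed_classical de hcl.1 σ ρ hσ _ (hτ.restrict hD.left_sub).belowOff)
          (by rw [hw]; exact one_ne_zero)
        rw [PureTyping.sem_ctrl_eq hD hΓ de ho dp hc her db hp hM hs] at hw
        obtain ⟨ρ', hρ'⟩ := s.exists_env
        refine ⟨u, hu, j, ρ', (pattern_ev_iff hp dp hc).2 ⟨s, hρ', hs⟩, ?_⟩
        refine (((gb j).pure_classical (db j) (hcl.2 j).2 _).2 _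
          (hσ.override (hΓ j) (hV j) hρ') w).2 ⟨τ, ?_, hw⟩
        refine (hτ.belowOff.override (hΓ j) ρ' (hV j)).below fun x hx hx' => ?_
        rw [(db j).sem_eq_zero ((db j).null_of_overlap hx hx')] at hw
        simp at hw
  have hiso : IsoExpr (Expr.ctrl e T n p b T') → ∀ {Γ Δ : Ctx} {S : Ty}
      (d : PureTyping Γ Δ (Expr.ctrl e T n p b T') S) (σ : Valuation Γ),
      (d.sem σ)ᴴ * d.sem σ = 1 := by
    intro hi Γ D S d σ
    cases hi with
    | ctrl hce he hs hb =>
      cases d with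
      | ctrl hD hΓ de ho dp hc her db =>
        exact PureTyping.iso_ctrl hD hΓ de ho dp hc her db hp ge gb hce he hs hb σ
  refine ⟨hpc, fun d hc => hpc.mixed hc (fun d h h' => ?_) d, ?_, hiso,
    fun hi hc _ _ _ d => hpc.total (hiso hi) hc (fun d h h' => ?_) d⟩
  · cases d with
    | mix d => exact absurd rfl (h d)
    | discard hJ d => exact absurd rfl (h' hJ d)
  · intro hdet Γ D S d d' σ
    simp only [Expr.Det] at hdet
    cases d with
    | @ctrl _ Δ _ _ _ _ _ _ _ _ Γp Γb hD hΓ de ho dp hc her db =>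
      cases d' with
      | @ctrl _ Δ' _ _ _ _ _ _ _ _ Γp' Γb' hD' hΓ' de' ho' dp' hc' her' db' =>
        obtain rfl : Γp = Γp' := funext fun k =>
          (dp k).ctx_unique (dp' k) (ho.pat_ofFn k).not_null
        obtain rfl : Γb = Γb' := funext fun k => (hΓ k).eq (hΓ' k)
        ext w τ
        obtain ⟨ρ, hσ, hτ⟩ := σ.exists_env_pair τ
        -- The two derivations may scrutinize different parts of the context. In a common
        -- environment both scrutinee states are given by the same evaluation, hence agree.
        have h1 := (ge.mixed_classical de hdet.1 σ ρ hσ _ (hτ.restrict hD.left_sub)).unique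
          (ge.mixed_classical de' hdet.1 σ ρ hσ _ (hτ.restrict hD'.left_sub))
        have h2 : ∀ j, (dp j).sem = (dp' j).sem := fun j =>
          funext fun σ' => (hp j).good.unique (hc j).det (dp j) (dp' j) σ'
        have h3 : ∀ j, (db j).sem = (db' j).sem := fun j =>
          funext fun σ' => (gb j).unique (hdet.2 j) (db j) (db' j) σ'
        simp only [PureTyping.sem, Matrix.of_apply, h1, h2, h3]
  · cases d with
    | mix d => exact absurd rfl (h d)
    | discard hJ d => exact absurd rfl (h' hJ d)

theorem Expr.good_mmatch {e : Expr} {T T' : Ty} {n : ℕ} {p b : Fin n → Expr} (ge : e.Good)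
    (hp : ∀ k, (p k).Hereditary) (gb : ∀ k, (b k).Good) : (Expr.mmatch e T n p b T').Good := by
  have hpc : (Expr.mmatch e T n p b T').PureClassical := fun {Γ Δ T} d => by cases d
  have hiso : ∀ {Γ Δ : Ctx} {S : Ty} (d : PureTyping Γ Δ (Expr.mmatch e T n p b T') S)
      (σ : Valuation Γ), (d.sem σ)ᴴ * d.sem σ = 1 := fun {Γ Δ T} d => by cases d
  refine ⟨hpc, fun d hc => hpc.mixed hc (fun d h h' => ?_) d, fun _ {Γ Δ T} d => (by cases d),
    fun _ => hiso, fun hi hc _ _ _ d => hpc.total hiso hc (fun d h h' => ?_) d⟩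
  · intro σ ρ hσ τ hτ
    simp only [Expr.Classical] at hc
    cases d with
    | mix d => exact absurd rfl (h d)
    | discard hJ d => exact absurd rfl (h' hJ d)
    | mmatch h₀ h₁ hJ hΓ de ho dp hcp db =>
      have hV := fun j => (dp j).dom_eq_FV (ho.pat_ofFn j)
      have hA := patterns_pInj hp dp hcp
      have hev : ∀ w, (Expr.mmatch e T n p b T').Ev ρ T' w ↔ ∃ u : Val T, e.Ev ρ T u ∧
          ∃ j ρ', (p j).Ev ρ' T u ∧
            (b j).Ev (fun x => if x ∈ (p j).FV then ρ' x else ρ x) T' w := fun w => by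
        rw [Expr.Ev]
      simp only [MixedTyping.sem]
      rw [superop_ketbra]
      rcases ge.mixed_classical de hc.1 σ ρ hσ _ (hτ.restrict hJ.left_sub) with
        ⟨u, hu, hM⟩ | ⟨hP, hM⟩
      · rw [hM, sum_ketbra_smul]
        by_cases hsel : ∃ j s, (dp j).sem Valuation.empty u s = 1
        · obtain ⟨j, s, hs⟩ := hsel
          rw [PInj.sum_select hA (patterns_orthogonal hp ho dp) hs]
          -- Evaluation allows any environment for the pattern variables. All environments extending
          -- `s` produce the same matrix, so the result does not depend on the choice.
          have hr : ∀ ρ', s.Below ρ' → IsResult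
              ((b j).Ev (fun x => if x ∈ (p j).FV then ρ' x else ρ x) T') _ := fun ρ' hρ' =>
            (gb j).mixed_classical (db j) (hc.2 j).2 _ _ (hσ.override (hΓ j) (hV j) hρ') _
              ((hτ.restrict (h₀.second_sub h₁ hJ)).override (hΓ j) ρ' (hV j))
          obtain ⟨ρ₀, hρ₀⟩ := s.exists_env
          refine (hr ρ₀ hρ₀).congr fun w => ?_
          rw [hev]
          constructor
          · rintro ⟨u', hu', j', ρ', hp', hb'⟩
            obtain rfl := (hu u').1 hu'
            obtain ⟨s', hs', hs''⟩ := (pattern_ev_iff hp dp hcp).1 hp'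
            cases PInj.select_unique hA (patterns_orthogonal hp ho dp) hs hs''
            exact ((hr ρ' hs').iff_iff (hr ρ₀ hρ₀) w).1 hb'
          · exact fun hw => ⟨u, (hu u).2 rfl, j, ρ₀,
              (pattern_ev_iff hp dp hcp).2 ⟨s, hρ₀, hs⟩, hw⟩
        · push Not at hsel
          rw [PInj.sum_select_eq_zero hA hsel]
          refine .inr ⟨fun w hw => ?_, rfl⟩
          obtain ⟨u', hu', j, ρ', hp', _⟩ := (hev w).1 hw
          obtain rfl := (hu u').1 hu'
          obtain ⟨s, _, hs⟩ := (pattern_ev_iff hp dp hcp).1 hp'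
          exact hsel j s hs
      · rw [hM]
        refine .inr ⟨fun w hw => ?_, by simp⟩
        obtain ⟨u, hu, _⟩ := (hev w).1 hw
        exact hP u hu
  · intro σ ρ hσ τ hτ
    simp only [Expr.Classical] at hc
    cases d with
    | mix d => exact absurd rfl (h d)
    | discard hJ d => exact absurd rfl (h' hJ d)
    | mmatch h₀ h₁ hJ hΓ de ho dp hcp db =>
      cases hi with
      | mmatch hce he hs hb =>
        have hV := fun j => (dp j).dom_eq_FV (ho.pat_ofFn j)
        obtain ⟨u, hu⟩ := ge.total he hce de σ ρ hσ _ (hτ.restrict hJ.left_sub)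
        obtain ⟨j, s, hsj⟩ := PInj.exists_select (patterns_pInj hp dp hcp) (hs.sum_ofFn hp dp) u
        obtain ⟨ρ', hρ'⟩ := s.exists_env
        obtain ⟨v, hv⟩ := (gb j).total (hb j) (hc.2 j).2 (db j) _ _
          (hσ.override (hΓ j) (hV j) hρ') _
          ((hτ.restrict (h₀.second_sub h₁ hJ)).override (hΓ j) ρ' (hV j))
        refine ⟨v, ?_⟩
        rw [Expr.Ev]
        exact ⟨u, hu, j, ρ', (pattern_ev_iff hp dp hcp).2 ⟨s, hρ', hsj⟩, hv⟩

/-! ### Programs -/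

theorem PInj.chan_isResult {T T' : Ty} {f : Prog} {A : Matrix (Val T') (Val T) ℂ} (hA : PInj A)
    (hf : ∀ u v, f.Ev T T' u v ↔ A v u = 1) (u : Val T) :
    IsResult (f.Ev T T' u) (conjugation A (ketbra u u)) :=
  hA.isResult_iff fun v => hf u v

theorem u3Matrix_isometry (θ φ l : ℝ) : (u3Matrix θ φ l)ᴴ * u3Matrix θ φ l = 1 := by
  have hexp : ∀ x : ℂ, Complex.exp (-x) * Complex.exp x = 1 := fun x => by
    rw [← Complex.exp_add]; simp
  have hcs : Complex.cos (θ / 2) ^ 2 + Complex.sin (θ / 2) ^ 2 = 1 :=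
    Complex.cos_sq_add_sin_sq _
  have hc : (starRingEnd ℂ) (Complex.cos (θ / 2)) = Complex.cos (θ / 2) := by
    rw [← Complex.cos_conj, map_div₀, Complex.conj_ofReal, map_ofNat]
  have hs : (starRingEnd ℂ) (Complex.sin (θ / 2)) = Complex.sin (θ / 2) := by
    rw [← Complex.sin_conj, map_div₀, Complex.conj_ofReal, map_ofNat]
  have e1 := hexp (Complex.I * φ)
  have e2 := hexp (Complex.I * l)
  ext (v : Unit ⊕ Unit) (w : Unit ⊕ Unit)
  rcases v with v | v <;> rcases w with w | w <;>
    simp [Matrix.mul_apply, u3Matrix, Fintype.sum_sum_type, ← Complex.exp_conj, mul_add,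
      Complex.exp_add, hc, hs]
  -- The four entries reduce to `cos² + sin² = 1` and the cancellation of opposite phases.
  · linear_combination hcs + Complex.sin (θ / 2) ^ 2 * e1
  · linear_combination Complex.cos (θ / 2) * Complex.sin (θ / 2) * Complex.exp (Complex.I * l) * e1
  · linear_combination
      Complex.cos (θ / 2) * Complex.sin (θ / 2) * Complex.exp (-(Complex.I * l)) * e1
  · linear_combination hcs +
      Complex.sin (θ / 2) ^ 2 * e2 + Complex.cos (θ / 2) ^ 2 *
        (Complex.exp (-(Complex.I * l)) * Complex.exp (Complex.I * l) * e1 + e2)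

theorem Prog.good_u3 (θ φ l : ℝ) : (Prog.u3 θ φ l).Good := by
  refine ⟨fun d hc => by simp [Prog.Classical] at hc, fun d hc => by simp [Prog.Classical] at hc,
    fun _ {T T'} d d' => ?_, fun _ {T T'} d => ?_, fun _ hc => by simp [Prog.Classical] at hc⟩
  · cases d
    cases d'
    rfl
  · cases d
    simp only [CohTyping.sem]
    exact u3Matrix_isometry θ φ l

theorem PInj.left (T₀ T₁ : Ty) : PInj (CohTyping.left T₀ T₁).sem := by
  refine ⟨fun v w => ?_, fun {v w w'} h h' => ?_, fun {v v' w} h h' => ?_⟩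
  · rcases Val.eq_inl_or_inr v with ⟨v, rfl⟩ | ⟨v, rfl⟩
    · rw [CohTyping.sem_left_inl]
      split <;> simp
    · simp
  · rcases Val.eq_inl_or_inr v with ⟨v, rfl⟩ | ⟨v, rfl⟩
    · simp at h h'
      exact h.symm.trans h'
    · simp at h
  · rcases Val.eq_inl_or_inr v with ⟨v, rfl⟩ | ⟨v, rfl⟩ <;>
      rcases Val.eq_inl_or_inr v' with ⟨v', rfl⟩ | ⟨v', rfl⟩ <;> simp at h h'
    rw [h, h']

theorem PInj.right (T₀ T₁ : Ty) : PInj (CohTyping.right T₀ T₁).sem := by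
  refine ⟨fun v w => ?_, fun {v w w'} h h' => ?_, fun {v v' w} h h' => ?_⟩
  · rcases Val.eq_inl_or_inr v with ⟨v, rfl⟩ | ⟨v, rfl⟩
    · simp
    · rw [CohTyping.sem_right_inr]
      split <;> simp
  · rcases Val.eq_inl_or_inr v with ⟨v, rfl⟩ | ⟨v, rfl⟩
    · simp at h
    · simp at h h'
      exact h.symm.trans h'
  · rcases Val.eq_inl_or_inr v with ⟨v, rfl⟩ | ⟨v, rfl⟩ <;>
      rcases Val.eq_inl_or_inr v' with ⟨v', rfl⟩ | ⟨v', rfl⟩ <;> simp at h h'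
    rw [h, h']

theorem Prog.ev_left {T₀ T₁ : Ty} {u : Val T₀} {v : Val (Ty.sum T₀ T₁)} :
    (Prog.left T₀ T₁).Ev T₀ (Ty.sum T₀ T₁) u v ↔ v = Val.inl T₁ u := by
  simp [Prog.Ev]

theorem Prog.ev_right {T₀ T₁ : Ty} {u : Val T₁} {v : Val (Ty.sum T₀ T₁)} :
    (Prog.right T₀ T₁).Ev T₁ (Ty.sum T₀ T₁) u v ↔ v = Val.inr T₀ u := by
  simp [Prog.Ev]

theorem Prog.good_left (T₀ T₁ : Ty) : (Prog.left T₀ T₁).Good := by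
  have hcoh : ∀ {T T' : Ty} (d : CohTyping (Prog.left T₀ T₁) T T'),
      PInj d.sem ∧ ∀ u v, (Prog.left T₀ T₁).Ev T T' u v ↔ d.sem v u = 1 := by
    intro T T' d
    cases d
    refine ⟨PInj.left T₀ T₁, fun u v => ?_⟩
    rw [Prog.ev_left]
    rcases Val.eq_inl_or_inr v with ⟨v, rfl⟩ | ⟨v, rfl⟩ <;> simp
  refine ⟨fun d _ => hcoh d, fun {T T'} d _ u => ?_, fun _ {T T'} d d' => ?_,
    fun _ {T T'} d => ?_, fun _ _ {T T'} d u => ?_⟩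
  · cases d with
    | channel d =>
      simp only [ChanTyping.sem]
      exact (hcoh d).1.chan_isResult (hcoh d).2 u
  · cases d
    cases d'
    rfl
  · cases d
    exact (PInj.left T₀ T₁).conjTranspose_mul_self fun u => ⟨Val.inl T₁ u, by simp⟩
  · cases d with
    | channel d =>
      cases d
      exact ⟨_, Prog.ev_left.2 rfl⟩

theorem Prog.good_right (T₀ T₁ : Ty) : (Prog.right T₀ T₁).Good := by
  have hcoh : ∀ {T T' : Ty} (d : CohTyping (Prog.right T₀ T₁) T T'),
      PInj d.sem ∧ ∀ u v, (Prog.right T₀ T₁).Ev T T' u v ↔ d.sem v u = 1 := by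
    intro T T' d
    cases d
    refine ⟨PInj.right T₀ T₁, fun u v => ?_⟩
    rw [Prog.ev_right]
    rcases Val.eq_inl_or_inr v with ⟨v, rfl⟩ | ⟨v, rfl⟩ <;> simp
  refine ⟨fun d _ => hcoh d, fun {T T'} d _ u => ?_, fun _ {T T'} d d' => ?_,
    fun _ {T T'} d => ?_, fun _ _ {T T'} d u => ?_⟩
  · cases d with
    | channel d =>
      simp only [ChanTyping.sem]
      exact (hcoh d).1.chan_isResult (hcoh d).2 u
  · cases d
    cases d'
    rfl
  · cases d
    exact (PInj.right T₀ T₁).conjTranspose_mul_self fun u => ⟨Val.inr T₀ u, by simp⟩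
  · cases d with
    | channel d =>
      cases d
      exact ⟨_, Prog.ev_right.2 rfl⟩

theorem Expr.Good.ev_iff {e : Expr} (g : e.Good) (hc : e.Classical) {Δ : Ctx} {T : Ty}
    (d : PureTyping Ctx.empty Δ e T) {ρ : Env} {v : Val T} :
    e.Ev ρ T v ↔ ∃ τ : Valuation Δ, τ.Below ρ ∧ d.sem Valuation.empty v τ = 1 :=
  (g.pure_classical d hc _).2 ρ (Valuation.below_empty _ _) v

theorem Expr.Good.pInj {e : Expr} (g : e.Good) (hc : e.Classical) {Δ : Ctx} {T : Ty}
    (d : PureTyping Ctx.empty Δ e T) : PInj (d.sem Valuation.empty) :=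
  (g.pure_classical d hc _).1

/-- The operator `⟦e'⟧⟦e⟧†` of classical expressions agrees with evaluation. -/
theorem Expr.Good.mul_conjTranspose_eq_one {e e' : Expr} (g : e.Good) (g' : e'.Good)
    (hc : e.Classical) (hc' : e'.Classical) {Δ : Ctx} {T T' : Ty}
    (d : PureTyping Ctx.empty Δ e T) (d' : PureTyping Ctx.empty Δ e' T') {u : Val T}
    {v : Val T'} :
    (∃ ρ, e.Ev ρ T u ∧ e'.Ev ρ T' v) ↔
      (d'.sem Valuation.empty * (d.sem Valuation.empty)ᴴ) v u = 1 := by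
  rw [(g'.pInj hc' d').mul_eq_one (g.pInj hc d).conjTranspose]
  simp only [g.ev_iff hc d, g'.ev_iff hc' d', conjTranspose_eq_one]
  constructor
  · rintro ⟨ρ, ⟨τ, hτ, h⟩, τ', hτ', h'⟩
    obtain rfl := hτ.eq hτ'
    exact ⟨τ, h', h⟩
  · rintro ⟨τ, h', h⟩
    obtain ⟨ρ, hρ⟩ := τ.exists_env
    exact ⟨ρ, ⟨τ, hρ, h⟩, τ, hρ, h'⟩

theorem Prog.good_lam {S : Ty} {e e' : Expr} (he : e.Hereditary) (g' : e'.Good) :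
    (Prog.lam S e e').Good := by
  have g := he.good
  have hcoh : ∀ {T T' : Ty} (d : CohTyping (Prog.lam S e e') T T'),
      (Prog.lam S e e').Classical →
      PInj d.sem ∧ ∀ u v, (Prog.lam S e e').Ev T T' u v ↔ d.sem v u = 1 := by
    intro T T' d hc
    simp only [Prog.Classical] at hc
    cases d with
    | lam d d' =>
      simp only [CohTyping.sem]
      refine ⟨(g'.pInj hc.2 d').mul (g.pInj hc.1 d).conjTranspose, fun u v => ?_⟩
      rw [Prog.Ev]
      exact g.mul_conjTranspose_eq_one g' hc.1 hc.2 d d'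
  -- A single spanning pattern has the identity as its projection, so the adjoint of its operator is
  -- an isometry.
  have hspan : Spanning S [e] → ∀ {Δ : Ctx} (d : PureTyping Ctx.empty Δ e S),
      d.sem Valuation.empty * (d.sem Valuation.empty)ᴴ = 1 := by
    intro hs Δ d
    have h1 := hs.sum_proj (by simpa using he) fun e' h' => by
      rw [List.mem_singleton.1 h']
      exact ⟨⟨Δ, d⟩⟩
    rw [List.map_singleton, List.sum_singleton] at h1
    rw [← h1, d.proj_eq g (hs.det e (by simp)) (hs.pat e (by simp))]
  have hiso : IsoProg (Prog.lam S e e') → ∀ {T T' : Ty} (d : CohTyping (Prog.lam S e e') T T'),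
      d.semᴴ * d.sem = 1 := by
    intro hi T T' d
    cases hi with
    | lam hs h =>
      cases d with
      | lam d d' =>
        simp only [CohTyping.sem]
        rw [Matrix.conjTranspose_mul, Matrix.conjTranspose_conjTranspose, Matrix.mul_assoc,
          ← Matrix.mul_assoc _ (d'.sem _), g'.iso h, Matrix.one_mul, hspan hs]
  refine ⟨hcoh, fun {T T'} d hc u => ?_, fun hdet {T T'} d d' => ?_, hiso,
    fun hi hc {T T'} d u => ?_⟩
  · cases d with
    | channel d =>
      simp only [ChanTyping.sem]
      exact (hcoh d hc).1.chan_isResult (hcoh d hc).2 u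
    | lam d d' =>
      simp only [Prog.Classical] at hc
      simp only [ChanTyping.sem, LinearMap.comp_apply]
      have hP := g.pInj hc.1 d
      have hr := hP.conjTranspose.isResult u
      by_cases hτ : ∃ τ, d.sem Valuation.empty u τ = 1
      · obtain ⟨τ, hτ⟩ := hτ
        rw [hr.eq_ketbra (conjTranspose_eq_one.2 hτ)]
        -- The pattern determines `τ` but not the environment outside it; the output matrix depends
        -- on `τ` only.
        have hr' : ∀ ρ, τ.Below ρ → IsResult (e'.Ev ρ T') _ := fun ρ hρ =>
          g'.mixed_classical d' hc.2 Valuation.empty ρ (Valuation.below_empty _ _) τ hρ.belowOff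
        obtain ⟨ρ₀, hρ₀⟩ := τ.exists_env
        refine (hr' ρ₀ hρ₀).congr fun v => ?_
        simp only [Prog.Ev, g.ev_iff hc.1 d]
        constructor
        · rintro ⟨ρ, ⟨τ', hρ, hτ'⟩, hv⟩
          obtain rfl := hP.row hτ hτ'
          exact ((hr' ρ hρ).iff_iff (hr' ρ₀ hρ₀) v).1 hv
        · exact fun hv => ⟨ρ₀, ⟨τ, hρ₀, hτ⟩, hv⟩
      · push Not at hτ
        rcases hr with ⟨τ, h1, _⟩ | ⟨_, hM⟩
        · exact absurd (conjTranspose_eq_one.1 ((h1 τ).2 rfl)) (hτ τ)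
        · rw [hM, map_zero]
          refine .inr ⟨fun v => ?_, rfl⟩
          simp only [Prog.Ev, g.ev_iff hc.1 d]
          rintro ⟨ρ, ⟨τ, _, h⟩, _⟩
          exact hτ τ h
  · simp only [Prog.Det] at hdet
    cases d with
    | @lam Δ _ _ _ _ d₁ d₂ =>
      cases d' with
      | @lam Δ' _ _ _ _ d₁' d₂' =>
        simp only [CohTyping.sem]
        -- The two derivations may use different intermediate contexts only if the pattern is null,
        -- and then both products vanish.
        by_cases hn : e.Null
        · rw [d₁.sem_eq_zero hn, d₁'.sem_eq_zero hn]
          simp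
        · obtain rfl := d₁.ctx_unique d₁' hn
          rw [g.unique hdet.1 d₁ d₁', g'.unique hdet.2 d₂ d₂']
  · cases d with
    | channel d =>
      obtain ⟨v, hv⟩ := (hcoh d hc).1.exists_of_iso (hiso hi d) u
      exact ⟨v, ((hcoh d hc).2 u v).2 hv⟩
    | lam d d' =>
      simp only [Prog.Classical] at hc
      cases hi with
      | lam hs h =>
        have h1 := hspan hs d
        -- This rewriting states the completeness relation as isometry of the adjoint.
        rw [← Matrix.conjTranspose_conjTranspose (d.sem Valuation.empty),
          Matrix.conjTranspose_conjTranspose (d.sem Valuation.empty)ᴴ] at h1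
        obtain ⟨τ, hτ⟩ := (g.pInj hc.1 d).conjTranspose.exists_of_iso h1 u
        obtain ⟨ρ, hρ⟩ := τ.exists_env
        obtain ⟨v, hv⟩ := g'.total h hc.2 d' Valuation.empty ρ (Valuation.below_empty _ _) τ
          hρ.belowOff
        refine ⟨v, ?_⟩
        simp only [Prog.Ev, g.ev_iff hc.1 d]
        exact ⟨ρ, ⟨τ, hρ, conjTranspose_eq_one.1 hτ⟩, hv⟩

/-- For an isometric pattern `P = ⟦e⟧⟦e⟧†` is a selfadjoint idempotent, and unit phases on `P` and
on its complement give an isometry. -/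
theorem Prog.good_rphase {S : Ty} {e : Expr} (g : e.Good) (r r' : ℝ) :
    (Prog.rphase S e r r').Good := by
  refine ⟨fun d hc => by simp [Prog.Classical] at hc, fun d hc => by simp [Prog.Classical] at hc,
    fun hdet {T T'} d d' => ?_, fun hi {T T'} d => ?_,
    fun _ hc => by simp [Prog.Classical] at hc⟩
  · simp only [Prog.Det] at hdet
    cases d with
    | rphase r r' d =>
      cases d' with
      | rphase r r' d' =>
        simp only [CohTyping.sem]
        by_cases hn : e.Null
        · rw [d.sem_eq_zero hn, d'.sem_eq_zero hn]
          simp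
        · obtain rfl := d.ctx_unique d' hn
          rw [g.unique hdet d d']
  · cases hi with
    | rphase h =>
      cases d with
      | rphase r r' d =>
        simp only [CohTyping.sem]
        have hP : d.sem Valuation.empty * (d.sem Valuation.empty)ᴴ *
            (d.sem Valuation.empty * (d.sem Valuation.empty)ᴴ) =
            d.sem Valuation.empty * (d.sem Valuation.empty)ᴴ := by
          rw [Matrix.mul_assoc, ← Matrix.mul_assoc _ (d.sem _), g.iso h, Matrix.one_mul]
        have hstar : (d.sem Valuation.empty * (d.sem Valuation.empty)ᴴ)ᴴ =
            d.sem Valuation.empty * (d.sem Valuation.empty)ᴴ := by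
          rw [Matrix.conjTranspose_mul, Matrix.conjTranspose_conjTranspose]
        generalize d.sem Valuation.empty * (d.sem Valuation.empty)ᴴ = P at hP hstar
        have hexp : ∀ x : ℝ, Complex.exp (Complex.I * x) * star (Complex.exp (Complex.I * x)) = 1 :=
          fun x => by
            rw [Complex.star_def, ← Complex.exp_conj, ← Complex.exp_add]
            simp
        rw [Matrix.conjTranspose_add, Matrix.conjTranspose_smul, Matrix.conjTranspose_smul,
          Matrix.conjTranspose_sub, Matrix.conjTranspose_one, hstar]
        simp only [Matrix.add_mul, Matrix.mul_add, Matrix.smul_mul, Matrix.mul_smul,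
          Matrix.mul_sub, Matrix.sub_mul, hP, Matrix.mul_one, Matrix.one_mul, sub_self,
          add_zero, smul_add, smul_sub, smul_smul, hexp, one_smul]
        abel

/-- Orthogonality on the left keeps the columns of the summands apart, orthogonality on the right
their rows. For isometry, the latter kills the cross terms, the isometric right-hand sides cancel,
and the remaining projections add up to the identity by spanning. -/
theorem Prog.good_pmatch {S S' : Ty} {n : ℕ} {p b : Fin n → Expr} (hp : ∀ k, (p k).Hereditary)
    (hb : ∀ k, (b k).Hereditary) : (Prog.pmatch S n p b S').Good := by
  have hcoh : ∀ {T T' : Ty} (d : CohTyping (Prog.pmatch S n p b S') T T'),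
      (Prog.pmatch S n p b S').Classical →
      PInj d.sem ∧ ∀ u v, (Prog.pmatch S n p b S').Ev T T' u v ↔ d.sem v u = 1 := by
    intro T T' d hc
    simp only [Prog.Classical] at hc
    cases d with
    | pmatch ho dp ho' db =>
      simp only [CohTyping.sem]
      have hA := patterns_pInj hp dp fun j => (hc j).1
      have hB := patterns_pInj hb db fun j => (hc j).2
      have hAB := fun j => (hB j).mul (hA j).conjTranspose
      have hcol : ∀ {j k v v' u},
          ((db j).sem Valuation.empty * ((dp j).sem Valuation.empty)ᴴ) v u = 1 →
          ((db k).sem Valuation.empty * ((dp k).sem Valuation.empty)ᴴ) v' u = 1 → j = k := by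
        intro j k v v' u h h'
        obtain ⟨s, _, hs⟩ := ((hB j).mul_eq_one (hA j).conjTranspose).1 h
        obtain ⟨s', _, hs'⟩ := ((hB k).mul_eq_one (hA k).conjTranspose).1 h'
        exact (Sigma.mk.inj (PInj.select_unique hA (patterns_orthogonal hp ho dp)
          (conjTranspose_eq_one.1 hs) (conjTranspose_eq_one.1 hs'))).1
      refine ⟨PInj.sum hAB (fun {j k v u u'} h h' => ?_) hcol, fun u v => ?_⟩
      · obtain ⟨s, hs, _⟩ := ((hB j).mul_eq_one (hA j).conjTranspose).1 h
        obtain ⟨s', hs', _⟩ := ((hB k).mul_eq_one (hA k).conjTranspose).1 h'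
        exact (Sigma.mk.inj (PInj.select_unique hB (patterns_orthogonal hb ho' db) hs hs')).1
      · rw [PInj.sum_eq_one hAB hcol, Prog.Ev]
        exact exists_congr fun j =>
          (hp j).good.mul_conjTranspose_eq_one (hb j).good (hc j).1 (hc j).2 (dp j) (db j)
  have hiso : IsoProg (Prog.pmatch S n p b S') →
      ∀ {T T' : Ty} (d : CohTyping (Prog.pmatch S n p b S') T T'), d.semᴴ * d.sem = 1 := by
    intro hi T T' d
    cases hi with
    | pmatch hs h =>
      cases d with
      | pmatch ho dp ho' db =>
        simp only [CohTyping.sem]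
        rw [← hs.sum_ofFn hp dp, Matrix.conjTranspose_sum, Matrix.sum_mul]
        refine Finset.sum_congr rfl fun j _ => ?_
        rw [Matrix.mul_sum, Finset.sum_eq_single j]
        · rw [Matrix.conjTranspose_mul, Matrix.conjTranspose_conjTranspose, Matrix.mul_assoc,
            ← Matrix.mul_assoc _ ((db j).sem _), (hb j).good.iso (h j), Matrix.one_mul]
        · intro k _ hk
          rw [Matrix.conjTranspose_mul, Matrix.conjTranspose_conjTranspose, Matrix.mul_assoc,
            ← Matrix.mul_assoc _ ((db k).sem _), patterns_orthogonal hb ho' db j k hk.symm,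
            Matrix.zero_mul, Matrix.mul_zero]
        · simp
  refine ⟨hcoh, fun {T T'} d hc u => ?_, fun hdet {T T'} d d' => ?_, hiso,
    fun hi hc {T T'} d u => ?_⟩
  · cases d with
    | channel d =>
      simp only [ChanTyping.sem]
      exact (hcoh d hc).1.chan_isResult (hcoh d hc).2 u
  · simp only [Prog.Det] at hdet
    cases d with
    | @pmatch _ _ _ _ _ Δ ho dp ho' db =>
      cases d' with
      | @pmatch _ _ _ _ _ Δ' ho₁ dp' ho₁' db' =>
        obtain rfl : Δ = Δ' := funext fun k => (dp k).ctx_unique (dp' k) (ho.pat_ofFn k).not_null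
        simp only [CohTyping.sem]
        refine Finset.sum_congr rfl fun k _ => ?_
        rw [(hp k).good.unique (hdet k).1 (dp k) (dp' k),
          (hb k).good.unique (hdet k).2 (db k) (db' k)]
  · cases d with
    | channel d =>
      obtain ⟨v, hv⟩ := (hcoh d hc).1.exists_of_iso (hiso hi d) u
      exact ⟨v, ((hcoh d hc).2 u v).2 hv⟩

/-! ### The main theorem -/

mutual
  -- The recursion is on syntax alone: patterns and their programs are subterms, so the
  -- orthogonality and spanning lemmas used on the way have their hypotheses available.
  theorem Expr.hereditary : ∀ e : Expr, e.Hereditary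
    | .unit => by rw [Expr.Hereditary]; exact Expr.good_unit
    | .var x => by rw [Expr.Hereditary]; exact Expr.good_var x
    | .pair e₀ e₁ => by
        have h₀ := e₀.hereditary
        have h₁ := e₁.hereditary
        rw [Expr.Hereditary]
        exact ⟨Expr.good_pair h₀.good h₁.good, h₀, h₁⟩
    | .ctrl e T n p b T' => by
        have he := e.hereditary
        have hp := fun k => (p k).hereditary
        have hb := fun k => (b k).hereditary
        rw [Expr.Hereditary]
        exact Expr.good_ctrl he.good hp fun k => (hb k).good
    | .mmatch e T n p b T' => by
        have he := e.hereditary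
        have hp := fun k => (p k).hereditary
        have hb := fun k => (b k).hereditary
        rw [Expr.Hereditary]
        exact Expr.good_mmatch he.good hp fun k => (hb k).good
    | .tryCatch e₀ e₁ => by
        have h₀ := e₀.hereditary
        have h₁ := e₁.hereditary
        rw [Expr.Hereditary]
        exact Expr.good_tryCatch h₀.good h₁.good
    | .app f e => by
        have hf := f.good
        have he := e.hereditary
        rw [Expr.Hereditary]
        exact ⟨Expr.good_app hf he.good, hf, he⟩
  theorem Prog.good : ∀ f : Prog, f.Good
    | .u3 θ φ l => Prog.good_u3 θ φ l
    | .left T₀ T₁ => Prog.good_left T₀ T₁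
    | .right T₀ T₁ => Prog.good_right T₀ T₁
    | .lam T e e' => by
        have he := e.hereditary
        have he' := e'.hereditary
        exact Prog.good_lam he he'.good
    | .rphase T e r r' => by
        have he := e.hereditary
        exact Prog.good_rphase he.good r r'
    | .pmatch T n p b T' => by
        have hp := fun k => (p k).hereditary
        have hb := fun k => (b k).hereditary
        exact Prog.good_pmatch hp hb
end

end Qunity

theorem mainTheorem3 {T : Qunity.Ty} {es : List Qunity.Expr} (h : Qunity.Ortho T es)
    (i j : Fin es.length) (hij : i ≠ j) {Δi Δj : Qunity.Ctx}
    (di : Qunity.PureTyping Qunity.Ctx.empty Δi (es.get i) T)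
    (dj : Qunity.PureTyping Qunity.Ctx.empty Δj (es.get j) T) :
    LinearMap.range di.operator ⟂ LinearMap.range dj.operator := by
  have h1 := h.orthogonal (fun e _ => e.hereditary) hij _ _ di dj
  rw [Submodule.isOrtho_iff_inner_eq]
  rintro _ ⟨x, rfl⟩ _ ⟨y, rfl⟩
  unfold Qunity.PureTyping.operator
  -- Moving one operator across the inner product turns the claim into the vanishing of the matrix
  -- product in `h1`.
  rw [← LinearMap.adjoint_inner_right, ← Matrix.toEuclideanLin_conjTranspose_eq_adjoint,
    ← LinearMap.comp_apply, Matrix.toEuclideanLin, ← Matrix.toLpLin_mul_same, h1, map_zero,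
    LinearMap.zero_apply, inner_zero_right]
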